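/- Let $k$ be an algebraically closed field and let $X$ be either a complete scheme of finite type over $k$, or a complex space (in which case $k=\mathbb C$ and differentials are analytic). Let $D$ be an effective Cartier divisor on $X$, $\mathcal E$ a vector bundle of finite rank on $X$, and $\nabla:\mathcal E\to\mathcal E\otimes\Omega^1_X(D)$ a connection with divisor of poles $D$ (a $k$-linear morphism of sheaves satisfying the Leibniz rule; integrability is not assumed). Let $\mathcal C^\bullet$ be the two-term complex of sheaves $$\mathcal C^\bullet=\bigl[\mathcal End(\mathcal E)\xrightarrow{\ \nabla_{\mathcal End(\mathcal E)}\ }\mathcal End(\mathcal E)\otimes\Omega^1_X(D)\bigr],\qquad \nabla_{\mathcal End(\mathcal E)}(\varphi)=\nabla\circ\varphi-\varphi\circ\nabla,$$ placed in degrees $0$ and $1$, and let $\mathbb H^i(X,\mathcal C^\bullet)$ be its hypercohomology, i.e. the direct limit over the open coverings $\mathfrak U$ of $X$ of the cohomology of the total complex $\bigoplus_{p+q=i}\check C^p(\mathfrak U,\mathcal C^q)$ with differential $\check d+(-1)^p\nabla_{\mathcal End(\mathcal E)}$. Composition of endomorphisms and the Čech cup product define the Yoneda product $\mathbb H^1(X,\mathcal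 C^\bullet)\times\mathbb H^1(X,\mathcal C^\bullet)\to\mathbb H^2(X,\mathcal C^\bullet)$; the square of the class of a $1$-cocycle $(a,\mathcal A)$ is represented by $c^{2,0}_{\alpha\beta\gamma}=a_{\alpha\beta}a_{\beta\gamma}$, $c^{1,1}_{\alpha\beta}=a_{\alpha\beta}\mathcal A_\beta-\mathcal A_\alpha a_{\alpha\beta}$. Put $V_n=\operatorname{Spec}k[\epsilon]/(\epsilon^{n+1})$. A deformation of $(\mathcal E,\nabla)$ over $V_n$ with fixed divisor of poles $D$ is a vector bundle $\mathcal E_n$ on $X\times V_n$ with a connection $\nabla_n$ relative to $V_n$ with poles along $D\times V_n$, together with an isomorphism of its restriction to $X$ with $(\mathcal E,\nabla)$. Let $\mathfrak U=(U_\alpha)$ be an open covering of $X$ and let $(a_1,\mathcal A_1)\in\check C^1(\mathfrak U,\mathcal End(\mathcal E))\oplus\check C^0(\mathfrak U,\mathcal End(\mathcal E)\otimes\Omega^1_X(D))$ be a $1$-cocycle: $\check d a_1=0$, $\check d\mathcal A_1=\nabla_{\mathcal End(\mathcal E)}(a_1)$. Let $(\mathcal E_1,\nabla_1)$ be the first-order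 deformation given by $(a_1,\mathcal A_1)$: there are isomorphisms $\varphi_\alpha:\mathcal E|_{U_\alpha}\otimes_k k[\epsilon]/(\epsilon^2)\to\mathcal E_1|_{U_\alpha}$ lifting the identity of $\mathcal E|_{U_\alpha}$ with $$\varphi_\alpha^{-1}\varphi_\beta=1+\epsilon\,a_{\alpha\beta,1}\ \text{ on } U_\alpha\cap U_\beta,\qquad \varphi_\alpha^{-1}\nabla_1\varphi_\alpha=\nabla+\epsilon\,\mathcal A_{\alpha,1}\ \text{ on } U_\alpha .$$ Then $(\mathcal E_1,\nabla_1)$ extends to a deformation $(\mathcal E_2,\nabla_2)$ of $(\mathcal E,\nabla)$ over $V_2$ with fixed divisor of poles $D$ (that is, there is $(\mathcal E_2,\nabla_2)$ over $V_2$ whose restriction to $V_1$ is isomorphic to $(\mathcal E_1,\nabla_1)$) if and only if the Yoneda square $[a_1,\mathcal A_1]\circ[a_1,\mathcal A_1]$ vanishes in $\mathbb H^2(X,\mathcal C^\bullet)$. -/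

import Mathlib

open CategoryTheory TopologicalSpace Opposite AlgebraicGeometry
open scoped TensorProduct

universe u

/-- A two-term complex `d : C₀ → C₁` of presheaves of abelian groups on `T`, in which `C₀` is a
presheaf of (noncommutative) rings acting on `C₁` from both sides and `d` is a derivation. The
example of interest is `𝓔nd(E) → 𝓔nd(E) ⊗ Ω¹(D)` with its composition products, constructed below. -/
structure DGPair (T : TopCat.{u}) where
  C₀ : Opens T → Type u
  C₁ : Opens T → Type u
  [ring₀ : ∀ U, Ring (C₀ U)]
  [grp₁ : ∀ U, AddCommGroup (C₁ U)]
  res₀ : ∀ {U V : Opens T}, V ≤ U → C₀ U →+* C₀ V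
  res₁ : ∀ {U V : Opens T}, V ≤ U → C₁ U →+ C₁ V
  res₀_self : ∀ {U : Opens T} (x : C₀ U), res₀ le_rfl x = x
  res₁_self : ∀ {U : Opens T} (x : C₁ U), res₁ le_rfl x = x
  res₀_res₀ : ∀ {U V W : Opens T} (h : V ≤ U) (h' : W ≤ V) (x : C₀ U),
    res₀ h' (res₀ h x) = res₀ (h'.trans h) x
  res₁_res₁ : ∀ {U V W : Opens T} (h : V ≤ U) (h' : W ≤ V) (x : C₁ U),
    res₁ h' (res₁ h x) = res₁ (h'.trans h) x
  d : ∀ U, C₀ U →+ C₁ U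
  d_res : ∀ {U V : Opens T} (h : V ≤ U) (x : C₀ U), d V (res₀ h x) = res₁ h (d U x)
  lmul : ∀ U, C₀ U →+ C₁ U →+ C₁ U
  lmul_res : ∀ {U V : Opens T} (h : V ≤ U) (x : C₀ U) (y : C₁ U),
    lmul V (res₀ h x) (res₁ h y) = res₁ h (lmul U x y)
  rmul : ∀ U, C₁ U →+ C₀ U →+ C₁ U
  rmul_res : ∀ {U V : Opens T} (h : V ≤ U) (y : C₁ U) (x : C₀ U),
    rmul V (res₁ h y) (res₀ h x) = res₁ h (rmul U y x)
  leibniz : ∀ (U : Opens T) (x y : C₀ U), d U (x * y) = rmul U (d U x) y + lmul U x (d U y)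

namespace DGPair

attribute [instance] ring₀ grp₁

/-- An open covering of `T`. -/
structure Cover (T : TopCat.{u}) (ι : Type u) where
  U : ι → Opens T
  covers : ∀ x, ∃ i, x ∈ U i

section Cech

variable {T : TopCat.{u}} {ι : Type u} (𝔘 : Cover T ι)

abbrev Cover.U₂ (i j : ι) : Opens T := 𝔘.U i ⊓ 𝔘.U j
abbrev Cover.U₃ (i j l : ι) : Opens T := 𝔘.U i ⊓ 𝔘.U j ⊓ 𝔘.U l
abbrev Cover.U₄ (i j l m : ι) : Opens T := 𝔘.U i ⊓ 𝔘.U j ⊓ 𝔘.U l ⊓ 𝔘.U m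

theorem Cover.le₂₀ (i j : ι) : 𝔘.U₂ i j ≤ 𝔘.U i := inf_le_left
theorem Cover.le₂₁ (i j : ι) : 𝔘.U₂ i j ≤ 𝔘.U j := inf_le_right
theorem Cover.le₃₀₁ (i j l : ι) : 𝔘.U₃ i j l ≤ 𝔘.U₂ i j := inf_le_left
theorem Cover.le₃₀₂ (i j l : ι) : 𝔘.U₃ i j l ≤ 𝔘.U₂ i l :=
  le_inf (inf_le_left.trans inf_le_left) inf_le_right
theorem Cover.le₃₁₂ (i j l : ι) : 𝔘.U₃ i j l ≤ 𝔘.U₂ j l :=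
  le_inf (inf_le_left.trans inf_le_right) inf_le_right
theorem Cover.le₄₀₁₂ (i j l m : ι) : 𝔘.U₄ i j l m ≤ 𝔘.U₃ i j l := inf_le_left
theorem Cover.le₄₀₁₃ (i j l m : ι) : 𝔘.U₄ i j l m ≤ 𝔘.U₃ i j m :=
  le_inf (inf_le_left.trans inf_le_left) inf_le_right
theorem Cover.le₄₀₂₃ (i j l m : ι) : 𝔘.U₄ i j l m ≤ 𝔘.U₃ i l m :=
  le_inf (le_inf (inf_le_left.trans (inf_le_left.trans inf_le_left))
    (inf_le_left.trans inf_le_right)) inf_le_right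
theorem Cover.le₄₁₂₃ (i j l m : ι) : 𝔘.U₄ i j l m ≤ 𝔘.U₃ j l m :=
  le_inf (le_inf (inf_le_left.trans (inf_le_left.trans inf_le_right))
    (inf_le_left.trans inf_le_right)) inf_le_right

variable (F : Opens T → Type u) [∀ U, AddCommGroup (F U)]
  (r : ∀ {U V : Opens T}, V ≤ U → F U →+ F V)

abbrev Coch₀ : Type u := ∀ i, F (𝔘.U i)
abbrev Coch₁ : Type u := ∀ i j, F (𝔘.U₂ i j)
abbrev Coch₂ : Type u := ∀ i j l, F (𝔘.U₃ i j l)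
abbrev Coch₃ : Type u := ∀ i j l m, F (𝔘.U₄ i j l m)

variable {F}

/-- The Čech differentials of a presheaf `F` with restriction maps `r`. -/
def δ₀ : Coch₀ 𝔘 F →+ Coch₁ 𝔘 F :=
  AddMonoidHom.mk' (fun x i j => r (𝔘.le₂₁ i j) (x j) - r (𝔘.le₂₀ i j) (x i)) fun x y => by
    funext i j
    simp only [Pi.add_apply, map_add]
    abel

def δ₁ : Coch₁ 𝔘 F →+ Coch₂ 𝔘 F :=
  AddMonoidHom.mk' (fun x i j l => r (𝔘.le₃₁₂ i j l) (x j l) - r (𝔘.le₃₀₂ i j l) (x i l) +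
    r (𝔘.le₃₀₁ i j l) (x i j)) fun x y => by
    funext i j l
    simp only [Pi.add_apply, map_add]
    abel

def δ₂ : Coch₂ 𝔘 F →+ Coch₃ 𝔘 F :=
  AddMonoidHom.mk' (fun x i j l m => r (𝔘.le₄₁₂₃ i j l m) (x j l m) -
    r (𝔘.le₄₀₂₃ i j l m) (x i l m) + r (𝔘.le₄₀₁₃ i j l m) (x i j m) -
    r (𝔘.le₄₀₁₂ i j l m) (x i j l)) fun x y => by
    funext i j l m
    simp only [Pi.add_apply, map_add]
    abel

end Cech

section Total

variable {T : TopCat.{u}} (K : DGPair T) {ι : Type u} (𝔘 : Cover T ι)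

/-- The total complex `Lⁿ = ⨁_{p+q=n} Čᵖ(𝔘, C_q)` of the Čech double complex, with differential
`δ + (-1)ᵖ d` on `Čᵖ(𝔘, C_q)`, in degrees `0, 1, 2, 3`. -/
abbrev L₀ : Type u := Coch₀ 𝔘 K.C₀
abbrev L₁ : Type u := Coch₁ 𝔘 K.C₀ × Coch₀ 𝔘 K.C₁
abbrev L₂ : Type u := Coch₂ 𝔘 K.C₀ × Coch₁ 𝔘 K.C₁
abbrev L₃ : Type u := Coch₃ 𝔘 K.C₀ × Coch₂ 𝔘 K.C₁

def r₀ {U V : Opens T} (h : V ≤ U) : K.C₀ U →+ K.C₀ V := (K.res₀ h).toAddMonoidHom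

def D₀ : K.L₀ 𝔘 →+ K.L₁ 𝔘 :=
  AddMonoidHom.mk' (fun x => (δ₀ 𝔘 K.r₀ x, fun i => K.d _ (x i))) fun _ _ =>
    Prod.ext (map_add _ _ _) (funext fun _ => map_add _ _ _)

def D₁ : K.L₁ 𝔘 →+ K.L₂ 𝔘 :=
  AddMonoidHom.mk' (fun x => (δ₁ 𝔘 K.r₀ x.1, δ₀ 𝔘 K.res₁ x.2 - fun i j => K.d _ (x.1 i j)))
    fun x y => Prod.ext (map_add _ _ _) (funext fun i => funext fun j => by
      simp only [Prod.fst_add, Prod.snd_add, map_add, Pi.sub_apply, Pi.add_apply]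
      abel)

def D₂ : K.L₂ 𝔘 →+ K.L₃ 𝔘 :=
  AddMonoidHom.mk' (fun x => (δ₂ 𝔘 K.r₀ x.1, δ₁ 𝔘 K.res₁ x.2 + fun i j l => K.d _ (x.1 i j l)))
    fun x y => Prod.ext (map_add _ _ _) (funext fun i => funext fun j => funext fun l => by
      simp only [Prod.fst_add, Prod.snd_add, map_add, Pi.add_apply]
      abel)

theorem r₀_apply {U V : Opens T} (h : V ≤ U) (x : K.C₀ U) : K.r₀ h x = K.res₀ h x := rfl

theorem D₁_D₀ (x : K.L₀ 𝔘) : K.D₁ 𝔘 (K.D₀ 𝔘 x) = 0 := by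
  refine Prod.ext (funext fun i => funext fun j => funext fun l => ?_)
    (funext fun i => funext fun j => ?_)
  · simp only [D₀, D₁, δ₀, δ₁, AddMonoidHom.mk'_apply, map_sub, r₀_apply, K.res₀_res₀,
      Prod.fst_zero, Pi.zero_apply]
    abel
  · simp only [D₀, D₁, δ₀, AddMonoidHom.mk'_apply, map_sub, r₀_apply, K.d_res,
      Prod.snd_zero, Pi.zero_apply, Pi.sub_apply]
    abel

theorem D₂_D₁ (x : K.L₁ 𝔘) : K.D₂ 𝔘 (K.D₁ 𝔘 x) = 0 := by
  refine Prod.ext (funext fun i => funext fun j => funext fun l => funext fun m => ?_)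
    (funext fun i => funext fun j => funext fun l => ?_)
  · simp only [D₁, D₂, δ₁, δ₂, AddMonoidHom.mk'_apply, map_sub, map_add, r₀_apply, K.res₀_res₀,
      Prod.fst_zero, Pi.zero_apply]
    abel
  · simp only [D₁, D₂, δ₀, δ₁, AddMonoidHom.mk'_apply, map_sub, map_add, r₀_apply, K.d_res,
      K.res₁_res₁, Prod.snd_zero, Pi.zero_apply, Pi.sub_apply, Pi.add_apply]
    abel

/-- Cocycles and cohomology groups `Hⁿ(L, D)` for `n = 1, 2`. -/
def Z₁ : AddSubgroup (K.L₁ 𝔘) := (K.D₁ 𝔘).ker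
def Z₂ : AddSubgroup (K.L₂ 𝔘) := (K.D₂ 𝔘).ker
def H₁ : Type u := K.Z₁ 𝔘 ⧸ (K.D₀ 𝔘).range.addSubgroupOf (K.Z₁ 𝔘)
def H₂ : Type u := K.Z₂ 𝔘 ⧸ (K.D₁ 𝔘).range.addSubgroupOf (K.Z₂ 𝔘)

instance : AddCommGroup (K.H₁ 𝔘) :=
  inferInstanceAs (AddCommGroup (K.Z₁ 𝔘 ⧸ (K.D₀ 𝔘).range.addSubgroupOf (K.Z₁ 𝔘)))
instance : AddCommGroup (K.H₂ 𝔘) :=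
  inferInstanceAs (AddCommGroup (K.Z₂ 𝔘 ⧸ (K.D₁ 𝔘).range.addSubgroupOf (K.Z₂ 𝔘)))

def mk₁ : K.Z₁ 𝔘 →+ K.H₁ 𝔘 := QuotientAddGroup.mk' _
def mk₂ : K.Z₂ 𝔘 →+ K.H₂ 𝔘 := QuotientAddGroup.mk' _

variable {𝔘}

theorem mk₁_eq_zero (z : K.Z₁ 𝔘) : K.mk₁ 𝔘 z = 0 ↔ ∃ x, K.D₀ 𝔘 x = z.1 :=
  (QuotientAddGroup.eq_zero_iff z).trans Iff.rfl

theorem mk₂_eq_zero (z : K.Z₂ 𝔘) : K.mk₂ 𝔘 z = 0 ↔ ∃ x, K.D₁ 𝔘 x = z.1 :=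
  (QuotientAddGroup.eq_zero_iff z).trans Iff.rfl

theorem mem_Z₁ (z : K.L₁ 𝔘) : z ∈ K.Z₁ 𝔘 ↔
    (∀ i j l, K.res₀ (𝔘.le₃₀₂ i j l) (z.1 i l) =
      K.res₀ (𝔘.le₃₀₁ i j l) (z.1 i j) + K.res₀ (𝔘.le₃₁₂ i j l) (z.1 j l)) ∧
    ∀ i j, K.d _ (z.1 i j) = K.res₁ (𝔘.le₂₁ i j) (z.2 j) - K.res₁ (𝔘.le₂₀ i j) (z.2 i) := by
  refine (Prod.ext_iff (x := K.D₁ 𝔘 z) (y := 0)).trans (and_congr ?_ ?_)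
  · simp only [funext_iff]
    refine forall_congr' fun i => forall_congr' fun j => forall_congr' fun l => ?_
    change K.res₀ _ (z.1 j l) - K.res₀ _ (z.1 i l) + K.res₀ _ (z.1 i j) = 0 ↔ _
    rw [sub_add_eq_add_sub, sub_eq_zero, eq_comm, add_comm]
  · simp only [funext_iff]
    refine forall_congr' fun i => forall_congr' fun j => ?_
    change K.res₁ _ (z.2 j) - K.res₁ _ (z.2 i) - K.d _ (z.1 i j) = 0 ↔ _
    rw [sub_eq_zero, eq_comm]

variable (𝔘)

/-- The product of `1`-cochains of the total complex: composition of coefficients together with the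
Čech cup product `(x ∪ y)_{α₀…α_{p+r}} = (-1)^{q r} x_{α₀…α_p} y_{α_p…α_{p+r}}` for `x` of
bidegree `(p, q)` and `y` of bidegree `(r, s)`; so `(a, A) ∪ (b, B)` has the components
`a_{αβ} b_{βγ}` and `a_{αβ} B_β - A_α b_{αβ}`. -/
def cup : K.L₁ 𝔘 →+ K.L₁ 𝔘 →+ K.L₂ 𝔘 :=
  AddMonoidHom.mk' (fun z => AddMonoidHom.mk' (fun w =>
      (fun i j l => K.res₀ (𝔘.le₃₀₁ i j l) (z.1 i j) * K.res₀ (𝔘.le₃₁₂ i j l) (w.1 j l),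
       fun i j => K.lmul _ (z.1 i j) (K.res₁ (𝔘.le₂₁ i j) (w.2 j)) -
          K.rmul _ (K.res₁ (𝔘.le₂₀ i j) (z.2 i)) (w.1 i j)))
      (fun w w' => Prod.ext
        (funext fun i => funext fun j => funext fun l => by
          simp only [Prod.fst_add, Pi.add_apply, map_add, mul_add])
        (funext fun i => funext fun j => by
          simp only [Prod.fst_add, Prod.snd_add, Pi.add_apply, map_add]
          abel)))
    (fun z z' => AddMonoidHom.ext fun w => Prod.ext
        (funext fun i => funext fun j => funext fun l => by
          simp only [AddMonoidHom.mk'_apply, AddMonoidHom.add_apply, Prod.fst_add, Pi.add_apply,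
            map_add, add_mul])
        (funext fun i => funext fun j => by
          simp only [AddMonoidHom.mk'_apply, AddMonoidHom.add_apply, Prod.fst_add, Prod.snd_add,
            Pi.add_apply, map_add]
          abel))

variable {𝔘}

theorem cup_mem {z w : K.L₁ 𝔘} (hz : z ∈ K.Z₁ 𝔘) (hw : w ∈ K.Z₁ 𝔘) :
    K.cup 𝔘 z w ∈ K.Z₂ 𝔘 := by
  rw [mem_Z₁] at hz hw
  obtain ⟨hz0, hz1⟩ := hz
  obtain ⟨hw0, hw1⟩ := hw
  refine Prod.ext (funext fun i => funext fun j => funext fun l => funext fun m => ?_)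
    (funext fun i => funext fun j => funext fun l => ?_)
  · have e1 := congrArg (K.res₀ (𝔘.le₄₀₁₂ i j l m)) (hz0 i j l)
    have e2 := congrArg (K.res₀ (𝔘.le₄₁₂₃ i j l m)) (hw0 j l m)
    simp only [map_add, K.res₀_res₀] at e1 e2
    simp only [cup, D₂, δ₂, AddMonoidHom.mk'_apply, r₀_apply, map_mul, K.res₀_res₀,
      Prod.fst_zero, Pi.zero_apply, e1, e2]
    noncomm_ring
  · have e1 := hw0 i j l
    have e2 := hz0 i j l
    simp only [cup, D₂, δ₁, AddMonoidHom.mk'_apply, map_sub, ← K.lmul_res, ← K.rmul_res,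
      K.res₁_res₁, K.leibniz, K.d_res, hz1, hw1, Prod.snd_zero, Pi.zero_apply, Pi.add_apply,
      AddMonoidHom.sub_apply, e1, e2, map_add, AddMonoidHom.add_apply]
    abel

theorem cup_D₀_left (x : K.L₀ 𝔘) {w : K.L₁ 𝔘} (hw : w ∈ K.Z₁ 𝔘) :
    ∃ y, K.D₁ 𝔘 y = K.cup 𝔘 (K.D₀ 𝔘 x) w := by
  rw [mem_Z₁] at hw
  obtain ⟨hw0, hw1⟩ := hw
  refine ⟨(fun i j => K.res₀ (𝔘.le₂₀ i j) (x i) * w.1 i j, fun i => K.lmul _ (x i) (w.2 i)),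
    Prod.ext (funext fun i => funext fun j => funext fun l => ?_)
      (funext fun i => funext fun j => ?_)⟩
  · have e1 := hw0 i j l
    simp only [cup, D₀, D₁, δ₀, δ₁, AddMonoidHom.mk'_apply, map_sub, r₀_apply, map_mul,
      K.res₀_res₀, e1]
    noncomm_ring
  · simp only [cup, D₀, D₁, δ₀, AddMonoidHom.mk'_apply, map_sub, r₀_apply, K.leibniz, K.d_res,
      hw1, ← K.lmul_res, Pi.sub_apply, AddMonoidHom.sub_apply]
    abel

theorem cup_D₀_right {z : K.L₁ 𝔘} (hz : z ∈ K.Z₁ 𝔘) (x : K.L₀ 𝔘) :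
    ∃ y, K.D₁ 𝔘 y = K.cup 𝔘 z (K.D₀ 𝔘 x) := by
  rw [mem_Z₁] at hz
  obtain ⟨hz0, hz1⟩ := hz
  refine ⟨-(fun i j => z.1 i j * K.res₀ (𝔘.le₂₁ i j) (x j), fun i => K.rmul _ (z.2 i) (x i)),
    Prod.ext (funext fun i => funext fun j => funext fun l => ?_)
      (funext fun i => funext fun j => ?_)⟩
  · have e1 := hz0 i j l
    simp only [cup, D₀, D₁, δ₀, δ₁, AddMonoidHom.mk'_apply, map_sub, r₀_apply, map_mul, map_neg,
      K.res₀_res₀, e1, Prod.fst_neg, Pi.neg_apply]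
    noncomm_ring
  · simp only [cup, D₀, D₁, δ₀, AddMonoidHom.mk'_apply, map_sub, map_neg, r₀_apply, K.leibniz,
      K.d_res, hz1, ← K.rmul_res, Pi.sub_apply, AddMonoidHom.sub_apply,
      Prod.snd_neg, Pi.neg_apply]
    abel

variable (𝔘)

/-- The Yoneda product `H¹(𝔘) × H¹(𝔘) → H²(𝔘)`. -/
def yonedaCover : K.H₁ 𝔘 →+ K.H₁ 𝔘 →+ K.H₂ 𝔘 :=
  QuotientAddGroup.lift _
    (AddMonoidHom.mk' (fun z => QuotientAddGroup.lift _
        (AddMonoidHom.mk' (fun w => K.mk₂ 𝔘 ⟨K.cup 𝔘 z.1 w.1, K.cup_mem z.2 w.2⟩)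
          (fun w w' => by
            rw [← map_add]
            exact congrArg _ (Subtype.ext (map_add (K.cup 𝔘 z.1) w.1 w'.1))))
        (fun w hw => by
          obtain ⟨x, hx⟩ := hw
          refine (K.mk₂_eq_zero _).2 ?_
          change ∃ y, K.D₁ 𝔘 y = K.cup 𝔘 z.1 ((K.Z₁ 𝔘).subtype w)
          rw [← hx]
          exact K.cup_D₀_right z.2 x))
      (fun z z' => by
        refine AddMonoidHom.ext fun q => ?_
        induction q using QuotientAddGroup.induction_on with
        | H w =>
          change K.mk₂ 𝔘 _ = K.mk₂ 𝔘 _ + K.mk₂ 𝔘 _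
          rw [← map_add]
          exact congrArg _ (Subtype.ext
            (DFunLike.congr_fun (map_add (K.cup 𝔘) z.1 z'.1) w.1))))
    (fun z hz => by
      obtain ⟨x, hx⟩ := hz
      refine AddMonoidHom.ext fun q => ?_
      induction q using QuotientAddGroup.induction_on with
      | H w =>
        refine (K.mk₂_eq_zero _).2 ?_
        change ∃ y, K.D₁ 𝔘 y = K.cup 𝔘 ((K.Z₁ 𝔘).subtype z) w.1
        rw [← hx]
        exact K.cup_D₀_left x w.2)

theorem yonedaCover_mk (z w : K.Z₁ 𝔘) : K.yonedaCover 𝔘 (K.mk₁ 𝔘 z) (K.mk₁ 𝔘 w) =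
    K.mk₂ 𝔘 ⟨K.cup 𝔘 z.1 w.1, K.cup_mem z.2 w.2⟩ := rfl

end Total

section Refinement

variable {T : TopCat.{u}} (K : DGPair T) {ι κ : Type u} {𝔘 : Cover T ι} {𝔙 : Cover T κ}
  (τ : κ → ι) (h : ∀ j, 𝔙.U j ≤ 𝔘.U (τ j))

/-- Pull-back of cochains to a refinement `𝔙` of `𝔘`, with refinement map `τ`. -/
def pull₀ : K.L₀ 𝔘 →+ K.L₀ 𝔙 :=
  AddMonoidHom.mk' (fun x i => K.res₀ (h i) (x (τ i))) fun _ _ => funext fun _ => map_add _ _ _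

def pull₁ : K.L₁ 𝔘 →+ K.L₁ 𝔙 :=
  AddMonoidHom.mk' (fun x => (fun i j => K.res₀ (inf_le_inf (h i) (h j)) (x.1 (τ i) (τ j)),
      fun i => K.res₁ (h i) (x.2 (τ i))))
    fun _ _ => Prod.ext (funext fun _ => funext fun _ => map_add _ _ _)
      (funext fun _ => map_add _ _ _)

def pull₂ : K.L₂ 𝔘 →+ K.L₂ 𝔙 :=
  AddMonoidHom.mk' (fun x =>
      (fun i j l => K.res₀ (inf_le_inf (inf_le_inf (h i) (h j)) (h l)) (x.1 (τ i) (τ j) (τ l)),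
       fun i j => K.res₁ (inf_le_inf (h i) (h j)) (x.2 (τ i) (τ j))))
    fun _ _ => Prod.ext (funext fun _ => funext fun _ => funext fun _ => map_add _ _ _)
      (funext fun _ => funext fun _ => map_add _ _ _)

def pull₃ : K.L₃ 𝔘 →+ K.L₃ 𝔙 :=
  AddMonoidHom.mk' (fun x =>
      (fun i j l m => K.res₀ (inf_le_inf (inf_le_inf (inf_le_inf (h i) (h j)) (h l)) (h m))
          (x.1 (τ i) (τ j) (τ l) (τ m)),
       fun i j l => K.res₁ (inf_le_inf (inf_le_inf (h i) (h j)) (h l)) (x.2 (τ i) (τ j) (τ l))))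
    fun _ _ => Prod.ext
      (funext fun _ => funext fun _ => funext fun _ => funext fun _ => map_add _ _ _)
      (funext fun _ => funext fun _ => funext fun _ => map_add _ _ _)

theorem D₀_pull (x : K.L₀ 𝔘) : K.D₀ 𝔙 (K.pull₀ τ h x) = K.pull₁ τ h (K.D₀ 𝔘 x) := by
  refine Prod.ext (funext fun i => funext fun j => ?_) (funext fun i => ?_)
  · simp only [D₀, δ₀, pull₀, pull₁, AddMonoidHom.mk'_apply, r₀_apply, map_sub, K.res₀_res₀]
  · simp only [D₀, pull₀, pull₁, AddMonoidHom.mk'_apply, K.d_res]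

theorem D₁_pull (x : K.L₁ 𝔘) : K.D₁ 𝔙 (K.pull₁ τ h x) = K.pull₂ τ h (K.D₁ 𝔘 x) := by
  refine Prod.ext (funext fun i => funext fun j => funext fun l => ?_)
    (funext fun i => funext fun j => ?_)
  · simp only [D₁, δ₁, pull₁, pull₂, AddMonoidHom.mk'_apply, r₀_apply, map_sub, map_add,
      K.res₀_res₀]
  · simp only [D₁, δ₀, pull₁, pull₂, AddMonoidHom.mk'_apply, K.d_res, map_sub, K.res₁_res₁,
      Pi.sub_apply]

theorem D₂_pull (x : K.L₂ 𝔘) : K.D₂ 𝔙 (K.pull₂ τ h x) = K.pull₃ τ h (K.D₂ 𝔘 x) := by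
  refine Prod.ext (funext fun i => funext fun j => funext fun l => funext fun m => ?_)
    (funext fun i => funext fun j => funext fun l => ?_)
  · simp only [D₂, δ₂, pull₂, pull₃, AddMonoidHom.mk'_apply, r₀_apply, map_sub, map_add,
      K.res₀_res₀]
  · simp only [D₂, δ₁, pull₂, pull₃, AddMonoidHom.mk'_apply, K.d_res, map_sub, map_add,
      K.res₁_res₁, Pi.add_apply]

theorem cup_pull (z w : K.L₁ 𝔘) :
    K.cup 𝔙 (K.pull₁ τ h z) (K.pull₁ τ h w) = K.pull₂ τ h (K.cup 𝔘 z w) := by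
  refine Prod.ext (funext fun i => funext fun j => funext fun l => ?_)
    (funext fun i => funext fun j => ?_)
  · simp only [cup, pull₁, pull₂, AddMonoidHom.mk'_apply, map_mul, K.res₀_res₀]
  · simp only [cup, pull₁, pull₂, AddMonoidHom.mk'_apply, map_sub, ← K.lmul_res, ← K.rmul_res,
      K.res₁_res₁]

theorem pull₁_mem {z : K.L₁ 𝔘} (hz : z ∈ K.Z₁ 𝔘) : K.pull₁ τ h z ∈ K.Z₁ 𝔙 := by
  change K.D₁ 𝔙 (K.pull₁ τ h z) = 0
  rw [D₁_pull, show K.D₁ 𝔘 z = 0 from hz, map_zero]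

theorem pull₂_mem {z : K.L₂ 𝔘} (hz : z ∈ K.Z₂ 𝔘) : K.pull₂ τ h z ∈ K.Z₂ 𝔙 := by
  change K.D₂ 𝔙 (K.pull₂ τ h z) = 0
  rw [D₂_pull, show K.D₂ 𝔘 z = 0 from hz, map_zero]

def pullZ₁ : K.Z₁ 𝔘 →+ K.Z₁ 𝔙 :=
  AddMonoidHom.mk' (fun z => ⟨K.pull₁ τ h z.1, K.pull₁_mem τ h z.2⟩)
    fun z w => Subtype.ext (map_add (K.pull₁ τ h) z.1 w.1)

def pullZ₂ : K.Z₂ 𝔘 →+ K.Z₂ 𝔙 :=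
  AddMonoidHom.mk' (fun z => ⟨K.pull₂ τ h z.1, K.pull₂_mem τ h z.2⟩)
    fun z w => Subtype.ext (map_add (K.pull₂ τ h) z.1 w.1)

def pullH₁ : K.H₁ 𝔘 →+ K.H₁ 𝔙 :=
  QuotientAddGroup.map _ _ (K.pullZ₁ τ h) (by
    rintro z ⟨x, hx⟩
    exact ⟨K.pull₀ τ h x, (K.D₀_pull τ h x).trans (congrArg _ hx)⟩)

def pullH₂ : K.H₂ 𝔘 →+ K.H₂ 𝔙 :=
  QuotientAddGroup.map _ _ (K.pullZ₂ τ h) (by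
    rintro z ⟨x, hx⟩
    exact ⟨K.pull₁ τ h x, (K.D₁_pull τ h x).trans (congrArg _ hx)⟩)

theorem pullH₁_mk (z : K.Z₁ 𝔘) : K.pullH₁ τ h (K.mk₁ 𝔘 z) = K.mk₁ 𝔙 (K.pullZ₁ τ h z) := rfl

theorem pullH₂_mk (z : K.Z₂ 𝔘) : K.pullH₂ τ h (K.mk₂ 𝔘 z) = K.mk₂ 𝔙 (K.pullZ₂ τ h z) := rfl

theorem mk₁_surjective (x : K.H₁ 𝔘) : ∃ z, K.mk₁ 𝔘 z = x := QuotientAddGroup.mk'_surjective _ x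

theorem mk₂_surjective (x : K.H₂ 𝔘) : ∃ z, K.mk₂ 𝔘 z = x := QuotientAddGroup.mk'_surjective _ x

theorem yonedaCover_pull (x y : K.H₁ 𝔘) : K.yonedaCover 𝔙 (K.pullH₁ τ h x) (K.pullH₁ τ h y) =
    K.pullH₂ τ h (K.yonedaCover 𝔘 x y) := by
  obtain ⟨z, rfl⟩ := K.mk₁_surjective x
  obtain ⟨w, rfl⟩ := K.mk₁_surjective y
  rw [pullH₁_mk, pullH₁_mk, yonedaCover_mk, yonedaCover_mk, pullH₂_mk]
  exact congrArg _ (Subtype.ext (K.cup_pull τ h z.1 w.1))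

end Refinement

section Limit

/-- Open coverings indexed by the points of the space, with `x ∈ U x`, ordered by refinement. Every
open covering is refined by one of these. -/
structure PCover (T : TopCat.{u}) where
  U : T → Opens T
  mem : ∀ x, x ∈ U x

variable {T : TopCat.{u}}

instance : Preorder (PCover T) where
  le 𝔘 𝔙 := ∀ x, 𝔙.U x ≤ 𝔘.U x
  le_refl _ _ := le_rfl
  le_trans _ _ _ h h' x := (h' x).trans (h x)

instance : IsDirectedOrder (PCover T) where
  directed 𝔘 𝔙 := ⟨⟨fun x => 𝔘.U x ⊓ 𝔙.U x, fun x => ⟨𝔘.mem x, 𝔙.mem x⟩⟩,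
    fun _ => inf_le_left, fun _ => inf_le_right⟩

instance : Nonempty (PCover T) := ⟨⟨fun _ => ⊤, fun _ => trivial⟩⟩

abbrev PCover.toCover (𝔘 : PCover T) : Cover T T := ⟨𝔘.U, fun x => ⟨x, 𝔘.mem x⟩⟩

variable (K : DGPair T)

abbrev trans₁ (𝔘 𝔙 : PCover T) (h : 𝔘 ≤ 𝔙) : K.H₁ 𝔘.toCover →+ K.H₁ 𝔙.toCover :=
  K.pullH₁ (𝔘 := 𝔘.toCover) (𝔙 := 𝔙.toCover) id h

abbrev trans₂ (𝔘 𝔙 : PCover T) (h : 𝔘 ≤ 𝔙) : K.H₂ 𝔘.toCover →+ K.H₂ 𝔙.toCover :=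
  K.pullH₂ (𝔘 := 𝔘.toCover) (𝔙 := 𝔙.toCover) id h

instance : DirectedSystem (fun 𝔘 : PCover T => K.H₁ 𝔘.toCover) (K.trans₁ · · ·) where
  map_self 𝔘 x := by
    obtain ⟨z, rfl⟩ := K.mk₁_surjective x
    exact congrArg (K.mk₁ _) (Subtype.ext (Prod.ext
      (funext fun i => funext fun j => K.res₀_self _) (funext fun i => K.res₁_self _)))
  map_map 𝔚 𝔙 𝔘 h h' x := by
    obtain ⟨z, rfl⟩ := K.mk₁_surjective x
    exact congrArg (K.mk₁ _) (Subtype.ext (Prod.ext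
      (funext fun i => funext fun j => K.res₀_res₀ _ _ _) (funext fun i => K.res₁_res₁ _ _ _)))

instance : DirectedSystem (fun 𝔘 : PCover T => K.H₂ 𝔘.toCover) (K.trans₂ · · ·) where
  map_self 𝔘 x := by
    obtain ⟨z, rfl⟩ := K.mk₂_surjective x
    exact congrArg (K.mk₂ _) (Subtype.ext (Prod.ext
      (funext fun i => funext fun j => funext fun l => K.res₀_self _)
      (funext fun i => funext fun j => K.res₁_self _)))
  map_map 𝔚 𝔙 𝔘 h h' x := by
    obtain ⟨z, rfl⟩ := K.mk₂_surjective x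
    exact congrArg (K.mk₂ _) (Subtype.ext (Prod.ext
      (funext fun i => funext fun j => funext fun l => K.res₀_res₀ _ _ _)
      (funext fun i => funext fun j => K.res₁_res₁ _ _ _)))

/-- Hypercohomology `ℍ¹(T, K)`, the direct limit over all open coverings of the cohomology of the
total Čech complex. -/
abbrev HH₁ : Type u := DirectLimit (fun 𝔘 : PCover T => K.H₁ 𝔘.toCover) K.trans₁

/-- Hypercohomology `ℍ²(T, K)`. -/
abbrev HH₂ : Type u := DirectLimit (fun 𝔘 : PCover T => K.H₂ 𝔘.toCover) K.trans₂

/-- The Yoneda product `ℍ¹(T, K) × ℍ¹(T, K) → ℍ²(T, K)`. -/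
noncomputable def yoneda : K.HH₁ → K.HH₁ → K.HH₂ :=
  DirectLimit.map₂ K.trans₁ K.trans₁ K.trans₂ (fun 𝔘 x y => K.yonedaCover 𝔘.toCover x y)
    fun 𝔘 𝔙 h x y =>
      (K.yonedaCover_pull (𝔘 := 𝔘.toCover) (𝔙 := 𝔙.toCover) id h x y).symm

variable {K} {ι : Type u} {𝔘 : Cover T ι}

/-- A choice of a member of the covering containing `x`. -/
noncomputable def Cover.index (𝔘 : Cover T ι) (x : T) : ι := (𝔘.covers x).choose

noncomputable abbrev Cover.toPCover (𝔘 : Cover T ι) : PCover T :=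
  ⟨fun x => 𝔘.U (𝔘.index x), fun x => (𝔘.covers x).choose_spec⟩

theorem Cover.toPCover_le (𝔘 : Cover T ι) (x : T) :
    𝔘.toPCover.toCover.U x ≤ 𝔘.U (𝔘.index x) := le_rfl

/-- The class in `ℍ¹(T, K)` of a `1`-cocycle on an open covering. -/
noncomputable def cls (z : K.Z₁ 𝔘) : K.HH₁ :=
  Quotient.mk _ ⟨𝔘.toPCover, K.pullH₁ 𝔘.index 𝔘.toPCover_le (K.mk₁ 𝔘 z)⟩

/-- The class does not depend on the chosen refinement map. -/
theorem cls_eq (z : K.Z₁ 𝔘) (τ : T → ι) (𝔙 : PCover T) (h : ∀ x, 𝔙.U x ≤ 𝔘.U (τ x)) :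
    cls z = (Quotient.mk _ ⟨𝔙, K.pullH₁ (𝔙 := 𝔙.toCover) τ h (K.mk₁ 𝔘 z)⟩ : K.HH₁) := by
  obtain ⟨hz0, hz1⟩ := (K.mem_Z₁ z.1).1 z.2
  let σ : T → ι := 𝔘.index
  let 𝔚 : PCover T := ⟨fun x => 𝔘.U (σ x) ⊓ 𝔙.U x, fun x => ⟨𝔘.toPCover.mem x, 𝔙.mem x⟩⟩
  have h₁ : ∀ x, 𝔚.toCover.U x ≤ 𝔘.U₂ (σ x) (τ x) := fun x => inf_le_inf le_rfl (h x)
  refine Quotient.sound ⟨𝔚, fun _ => inf_le_left, fun _ => inf_le_right, ?_⟩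
  rw [← sub_eq_zero]
  dsimp only
  change K.mk₁ 𝔚.toCover (K.pullZ₁ _ _ (K.pullZ₁ _ _ z)) -
    K.mk₁ 𝔚.toCover (K.pullZ₁ _ _ (K.pullZ₁ _ _ z)) = 0
  rw [← map_sub, mk₁_eq_zero]
  let b : K.L₀ 𝔚.toCover := fun x => K.res₀ (h₁ x) (z.1.1 (σ x) (τ x))
  refine ⟨-b, (map_neg _ b).trans (neg_eq_iff_eq_neg.2 ?_)⟩
  refine Prod.ext (funext fun x => funext fun y => ?_) (funext fun x => ?_)
  · have hσ : 𝔚.toCover.U₂ x y ≤ 𝔘.U₃ (σ x) (σ y) (τ y) :=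
      le_inf (le_inf (inf_le_left.trans ((h₁ x).trans inf_le_left))
        (inf_le_right.trans ((h₁ y).trans inf_le_left)))
        (inf_le_right.trans ((h₁ y).trans inf_le_right))
    have hτ : 𝔚.toCover.U₂ x y ≤ 𝔘.U₃ (σ x) (τ x) (τ y) :=
      le_inf (le_inf (inf_le_left.trans ((h₁ x).trans inf_le_left))
        (inf_le_left.trans ((h₁ x).trans inf_le_right)))
        (inf_le_right.trans ((h₁ y).trans inf_le_right))
    have e1 := congrArg (K.res₀ hσ) (hz0 (σ x) (σ y) (τ y))
    have e2 := congrArg (K.res₀ hτ) (hz0 (σ x) (τ x) (τ y))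
    simp only [map_add, K.res₀_res₀] at e1 e2
    change K.res₀ _ (K.res₀ _ _) - K.res₀ _ (K.res₀ _ _) =
      -(K.res₀ _ (K.res₀ _ _) - K.res₀ _ (K.res₀ _ _))
    simp only [K.res₀_res₀]
    rw [e1] at e2
    rw [neg_sub, sub_eq_sub_iff_add_eq_add, add_comm]
    exact e2.trans (add_comm _ _)
  · change K.d _ (K.res₀ _ _) = -(K.res₁ _ (K.res₁ _ _) - K.res₁ _ (K.res₁ _ _))
    rw [K.d_res, hz1]
    simp only [map_sub, K.res₁_res₁, neg_sub]
    rfl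

end Limit

end DGPair

/-- Which `1`-forms are used on a locally ringed space over `k`: the algebraic Kähler differentials or
the analytic ones. -/
inductive FormKind : Type
  | algebraic
  | analytic

/-- A locally ringed space over the field `k`. The `k`-algebra structure of the structure sheaf is
given by `structureMap`. -/
structure KSpace (k : Type u) [Field k] where
  toLRS : LocallyRingedSpace.{u}
  structureMap : k →+* toLRS.presheaf.obj (op ⊤)
  kind : FormKind

namespace KSpace

section Functions

variable {k : Type u} [Field k] (X : KSpace k)

/-- The points of `X`. -/
abbrev Pt : Type u := X.toLRS.toTopCat

/-- Functions on `U`, that is `Γ(U, 𝒪_X)`. -/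
def Fn (U : Opens X.Pt) : Type u := X.toLRS.presheaf.obj (op U)

noncomputable instance (U : Opens X.Pt) : CommRing (X.Fn U) :=
  inferInstanceAs (CommRing (X.toLRS.presheaf.obj (op U)))

noncomputable def resFn {U V : Opens X.Pt} (h : V ≤ U) : X.Fn U →+* X.Fn V :=
  (X.toLRS.presheaf.map (homOfLE h).op).hom

noncomputable def constFn (U : Opens X.Pt) : k →+* X.Fn U :=
  (X.resFn (le_top : U ≤ ⊤)).comp X.structureMap

def Stalk (x : X.Pt) : Type u := X.toLRS.presheaf.stalk x

noncomputable instance (x : X.Pt) : CommRing (X.Stalk x) :=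
  inferInstanceAs (CommRing (X.toLRS.presheaf.stalk x))

instance (x : X.Pt) : IsLocalRing (X.Stalk x) :=
  inferInstanceAs (IsLocalRing (X.toLRS.presheaf.stalk x))

noncomputable def germ {U : Opens X.Pt} (x : X.Pt) (hx : x ∈ U) : X.Fn U →+* X.Stalk x :=
  (X.toLRS.presheaf.germ U x hx).hom

theorem germ_resFn {U V : Opens X.Pt} (h : V ≤ U) (x : X.Pt) (hx : x ∈ V) (f : X.Fn U) :
    X.germ x hx (X.resFn h f) = X.germ x (h hx) f :=
  TopCat.Presheaf.germ_res_apply X.toLRS.presheaf (homOfLE h) x hx f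

noncomputable instance (x : X.Pt) : Algebra k (X.Stalk x) :=
  ((X.germ x (Opens.mem_top x)).comp X.structureMap).toAlgebra

theorem resFn_self {U : Opens X.Pt} (f : X.Fn U) : X.resFn le_rfl f = f :=
  congrArg (fun g => g.hom f) (X.toLRS.presheaf.map_id (op U))

theorem resFn_resFn {U V W : Opens X.Pt} (h : V ≤ U) (h' : W ≤ V) (f : X.Fn U) :
    X.resFn h' (X.resFn h f) = X.resFn (h'.trans h) f :=
  (congrArg (fun g => g.hom f)
    (X.toLRS.presheaf.map_comp (homOfLE h).op (homOfLE h').op)).symm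

/-- The structure sheaf as a sheaf of rings. -/
noncomputable def ringSheaf : Sheaf (Opens.grothendieckTopology X.Pt) RingCat.{u} :=
  (sheafCompose (Opens.grothendieckTopology X.toLRS.toTopCat)
    (forget₂ CommRingCat.{u} RingCat.{u})).obj X.toLRS.sheaf

/-- Sheaves of `𝒪_X`-modules. -/
abbrev Mods := SheafOfModules.{u} X.ringSheaf
variable {X}

/-- Sections of a sheaf of modules. -/
def Sec (E : X.Mods) (U : Opens X.Pt) : Type u := E.val.obj (op U)

noncomputable instance (E : X.Mods) (U : Opens X.Pt) : AddCommGroup (Sec E U) :=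
  inferInstanceAs (AddCommGroup (E.val.obj (op U)))

noncomputable instance (E : X.Mods) (U : Opens X.Pt) : Module (X.Fn U) (Sec E U) :=
  (E.val.obj (op U)).isModule

/-- Restriction of sections. -/
noncomputable def res (E : X.Mods) {U V : Opens X.Pt} (h : V ≤ U) :
    Sec E U →ₛₗ[X.resFn h] Sec E V :=
  E.val.restrictₛₗ (homOfLE h).op

theorem res_self (E : X.Mods) {U : Opens X.Pt} (s : Sec E U) : res E le_rfl s = s := by
  have := congrArg (fun g => g.hom s) (E.val.map_id (op U))
  exact this

theorem res_res (E : X.Mods) {U V W : Opens X.Pt} (h : V ≤ U) (h' : W ≤ V) (s : Sec E U) :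
    res E h' (res E h s) = res E (h'.trans h) s :=
  (PresheafOfModules.map_comp_apply E.val (homOfLE h).op (homOfLE h').op s).symm

/-- A morphism of sheaves of modules on sections. -/
noncomputable def app {E F : X.Mods} (φ : E ⟶ F) (U : Opens X.Pt) :
    Sec E U →ₗ[X.Fn U] Sec F U :=
  (φ.val.app (op U)).hom

theorem app_res {E F : X.Mods} (φ : E ⟶ F) {U V : Opens X.Pt} (h : V ≤ U) (s : Sec E U) :
    app φ V (res E h s) = res F h (app φ U s) :=
  PresheafOfModules.naturality_apply φ.val (homOfLE h).op s

end Functions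

section Forms

variable {k : Type u} [Field k] (X : KSpace k)

/-- The submodule of `Ω[𝒪_{X,x}⁄k]` by which one divides: nothing in the algebraic case, and
`⋂ₙ 𝔪ⁿ Ω` in the analytic case. For `𝒪_{X,x} = ℂ{z₁, …, z_n}/I` the latter quotient is the module of
analytic differentials `⨁ 𝒪_{X,x} dz_i / (dg, g ∈ I)`, since every `dg - ∑ (∂g/∂z_i) dz_i` lies in
all `𝔪ⁿ Ω` while finitely generated modules are `𝔪`-adically separated. -/
noncomputable def formKernel (x : X.Pt) : Submodule (X.Stalk x) (Ω[X.Stalk x⁄k]) :=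
  match X.kind with
  | .algebraic => ⊥
  | .analytic => ⨅ n : ℕ, (IsLocalRing.maximalIdeal (X.Stalk x) ^ n) • ⊤

/-- The stalk at `x` of the sheaf `Ω¹_X`. -/
abbrev FormStalk (x : X.Pt) : Type u := (Ω[X.Stalk x⁄k]) ⧸ X.formKernel x

/-- The differential `𝒪_{X,x} → Ω¹_{X,x}`. -/
noncomputable def dStalk (x : X.Pt) : Derivation k (X.Stalk x) (X.FormStalk x) :=
  (X.formKernel x).mkQ.compDer (KaehlerDifferential.D k (X.Stalk x))

/-- Sections of `Ω¹_X` over `U`: families of elements of the stalks that are locally of the form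
`∑ a_i db_i`. -/
def IsForm {U : Opens X.Pt} (ω : ∀ x : U, X.FormStalk x.1) : Prop :=
  ∀ x : U, ∃ (V : Opens X.Pt) (hV : V ≤ U) (_ : x.1 ∈ V) (n : ℕ) (a b : Fin n → X.Fn V),
    ∀ y : V, ω ⟨y.1, hV y.2⟩ =
      ∑ i, X.germ y.1 y.2 (a i) • X.dStalk y.1 (X.germ y.1 y.2 (b i))

variable {X}

theorem IsForm.zero {U : Opens X.Pt} : X.IsForm (U := U) (fun _ => 0) :=
  fun x => ⟨U, le_rfl, x.2, 0, Fin.elim0, Fin.elim0, fun y => by simp⟩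

theorem IsForm.add {U : Opens X.Pt} {ω η : ∀ x : U, X.FormStalk x.1}
    (hω : X.IsForm ω) (hη : X.IsForm η) : X.IsForm (fun x => ω x + η x) := by
  intro x
  obtain ⟨V, hV, hxV, n, a, b, h⟩ := hω x
  obtain ⟨W, hW, hxW, m, a', b', h'⟩ := hη x
  refine ⟨V ⊓ W, inf_le_left.trans hV, ⟨hxV, hxW⟩, n + m,
    Fin.append (fun i => X.resFn inf_le_left (a i)) (fun i => X.resFn inf_le_right (a' i)),
    Fin.append (fun i => X.resFn inf_le_left (b i)) (fun i => X.resFn inf_le_right (b' i)),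
    fun y => ?_⟩
  rw [Fin.sum_univ_add]
  simp only [Fin.append_left, Fin.append_right, germ_resFn]
  exact congrArg₂ (· + ·) (h ⟨y.1, y.2.1⟩) (h' ⟨y.1, y.2.2⟩)

theorem IsForm.smul {U : Opens X.Pt} {ω : ∀ x : U, X.FormStalk x.1} (c : X.Fn U)
    (hω : X.IsForm ω) : X.IsForm (fun x => X.germ x.1 x.2 c • ω x) := by
  intro x
  obtain ⟨V, hV, hxV, n, a, b, h⟩ := hω x
  refine ⟨V, hV, hxV, n, fun i => X.resFn hV c * a i, b, fun y => ?_⟩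
  simp only [h y, Finset.smul_sum, map_mul, germ_resFn, mul_smul]

theorem IsForm.neg {U : Opens X.Pt} {ω : ∀ x : U, X.FormStalk x.1}
    (hω : X.IsForm ω) : X.IsForm (fun x => - ω x) := by
  simpa using hω.smul (-1)

theorem IsForm.restrict {U V : Opens X.Pt} (hVU : V ≤ U) {ω : ∀ x : U, X.FormStalk x.1}
    (hω : X.IsForm ω) : X.IsForm (U := V) (fun x => ω ⟨x.1, hVU x.2⟩) := by
  intro x
  obtain ⟨W, hW, hxW, n, a, b, h⟩ := hω ⟨x.1, hVU x.2⟩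
  refine ⟨W ⊓ V, inf_le_right, ⟨hxW, x.2⟩, n, fun i => X.resFn inf_le_left (a i),
    fun i => X.resFn inf_le_left (b i), fun y => ?_⟩
  simp only [germ_resFn]
  exact h ⟨y.1, y.2.1⟩

theorem IsForm.d {U : Opens X.Pt} (b : X.Fn U) :
    X.IsForm (fun x : U => X.dStalk x.1 (X.germ x.1 x.2 b)) :=
  fun x => ⟨U, le_rfl, x.2, 1, fun _ => 1, fun _ => b, fun y => by simp⟩

variable (X)

/-- An effective Cartier divisor, given by the stalks `𝒪(-D)_x` of its ideal sheaf, which is locally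
generated by one function that is not a zero divisor. -/
structure CartierDivisor where
  ideal : ∀ x : X.Pt, Ideal (X.Stalk x)
  locally_principal : ∀ x : X.Pt, ∃ (U : Opens X.Pt) (_ : x ∈ U) (f : X.Fn U),
    ∀ (y : X.Pt) (hy : y ∈ U), X.germ y hy f ∈ nonZeroDivisors (X.Stalk y) ∧
      ideal y = Ideal.span {X.germ y hy f}

variable {X}

/-- Sections over `U` of `Ω¹_X(D) = Ω¹_X ⊗ 𝒪(D) = 𝓗om(𝒪(-D), Ω¹_X)`: families of homomorphisms of
stalks that take sections of `𝒪(-D)` to sections of `Ω¹_X`. If `f` is a local equation of `D`, then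
`w` corresponds to the form `w(f) / f`. -/
def PolarForm (D : X.CartierDivisor) (U : Opens X.Pt) : Type u :=
  {w : ∀ x : U, D.ideal x.1 →ₗ[X.Stalk x.1] X.FormStalk x.1 //
    ∀ (V : Opens X.Pt) (hV : V ≤ U) (f : X.Fn V) (hf : ∀ y : V, X.germ y.1 y.2 f ∈ D.ideal y.1),
      X.IsForm (fun y : V => w ⟨y.1, hV y.2⟩ ⟨X.germ y.1 y.2 f, hf y⟩)}

variable (D : X.CartierDivisor)

noncomputable instance (U : Opens X.Pt) : AddCommGroup (PolarForm D U) :=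
  inferInstanceAs (AddCommGroup ({
    carrier := {w : ∀ x : U, D.ideal x.1 →ₗ[X.Stalk x.1] X.FormStalk x.1 |
      ∀ (V : Opens X.Pt) (hV : V ≤ U) (f : X.Fn V)
        (hf : ∀ y : V, X.germ y.1 y.2 f ∈ D.ideal y.1),
        X.IsForm (fun y : V => w ⟨y.1, hV y.2⟩ ⟨X.germ y.1 y.2 f, hf y⟩)}
    zero_mem' := fun _ _ _ _ => IsForm.zero
    add_mem' := fun h h' V hV f hf => (h V hV f hf).add (h' V hV f hf)
    neg_mem' := fun h V hV f hf => (h V hV f hf).neg } :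
      AddSubgroup (∀ x : U, D.ideal x.1 →ₗ[X.Stalk x.1] X.FormStalk x.1)))

variable {D}

theorem PolarForm.ext {U : Opens X.Pt} {w w' : PolarForm D U} (h : ∀ x, w.1 x = w'.1 x) :
    w = w' := Subtype.ext (funext h)

noncomputable instance (U : Opens X.Pt) : Module (X.Fn U) (PolarForm D U) where
  smul c w := ⟨fun x => X.germ x.1 x.2 c • w.1 x, fun V hV f hf => by
    have := (w.2 V hV f hf).smul (X.resFn hV c)
    simp only [germ_resFn] at this
    exact this⟩
  one_smul w := PolarForm.ext fun x => by
    change X.germ x.1 x.2 1 • w.1 x = w.1 x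
    rw [map_one, one_smul]
  mul_smul a b w := PolarForm.ext fun x => by
    change X.germ x.1 x.2 (a * b) • w.1 x = X.germ x.1 x.2 a • X.germ x.1 x.2 b • w.1 x
    rw [map_mul, mul_smul]
  smul_zero a := PolarForm.ext fun x => smul_zero (X.germ x.1 x.2 a)
  smul_add a w w' := PolarForm.ext fun x => smul_add (X.germ x.1 x.2 a) (w.1 x) (w'.1 x)
  add_smul a b w := PolarForm.ext fun x => by
    change X.germ x.1 x.2 (a + b) • w.1 x = X.germ x.1 x.2 a • w.1 x + X.germ x.1 x.2 b • w.1 x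
    rw [map_add, add_smul]
  zero_smul w := PolarForm.ext fun x => by
    change X.germ x.1 x.2 0 • w.1 x = 0
    rw [map_zero, zero_smul]

/-- Restriction of sections of `Ω¹_X(D)`. -/
noncomputable def resForm {U V : Opens X.Pt} (h : V ≤ U) :
    PolarForm D U →ₛₗ[X.resFn h] PolarForm D V where
  toFun w := ⟨fun x => w.1 ⟨x.1, h x.2⟩, fun W hW f hf => w.2 W (hW.trans h) f hf⟩
  map_add' _ _ := rfl
  map_smul' c w := PolarForm.ext fun x => by
    change X.germ x.1 (h x.2) c • w.1 ⟨x.1, h x.2⟩ =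
      X.germ x.1 x.2 (X.resFn h c) • w.1 ⟨x.1, h x.2⟩
    rw [germ_resFn]

variable (D)

/-- The differential `𝒪_X → Ω¹_X → Ω¹_X(D)`. -/
noncomputable def dForm {U : Opens X.Pt} (b : X.Fn U) : PolarForm D U :=
  ⟨fun x => (LinearMap.toSpanSingleton (X.Stalk x.1) (X.FormStalk x.1)
      (X.dStalk x.1 (X.germ x.1 x.2 b))).comp (D.ideal x.1).subtype,
    fun V hV f _ => by
      have := (IsForm.d (X.resFn hV b)).smul f
      simp only [germ_resFn] at this
      exact this⟩

theorem resForm_dForm {U V : Opens X.Pt} (h : V ≤ U) (b : X.Fn U) :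
    resForm h (dForm D b) = dForm D (X.resFn h b) :=
  PolarForm.ext fun x => by
    change (dForm D b).1 ⟨x.1, h x.2⟩ = _
    simp only [dForm, germ_resFn]

theorem dForm_mul {U : Opens X.Pt} (a b : X.Fn U) :
    dForm D (a * b) = a • dForm D b + b • dForm D a :=
  PolarForm.ext fun x => LinearMap.ext fun g => by
    change (g : X.Stalk x.1) • X.dStalk x.1 (X.germ x.1 x.2 (a * b)) =
      X.germ x.1 x.2 a • (g : X.Stalk x.1) • X.dStalk x.1 (X.germ x.1 x.2 b) +
      X.germ x.1 x.2 b • (g : X.Stalk x.1) • X.dStalk x.1 (X.germ x.1 x.2 a)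
    rw [map_mul, Derivation.leibniz, smul_add, smul_comm, smul_comm (g : X.Stalk x.1)
      (X.germ x.1 x.2 b)]

theorem dForm_const {U : Opens X.Pt} (c : k) : dForm D (X.constFn U c) = 0 :=
  PolarForm.ext fun x => LinearMap.ext fun g => by
    change (g : X.Stalk x.1) • X.dStalk x.1 (X.germ x.1 x.2 (X.constFn U c)) = 0
    have : X.germ x.1 x.2 (X.constFn U c) = algebraMap k (X.Stalk x.1) c :=
      germ_resFn X le_top x.1 x.2 _
    rw [this, Derivation.map_algebraMap, smul_zero]

end Forms

section Bundles

variable {k : Type u} [Field k] {X : KSpace k}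

/-- For an endomorphism `ε` with `ε^{n+1} = 0`, so that `E` is a sheaf of modules over
`𝒪_X[ε]/(ε^{n+1})`: the sections `e` form a basis of `E` over `𝒪_X[ε]/(ε^{n+1})` on `U`. -/
def IsFrame {E : X.Mods} (ε : E ⟶ E) (n : ℕ) {r : ℕ} {U : Opens X.Pt} (e : Fin r → Sec E U) :
    Prop :=
  ∀ (V : Opens X.Pt) (h : V ≤ U), Function.Bijective
    (fun c : Fin r → Fin (n + 1) → X.Fn V =>
      ∑ i, ∑ j, c i j • ((app ε V) ^ (j : ℕ)) (res E h (e i)))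

variable (X) in
/-- A vector bundle on `X × V_n`, where `V_n = Spec k[ε]/(ε^{n+1})`. As a ringed space `X × V_n` is
the space `X` with the structure sheaf `𝒪_X[ε]/(ε^{n+1})`, so this is a sheaf of `𝒪_X`-modules with an
endomorphism `ε` such that `ε^{n+1} = 0`, locally free of finite rank over `𝒪_X[ε]/(ε^{n+1})`. For
`n = 0` one has `ε = 0` and this is a vector bundle on `X`. -/
structure Bundle (n : ℕ) where
  sheaf : X.Mods
  eps : sheaf ⟶ sheaf
  eps_pow : ∀ (U : Opens X.Pt) (s : Sec sheaf U), ((app eps U) ^ (n + 1)) s = 0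
  locally_free : ∀ x : X.Pt, ∃ (U : Opens X.Pt) (_ : x ∈ U) (r : ℕ) (e : Fin r → Sec sheaf U),
    IsFrame eps n e

/-- The bundle is trivial on `U`. -/
def Bundle.Triv {n : ℕ} (E : X.Bundle n) (U : Opens X.Pt) : Prop :=
  ∃ (r : ℕ) (e : Fin r → Sec E.sheaf U), IsFrame E.eps n e

variable (D : X.CartierDivisor)

/-- The module `E(U) ⊗ Ω¹_X(D)(U)`. For `U` on which the bundle `E` is trivial, the only case used, this
is the module of sections over `U` of the sheaf `E ⊗ Ω¹_X(D)`. -/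
abbrev Tw (E : X.Mods) (U : Opens X.Pt) : Type u := Sec E U ⊗[X.Fn U] PolarForm D U

/-- Restriction of sections of `E ⊗ Ω¹_X(D)`. -/
noncomputable def resTw (E : X.Mods) {U V : Opens X.Pt} (h : V ≤ U) : Tw D E U →+ Tw D E V :=
  TensorProduct.liftAddHom
    { toFun := fun s =>
        { toFun := fun w => res E h s ⊗ₜ resForm h w
          map_zero' := by rw [map_zero, TensorProduct.tmul_zero]
          map_add' := fun w w' => by rw [map_add, TensorProduct.tmul_add] }
      map_zero' := AddMonoidHom.ext fun w => by
        change res E h 0 ⊗ₜ[X.Fn V] resForm h w = 0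
        rw [map_zero, TensorProduct.zero_tmul]
      map_add' := fun s s' => AddMonoidHom.ext fun w => by
        change res E h (s + s') ⊗ₜ[X.Fn V] resForm h w =
          res E h s ⊗ₜ[X.Fn V] resForm h w + res E h s' ⊗ₜ[X.Fn V] resForm h w
        rw [map_add, TensorProduct.add_tmul] }
    (fun f s w => by
      change res E h (f • s) ⊗ₜ[X.Fn V] resForm h w = res E h s ⊗ₜ[X.Fn V] resForm h (f • w)
      rw [map_smulₛₗ, map_smulₛₗ, TensorProduct.smul_tmul])

theorem resTw_tmul (E : X.Mods) {U V : Opens X.Pt} (h : V ≤ U) (s : Sec E U)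
    (w : PolarForm D U) : resTw D E h (s ⊗ₜ w) = res E h s ⊗ₜ resForm h w := rfl

theorem resTw_smul (E : X.Mods) {U V : Opens X.Pt} (h : V ≤ U) (f : X.Fn U) (t : Tw D E U) :
    resTw D E h (f • t) = X.resFn h f • resTw D E h t := by
  induction t using TensorProduct.induction_on with
  | zero => simp
  | tmul s w => rw [TensorProduct.smul_tmul', resTw_tmul, resTw_tmul, map_smulₛₗ,
      TensorProduct.smul_tmul']
  | add a b ha hb => rw [smul_add, map_add, ha, hb, map_add, smul_add]

/-- A connection `∇ : E → E ⊗ Ω¹(D)` on a vector bundle on `X × V_n`, relative to `V_n`, with poles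
along `D × V_n` (over `𝒪_X[ε]/(ε^{n+1})` the sheaf of relative forms is `Ω¹_X(D)[ε]/(ε^{n+1})`, whence the
same tensor product). The morphism of sheaves is given on the basis of those open sets on which `E`
is trivial. It is `k[ε]`-linear: `k`-linearity follows from the Leibniz rule as `dc = 0` for `c ∈ k`. -/
structure Connection {n : ℕ} (E : X.Bundle n) where
  nabla : ∀ U : Opens X.Pt, E.Triv U → Sec E.sheaf U →+ Tw D E.sheaf U
  nabla_res : ∀ {U V : Opens X.Pt} (hU : E.Triv U) (hV : E.Triv V) (h : V ≤ U)
    (s : Sec E.sheaf U), nabla V hV (res E.sheaf h s) = resTw D E.sheaf h (nabla U hU s)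
  leibniz : ∀ {U : Opens X.Pt} (hU : E.Triv U) (f : X.Fn U) (s : Sec E.sheaf U),
    nabla U hU (f • s) = f • nabla U hU s + s ⊗ₜ dForm D f
  nabla_eps : ∀ {U : Opens X.Pt} (hU : E.Triv U) (s : Sec E.sheaf U),
    nabla U hU (app E.eps U s) = (app E.eps U).rTensor (PolarForm D U) (nabla U hU s)

variable {D}

/-- For `n ≤ m`, an isomorphism of `(E, ∇)` over `V_n` with the restriction to `V_n` of `(E', ∇')` over
`V_m`, given by the corresponding projection `π : E' → E' / ε^{n+1} E' ≅ E`. With it, `(E', ∇')` is an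
extension of `(E, ∇)` to `V_m`, with fixed divisor of poles. -/
structure Reduction {m n : ℕ} {E' : X.Bundle m} (N' : Connection D E')
    {E : X.Bundle n} (N : Connection D E) where
  π : E'.sheaf ⟶ E.sheaf
  π_eps : ∀ (U : Opens X.Pt) (s : Sec E'.sheaf U),
    app π U (app E'.eps U s) = app E.eps U (app π U s)
  surj : ∀ U : Opens X.Pt, E'.Triv U → Function.Surjective (app π U)
  ker : ∀ U : Opens X.Pt, E'.Triv U → ∀ s : Sec E'.sheaf U,
    app π U s = 0 ↔ ∃ t, s = ((app E'.eps U) ^ (n + 1)) t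
  π_nabla : ∀ (U : Opens X.Pt) (hU' : E'.Triv U) (hU : E.Triv U) (s : Sec E'.sheaf U),
    N.nabla U hU (app π U s) = (app π U).rTensor (PolarForm D U) (N'.nabla U hU' s)

end Bundles

section EndComplex

variable {k : Type u} [Field k] {X : KSpace k} (E : X.Bundle 0)

/-- Open subsets of `U` on which `E` is trivial. -/
def TrivOpens (U : Opens X.Pt) : Type u := {W : Opens X.Pt // W ≤ U ∧ E.Triv W}

variable {E}

def TrivOpens.incl {U V : Opens X.Pt} (h : V ≤ U) (W : TrivOpens E V) : TrivOpens E U :=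
  ⟨W.1, W.2.1.trans h, W.2.2⟩

variable (E)

/-- The ring of sections over `U` of `𝓔nd(E)`: endomorphisms of the sheaf `E` restricted to `U`, given on
the basis of open sets on which `E` is trivial. -/
def EndSec (U : Opens X.Pt) :
    Subring (∀ W : TrivOpens E U, Module.End (X.Fn W.1) (Sec E.sheaf W.1)) where
  carrier := {φ | ∀ (W W' : TrivOpens E U) (h : W'.1 ≤ W.1) (s : Sec E.sheaf W.1),
    φ W' (res E.sheaf h s) = res E.sheaf h (φ W s)}
  zero_mem' := fun W W' h s => (map_zero (res E.sheaf h)).symm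
  one_mem' := fun _ _ _ _ => rfl
  add_mem' := fun {φ ψ} hφ hψ W W' h s => by
    change φ W' _ + ψ W' _ = res E.sheaf h (φ W s + ψ W s)
    rw [hφ W W' h, hψ W W' h, map_add]
  neg_mem' := fun {φ} hφ W W' h s => by
    change - φ W' _ = res E.sheaf h (- φ W s)
    rw [hφ W W' h, map_neg]
  mul_mem' := fun {φ ψ} hφ hψ W W' h s => by
    change φ W' (ψ W' _) = res E.sheaf h (φ W (ψ W s))
    rw [hψ W W' h, hφ W W' h]

def resEnd {U V : Opens X.Pt} (h : V ≤ U) : EndSec E U →+* EndSec E V where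
  toFun φ := ⟨fun W => φ.1 (W.incl h), fun W W' => φ.2 (W.incl h) (W'.incl h)⟩
  map_one' := rfl
  map_mul' _ _ := rfl
  map_zero' := rfl
  map_add' _ _ := rfl

variable (D : X.CartierDivisor)

/-- Sections over `U` of `𝓔nd(E) ⊗ Ω¹(D) = 𝓗om(E, E ⊗ Ω¹(D))`. -/
def EndForm (U : Opens X.Pt) :
    AddSubgroup (∀ W : TrivOpens E U, Sec E.sheaf W.1 →ₗ[X.Fn W.1] Tw D E.sheaf W.1) where
  carrier := {A | ∀ (W W' : TrivOpens E U) (h : W'.1 ≤ W.1) (s : Sec E.sheaf W.1),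
    A W' (res E.sheaf h s) = resTw D E.sheaf h (A W s)}
  zero_mem' := fun W W' h s => (map_zero (resTw D E.sheaf h)).symm
  add_mem' := fun {A B} hA hB W W' h s => by
    change A W' _ + B W' _ = resTw D E.sheaf h (A W s + B W s)
    rw [hA W W' h, hB W W' h, map_add]
  neg_mem' := fun {A} hA W W' h s => by
    change - A W' _ = resTw D E.sheaf h (- A W s)
    rw [hA W W' h, map_neg]

def resEndForm {U V : Opens X.Pt} (h : V ≤ U) : EndForm E D U →+ EndForm E D V where
  toFun A := ⟨fun W => A.1 (W.incl h), fun W W' => A.2 (W.incl h) (W'.incl h)⟩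
  map_zero' := rfl
  map_add' _ _ := rfl

variable {E D}

theorem resTw_rTensor {U V : Opens X.Pt} (h : V ≤ U)
    (φ : Module.End (X.Fn U) (Sec E.sheaf U)) (ψ : Module.End (X.Fn V) (Sec E.sheaf V))
    (hc : ∀ s, ψ (res E.sheaf h s) = res E.sheaf h (φ s)) (t : Tw D E.sheaf U) :
    resTw D E.sheaf h (φ.rTensor (PolarForm D U) t) =
      ψ.rTensor (PolarForm D V) (resTw D E.sheaf h t) := by
  induction t using TensorProduct.induction_on with
  | zero => simp
  | tmul s w => rw [LinearMap.rTensor_tmul, resTw_tmul, resTw_tmul, LinearMap.rTensor_tmul, hc]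
  | add a b ha hb => rw [map_add, map_add, ha, hb, map_add, map_add]

theorem EndForm.ext {U : Opens X.Pt} {A B : EndForm E D U}
    (h : ∀ (W : TrivOpens E U) (s : Sec E.sheaf W.1), A.1 W s = B.1 W s) : A = B :=
  Subtype.ext <| funext fun W => LinearMap.ext fun s => h W s

noncomputable def compLeft {U : Opens X.Pt} (φ : EndSec E U) (A : EndForm E D U) :
    EndForm E D U :=
  ⟨fun W => ((φ.1 W).rTensor (PolarForm D W.1)).comp (A.1 W), fun W W' h s => by
    rw [LinearMap.comp_apply, LinearMap.comp_apply, A.2 W W' h,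
      resTw_rTensor h (φ.1 W) (φ.1 W') (φ.2 W W' h)]⟩

theorem compLeft_apply {U : Opens X.Pt} (φ : EndSec E U) (A : EndForm E D U)
    (W : TrivOpens E U) (s : Sec E.sheaf W.1) :
    (compLeft φ A).1 W s = (φ.1 W).rTensor (PolarForm D W.1) (A.1 W s) := rfl

theorem EndForm.add_apply {U : Opens X.Pt} (A B : EndForm E D U)
    (W : TrivOpens E U) (s : Sec E.sheaf W.1) : (A + B).1 W s = A.1 W s + B.1 W s := rfl

theorem EndSec.add_val {U : Opens X.Pt} (φ ψ : EndSec E U)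
    (W : TrivOpens E U) : (φ + ψ).1 W = φ.1 W + ψ.1 W := rfl

/-- The product `φ A = (φ ⊗ 1) ∘ A`. -/
noncomputable def EndForm.lmul (U : Opens X.Pt) : EndSec E U →+ EndForm E D U →+ EndForm E D U :=
  AddMonoidHom.mk' (fun φ => AddMonoidHom.mk' (compLeft φ) (fun A B => EndForm.ext fun W s => by
      rw [compLeft_apply, EndForm.add_apply, EndForm.add_apply, map_add]
      rfl))
    (fun φ ψ => AddMonoidHom.ext fun A => EndForm.ext fun W s => by
      change (compLeft (φ + ψ) A).1 W s = (compLeft φ A + compLeft ψ A).1 W s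
      rw [EndForm.add_apply, compLeft_apply, EndSec.add_val, LinearMap.rTensor_add]
      rfl)

/-- The product `A φ = A ∘ φ`. -/
noncomputable def EndForm.rmul (U : Opens X.Pt) : EndForm E D U →+ EndSec E U →+ EndForm E D U :=
  AddMonoidHom.mk' (fun A => AddMonoidHom.mk' (fun φ =>
      ⟨fun W => (A.1 W).comp (φ.1 W), fun W W' h s => by
        change A.1 W' (φ.1 W' _) = resTw D E.sheaf h (A.1 W (φ.1 W s))
        rw [φ.2 W W' h, A.2 W W' h]⟩)
      (fun φ ψ => Subtype.ext <| funext fun W => LinearMap.comp_add _ _ _))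
    (fun A B => AddMonoidHom.ext fun φ => Subtype.ext <| funext fun W => LinearMap.add_comp _ _ _)

/-- The induced connection `φ ↦ ∇ ∘ φ - (φ ⊗ 1) ∘ ∇` on `𝓔nd(E)`. -/
noncomputable def Connection.onEnd (N : Connection D E) (U : Opens X.Pt) :
    EndSec E U →+ EndForm E D U :=
  AddMonoidHom.mk' (fun φ =>
      ⟨fun W =>
        { toFun := fun s => N.nabla W.1 W.2.2 (φ.1 W s) -
            (φ.1 W).rTensor (PolarForm D W.1) (N.nabla W.1 W.2.2 s)
          map_add' := fun s t => by
            simp only [map_add]; abel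
          map_smul' := fun f s => by
            simp only [map_smul, N.leibniz, map_add, LinearMap.rTensor_tmul, RingHom.id_apply,
              smul_sub]
            abel },
        fun W W' h s => by
          change N.nabla W'.1 W'.2.2 (φ.1 W' _) - (φ.1 W').rTensor _ (N.nabla W'.1 W'.2.2 _) =
            resTw D E.sheaf h (N.nabla W.1 W.2.2 (φ.1 W s) -
              (φ.1 W).rTensor _ (N.nabla W.1 W.2.2 s))
          rw [φ.2 W W' h, N.nabla_res W.2.2 W'.2.2 h, N.nabla_res W.2.2 W'.2.2 h, map_sub,
            resTw_rTensor h (φ.1 W) (φ.1 W') (φ.2 W W' h)]⟩)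
    (fun φ ψ => Subtype.ext <| funext fun W => LinearMap.ext fun s => by
      change N.nabla W.1 W.2.2 (φ.1 W s + ψ.1 W s) -
          LinearMap.rTensor _ (φ.1 W + ψ.1 W) (N.nabla W.1 W.2.2 s) =
        (N.nabla W.1 W.2.2 (φ.1 W s) - LinearMap.rTensor _ (φ.1 W) (N.nabla W.1 W.2.2 s)) +
        (N.nabla W.1 W.2.2 (ψ.1 W s) - LinearMap.rTensor _ (ψ.1 W) (N.nabla W.1 W.2.2 s))
      rw [map_add, LinearMap.rTensor_add, LinearMap.add_apply]
      abel)

theorem Connection.onEnd_mul (N : Connection D E) (U : Opens X.Pt) (φ ψ : EndSec E U) :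
    N.onEnd U (φ * ψ) = EndForm.rmul U (N.onEnd U φ) ψ + EndForm.lmul U φ (N.onEnd U ψ) :=
  Subtype.ext <| funext fun W => LinearMap.ext fun s => by
    change N.nabla W.1 W.2.2 (φ.1 W (ψ.1 W s)) -
        LinearMap.rTensor _ ((φ.1 W).comp (ψ.1 W)) (N.nabla W.1 W.2.2 s) =
      (N.nabla W.1 W.2.2 (φ.1 W (ψ.1 W s)) -
        LinearMap.rTensor _ (φ.1 W) (N.nabla W.1 W.2.2 (ψ.1 W s))) +
      LinearMap.rTensor _ (φ.1 W) (N.nabla W.1 W.2.2 (ψ.1 W s) -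
        LinearMap.rTensor _ (ψ.1 W) (N.nabla W.1 W.2.2 s))
    rw [map_sub, LinearMap.rTensor_comp, LinearMap.comp_apply]
    abel

/-- The complex `𝓔nd(E) → 𝓔nd(E) ⊗ Ω¹(D)` with its composition products. -/
noncomputable def Connection.endPair (N : Connection D E) : DGPair X.toLRS.toTopCat where
  C₀ U := EndSec E U
  C₁ U := EndForm E D U
  res₀ h := resEnd E h
  res₁ h := resEndForm E D h
  res₀_self _ := rfl
  res₁_self _ := rfl
  res₀_res₀ _ _ _ := rfl
  res₁_res₁ _ _ _ := rfl
  d := N.onEnd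
  d_res _ _ := rfl
  lmul := EndForm.lmul
  lmul_res _ _ _ := rfl
  rmul := EndForm.rmul
  rmul_res _ _ _ := rfl
  leibniz := N.onEnd_mul

end EndComplex

section Deformations

variable {k : Type u} [Field k] {X : KSpace k} {D : X.CartierDivisor}

/-- `(E₁, ∇₁)`, with its identification `ρ` of the reduction modulo `ε` with `(E, ∇)`, is the first
order deformation given by the cocycle `z = (a, A)` on the covering `𝔘`: over each member `U_α`
there is a trivialization of the deformation, that is an isomorphism
`φ_α : E[ε]/(ε²) ≅ E₁` over `U_α` lifting the identity of `E`, such that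
`φ_α⁻¹ φ_β = 1 + ε a_{αβ}` and `φ_α⁻¹ ∇₁ φ_α = ∇ + ε A_α`.
The isomorphism is recorded by its restriction `ψ_α` to `E`, so `φ_α (s + ε t) = ψ_α s + ε ψ_α t`,
on the basis of opens `W ≤ U_α` over which both sheaves are free. For a frame `e_α` of `E` on `U_α`
and `ẽ_α = ψ_α e_α` the conditions read `ẽ_β = ẽ_α (1 + ε a_{αβ}) g_{αβ}` and
`∇₁ ẽ_α = ẽ_α (A_α⁰ + ε A_α)`, where `e_β = e_α g_{αβ}` and `∇ e_α = e_α A_α⁰`. -/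
def IsGivenBy {E : X.Bundle 0} {N : Connection D E} {E₁ : X.Bundle 1} {N₁ : Connection D E₁}
    (ρ : Reduction N₁ N) {ι : Type u} (𝔘 : DGPair.Cover X.toLRS.toTopCat ι)
    (z : N.endPair.Z₁ 𝔘) : Prop :=
  ∃ ψ : ∀ (α : ι) (W : Opens X.Pt), W ≤ 𝔘.U α → E.Triv W → E₁.Triv W →
      Sec E.sheaf W →ₗ[X.Fn W] Sec E₁.sheaf W,
    (∀ (α : ι) (W V : Opens X.Pt) (hW : W ≤ 𝔘.U α) (h : V ≤ W) (t : E.Triv W) (t₁ : E₁.Triv W)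
      (v : E.Triv V) (v₁ : E₁.Triv V) (s : Sec E.sheaf W),
      ψ α V (h.trans hW) v v₁ (res E.sheaf h s) = res E₁.sheaf h (ψ α W hW t t₁ s)) ∧
    (∀ (α : ι) (W : Opens X.Pt) (hW : W ≤ 𝔘.U α) (t : E.Triv W) (t₁ : E₁.Triv W)
      (s : Sec E.sheaf W), app ρ.π W (ψ α W hW t t₁ s) = s) ∧
    (∀ (α β : ι) (W : Opens X.Pt) (hW : W ≤ 𝔘.U₂ α β) (t : E.Triv W) (t₁ : E₁.Triv W)
      (s : Sec E.sheaf W),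
      ψ β W (hW.trans (𝔘.le₂₁ α β)) t t₁ s =
        ψ α W (hW.trans (𝔘.le₂₀ α β)) t t₁ s +
        app E₁.eps W (ψ α W (hW.trans (𝔘.le₂₀ α β)) t t₁
          ((show EndSec E (𝔘.U₂ α β) from z.1.1 α β).1 ⟨W, hW, t⟩ s))) ∧
    (∀ (α : ι) (W : Opens X.Pt) (hW : W ≤ 𝔘.U α) (t : E.Triv W) (t₁ : E₁.Triv W)
      (s : Sec E.sheaf W),
      N₁.nabla W t₁ (ψ α W hW t t₁ s) =
        (ψ α W hW t t₁).rTensor (PolarForm D W) (N.nabla W t s) +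
        ((app E₁.eps W).comp (ψ α W hW t t₁)).rTensor (PolarForm D W)
          ((show EndForm E D (𝔘.U α) from z.1.2 α).1 ⟨W, hW, t⟩ s))

end Deformations

section Spaces

variable {k : Type u} [Field k]

/-- A scheme over `k`, with the algebraic Kähler differentials. -/
noncomputable def ofScheme {Y : Scheme.{u}} (f : Y ⟶ Spec (.of k)) : KSpace k where
  toLRS := Y.toLocallyRingedSpace
  structureMap := f.appTop.hom.comp (Scheme.ΓSpecIso (.of k)).inv.hom
  kind := .algebraic

/-- `X` is a complete scheme of finite type over `k`. -/
def IsCompleteScheme (X : KSpace k) : Prop :=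
  ∃ (Y : Scheme.{u}) (f : Y ⟶ Spec (.of k)), IsProper f ∧ X = ofScheme f

/-- The ring of holomorphic functions on an open subset of `ℂⁿ`. -/
def holo {n : ℕ} (V : Opens (Fin n → ℂ)) : Subring (V → ℂ) where
  carrier := {f | ∃ g : (Fin n → ℂ) → ℂ, DifferentiableOn ℂ g V ∧ ∀ z : V, f z = g z.1}
  zero_mem' := ⟨fun _ => 0, differentiableOn_const 0, fun _ => rfl⟩
  one_mem' := ⟨fun _ => 1, differentiableOn_const 1, fun _ => rfl⟩
  add_mem' := fun ⟨g, hg, h⟩ ⟨g₂, hg₂, h₂⟩ =>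
    ⟨g + g₂, hg.add hg₂, fun z => congrArg₂ (· + ·) (h z) (h₂ z)⟩
  mul_mem' := fun ⟨g, hg, h⟩ ⟨g₂, hg₂, h₂⟩ =>
    ⟨g * g₂, hg.mul hg₂, fun z => congrArg₂ (· * ·) (h z) (h₂ z)⟩
  neg_mem' := fun ⟨g, hg, h⟩ => ⟨-g, hg.neg, fun z => congrArg Neg.neg (h z)⟩

/-- Restriction of holomorphic functions. -/
def resHolo {n : ℕ} {V V₂ : Opens (Fin n → ℂ)} (h : V₂ ≤ V) (f : holo V) : holo V₂ :=
  ⟨fun z => f.1 ⟨z.1, h z.2⟩, by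
    obtain ⟨g, hg, hf⟩ := f.2
    exact ⟨g, hg.mono h, fun z => hf ⟨z.1, h z.2⟩⟩⟩

/-- The constant function `c`. -/
def constHolo {n : ℕ} (V : Opens (Fin n → ℂ)) (c : ℂ) : holo V :=
  ⟨fun _ => c, fun _ => c, differentiableOn_const c, fun _ => rfl⟩

/-- The open subset `j⁻¹(V)` of `X`, for a continuous map `j` defined on the open subset `W`. -/
def preOpen {X : KSpace k} {W : Opens X.Pt} {n : ℕ} {j : W → (Fin n → ℂ)} (hj : Continuous j)
    (V : Opens (Fin n → ℂ)) : Opens X.Pt :=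
  ⟨Subtype.val '' (j ⁻¹' (V : Set (Fin n → ℂ))),
    W.2.isOpenMap_subtype_val _ (V.2.preimage hj)⟩

theorem preOpen_mono {X : KSpace k} {W : Opens X.Pt} {n : ℕ} {j : W → (Fin n → ℂ)}
    (hj : Continuous j) {V V₂ : Opens (Fin n → ℂ)} (h : V₂ ≤ V) :
    preOpen (X := X) hj V₂ ≤ preOpen hj V :=
  Set.image_mono (Set.preimage_mono h)

theorem mem_preOpen {X : KSpace k} {W : Opens X.Pt} {n : ℕ} {j : W → (Fin n → ℂ)}
    (hj : Continuous j) {V : Opens (Fin n → ℂ)} {w : W} (hw : j w ∈ V) :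
    w.1 ∈ preOpen (X := X) hj V := ⟨w, hw, rfl⟩

/-- An isomorphism of the open subspace `W` of `X` with a local model of complex spaces: the zero
locus of finitely many holomorphic functions `F₁, …, F_m` on an open subset `G` of `ℂⁿ`, with the
structure sheaf `𝒪_G / (F₁, …, F_m)`. It is given as a homeomorphism `j` of `W` onto the zero locus
and the pull-back of functions `𝒪_G → j_* 𝒪_W`, a surjective map of sheaves of rings with kernel
`(F₁, …, F_m)`. Constants are compared through the identification `e` of `k` with `ℂ`. -/
structure LocalModel (X : KSpace k) (e : k ≃+* ℂ) (W : Opens X.Pt) where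
  n : ℕ
  m : ℕ
  G : Opens (Fin n → ℂ)
  F : Fin m → holo G
  j : W → (Fin n → ℂ)
  embedding : Topology.IsEmbedding j
  range_j : Set.range j = {z | ∃ hz : z ∈ G, ∀ i, (F i).1 ⟨z, hz⟩ = 0}
  pull : ∀ V : Opens (Fin n → ℂ), V ≤ G → holo V →+* X.Fn (preOpen embedding.continuous V)
  pull_const : ∀ (V : Opens (Fin n → ℂ)) (hV : V ≤ G) (c : k),
    pull V hV (constHolo V (e c)) = X.constFn _ c
  pull_res : ∀ (V V₂ : Opens (Fin n → ℂ)) (hV : V ≤ G) (h : V₂ ≤ V) (f : holo V),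
    pull V₂ (h.trans hV) (resHolo h f) =
      X.resFn (preOpen_mono embedding.continuous h) (pull V hV f)
  surj : ∀ (w : W) (t : X.Stalk w.1), ∃ (V : Opens (Fin n → ℂ)) (hV : V ≤ G) (hw : j w ∈ V)
    (f : holo V), X.germ w.1 (mem_preOpen embedding.continuous hw) (pull V hV f) = t
  ker : ∀ (V : Opens (Fin n → ℂ)) (hV : V ≤ G) (f : holo V) (w : W) (hw : j w ∈ V),
    X.germ w.1 (mem_preOpen embedding.continuous hw) (pull V hV f) = 0 ↔
      ∃ (V₂ : Opens (Fin n → ℂ)) (h : V₂ ≤ V) (_ : j w ∈ V₂) (c : Fin m → holo V₂),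
        ∀ z : V₂, f.1 ⟨z.1, h z.2⟩ = ∑ i, (c i).1 z * (F i).1 ⟨z.1, hV (h z.2)⟩

/-- `X` is a complex space: `k` is `ℂ`, every point has an open neighbourhood isomorphic to a local
model, and the differentials are the analytic ones. -/
def IsComplexSpace (X : KSpace k) : Prop :=
  X.kind = .analytic ∧ ∃ e : k ≃+* ℂ, ∀ x : X.Pt, ∃ W : Opens X.Pt, x ∈ W ∧
    Nonempty (LocalModel X e W)

end Spaces

end KSpace

namespace KSpace

variable {k : Type u} [Field k] {X : KSpace k}

/-! ### Gluing sections of modules and forms with poles -/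

section SheafConditions

/-! Over open sets on which all bundles are free, the trivializations of `E₁` lift to a second order
extension, since homomorphisms out of a free module lift along surjections. In terms of such lifts
an extension consists of transition functions 1 + ε a_ij + ε² b_ij and local operators ∇ + ε A_i +
ε² B_i. At order ε their compatibility says that (a, A) is a cocycle. At order ε² it says b_il =
b_ij + b_jl + a_ij a_jl and B_i + A_i a_ij + ∇(b_ij) = a_ij A_j + B_j, that is, D(-(b, B)) = (a, A)
∪ (a, A). So an extension exists exactly when the cup square is a coboundary on some sufficiently
fine covering. As hypercohomology is a direct limit over coverings, this is the vanishing of the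
Yoneda square; `yoneda_cls_self_eq_zero_iff` makes this precise and lets the covering be fine enough
to trivialize the given bundles.

Necessity is `exists_D₁_eq_cup`. There b and B are extracted by `exists_coefficient`: if χ lifts the
identity of `E` to `E₂`, then ε² χ identifies `E` with the kernel of `E₂ → E₁`, so that whatever
vanishes in `E₁` has a well-defined coefficient of ε². The equation for B is then read off from
`gauge_formula`.

Sufficiency is `exists_extension`. A solution (b, B) glues copies of E[ε]/(ε³) to a bundle
(`Gluing`), and the chart connections agree on overlaps by the same `gauge_formula`. One point is
not formal: `E₂ → E₁` has to be surjective on sections over every open set on which `E₂` is free,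
whereas the charts give this only locally. `Bundle.Triv.surjective_of_locally` normalizes the local
lifts by a frame, which makes them unique and hence gluable.

Forms with values in a bundle are tensor products of modules of sections, without sheafification;
over open sets with a frame they still glue (`Tw.exists_of_unique`). -/

theorem Sec.eq_of_locally_eq (E : X.Mods) {U : Opens X.Pt} (s t : Sec E U)
    (h : ∀ x ∈ U, ∃ (V : Opens X.Pt) (hV : V ≤ U), x ∈ V ∧ res E hV s = res E hV t) : s = t := by
  choose V hV hx hst using h
  let F : TopCat.Sheaf Ab.{u} X.toLRS.toTopCat := ⟨E.val.presheaf, E.isSheaf⟩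
  refine F.eq_of_locally_eq' (fun x : U => V x.1 x.2) U (fun x => homOfLE (hV x.1 x.2))
    (fun x hxU => ?_) s t (fun x => hst x.1 x.2)
  exact Opens.mem_iSup.2 ⟨⟨x, hxU⟩, hx x hxU⟩

/-- Sections characterized by a local property which determines them uniquely exist globally as
soon as they exist locally. -/
theorem Sec.exists_of_unique (E : X.Mods) {U : Opens X.Pt}
    (P : ∀ V : Opens X.Pt, Sec E V → Prop)
    (mono : ∀ {V W : Opens X.Pt} (h : W ≤ V) (s : Sec E V), P V s → P W (res E h s))
    (uniq : ∀ (V : Opens X.Pt), V ≤ U → ∀ s t : Sec E V, P V s → P V t → s = t)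
    (ex : ∀ x ∈ U, ∃ V : Opens X.Pt, V ≤ U ∧ x ∈ V ∧ ∃ s : Sec E V, P V s) :
    ∃ s : Sec E U, ∀ (V : Opens X.Pt) (h : V ≤ U) (t : Sec E V), P V t → res E h s = t := by
  choose V hV hx s hs using ex
  let F : TopCat.Sheaf Ab.{u} X.toLRS.toTopCat := ⟨E.val.presheaf, E.isSheaf⟩
  obtain ⟨(t : Sec E U), ht, -⟩ := F.existsUnique_gluing' (fun x : U => V x.1 x.2) U
    (fun x => homOfLE (hV x.1 x.2)) (fun x hxU => Opens.mem_iSup.2 ⟨⟨x, hxU⟩, hx x hxU⟩)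
    (fun x => s x.1 x.2) (fun x y => uniq _ (inf_le_left.trans (hV x.1 x.2)) _ _
      (mono inf_le_left _ (hs x.1 x.2)) (mono inf_le_right _ (hs y.1 y.2)))
  have ht' : ∀ x (hxU : x ∈ U), res E (hV x hxU) t = s x hxU := fun x hxU => ht ⟨x, hxU⟩
  -- Near each point of W, both the glued section and a given solution restrict to solutions on V x
  -- ⊓ W, where uniqueness applies.
  refine ⟨t, fun W h w hw => Sec.eq_of_locally_eq E _ _ fun x hxW => ?_⟩
  refine ⟨V x (h hxW) ⊓ W, inf_le_right, ⟨hx _ _, hxW⟩, ?_⟩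
  rw [res_res, ← res_res E (hV x (h hxW)) inf_le_left, ht']
  exact uniq _ (inf_le_right.trans h) _ _ (mono _ _ (hs _ _)) (mono _ _ hw)

theorem IsForm.of_locally {U : Opens X.Pt} {ω : ∀ x : U, X.FormStalk x.1}
    (h : ∀ x : U, ∃ (V : Opens X.Pt) (hV : V ≤ U) (_ : x.1 ∈ V),
      X.IsForm (U := V) fun y => ω ⟨y.1, hV y.2⟩) : X.IsForm ω := by
  intro x
  obtain ⟨V, hV, hx, hω⟩ := h x
  obtain ⟨W, hW, hxW, n, a, b, hab⟩ := hω ⟨x.1, hx⟩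
  exact ⟨W, hW.trans hV, hxW, n, a, b, hab⟩

variable {D : X.CartierDivisor}

theorem resForm_resForm {U V W : Opens X.Pt} (h : V ≤ U) (h' : W ≤ V) (w : PolarForm D U) :
    resForm h' (resForm h w) = resForm (h'.trans h) w := rfl

theorem PolarForm.eq_of_locally_eq {U : Opens X.Pt} (s t : PolarForm D U)
    (h : ∀ x ∈ U, ∃ (V : Opens X.Pt) (hV : V ≤ U), x ∈ V ∧ resForm hV s = resForm hV t) :
    s = t := by
  refine PolarForm.ext fun x => ?_
  obtain ⟨V, hV, hx, e⟩ := h x.1 x.2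
  exact congrArg (fun w : PolarForm D V => w.1 ⟨x.1, hx⟩) e

theorem PolarForm.exists_of_unique {U : Opens X.Pt} (P : ∀ V : Opens X.Pt, PolarForm D V → Prop)
    (mono : ∀ {V W : Opens X.Pt} (h : W ≤ V) (s : PolarForm D V), P V s → P W (resForm h s))
    (uniq : ∀ (V : Opens X.Pt), V ≤ U → ∀ s t : PolarForm D V, P V s → P V t → s = t)
    (ex : ∀ x ∈ U, ∃ V : Opens X.Pt, V ≤ U ∧ x ∈ V ∧ ∃ s : PolarForm D V, P V s) :
    ∃ s : PolarForm D U, ∀ (V : Opens X.Pt) (h : V ≤ U) (t : PolarForm D V),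
      P V t → resForm h s = t := by
  choose V hV hx s hs using ex
  -- By uniqueness on overlaps all local solutions take the same value at y. The glued form can
  -- therefore take at x the value of the solution chosen at x; that it is a form is a local
  -- condition.
  have key : ∀ (x y : X.Pt) (hxU : x ∈ U) (W : Opens X.Pt) (hW : W ≤ U) (hy : y ∈ V x hxU)
      (hyW : y ∈ W) (t : PolarForm D W), P W t → (s x hxU).1 ⟨y, hy⟩ = t.1 ⟨y, hyW⟩ := by
    intro x y hxU W hW hy hyW t ht
    exact congrArg (fun w : PolarForm D (V x hxU ⊓ W) => w.1 ⟨y, hy, hyW⟩)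
      (uniq (V x hxU ⊓ W) (inf_le_right.trans hW) _ _ (mono inf_le_left _ (hs x hxU))
        (mono inf_le_right _ ht))
  refine ⟨⟨fun x => (s x.1 x.2).1 ⟨x.1, hx x.1 x.2⟩, fun W hW f hf => ?_⟩, fun W h t ht => ?_⟩
  · refine IsForm.of_locally fun x => ⟨V x.1 (hW x.2) ⊓ W, inf_le_right, ⟨hx _ _, x.2⟩, ?_⟩
    have := (s x.1 (hW x.2)).2 (V x.1 (hW x.2) ⊓ W) inf_le_left (X.resFn inf_le_right f)
      (fun y => by rw [germ_resFn]; exact hf ⟨y.1, y.2.2⟩)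
    simp only [germ_resFn] at this
    convert this using 2 with y
    exact DFunLike.congr_fun
      (key y.1 y.1 (hW y.2.2) (V x.1 (hW x.2)) (hV _ _) (hx _ _) y.2.1 _ (hs _ _)) _
  · exact PolarForm.ext fun x => key x.1 x.1 (h x.2) W h _ x.2 t ht

end SheafConditions

/-! ### Bases given by frames, and coordinates of sections of E ⊗ Ω¹(D) -/

section Frames

variable {E : X.Mods} {ε : E ⟶ E} {n r : ℕ} {U : Opens X.Pt} {e : Fin r → Sec E U}

theorem IsFrame.mono (he : IsFrame ε n e) {V : Opens X.Pt} (h : V ≤ U) :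
    IsFrame ε n fun i => res E h (e i) := by
  intro W hW
  simp only [res_res]
  exact he W (hW.trans h)

theorem Bundle.Triv.mono {n : ℕ} {E : X.Bundle n} {U V : Opens X.Pt} (hU : E.Triv U) (h : V ≤ U) :
    E.Triv V := by
  obtain ⟨r, e, he⟩ := hU
  exact ⟨r, _, he.mono h⟩

theorem app_pow_res (φ : E ⟶ E) {U V : Opens X.Pt} (h : V ≤ U) (j : ℕ) (s : Sec E U) :
    ((app φ V) ^ j) (res E h s) = res E h (((app φ U) ^ j) s) := by
  induction j with
  | zero => rfl
  | succ j ih => rw [pow_succ', pow_succ', Module.End.mul_apply, ih, app_res, Module.End.mul_apply]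

/-- The basis over `𝒪_X` given by a frame. -/
noncomputable def IsFrame.basis (he : IsFrame ε n e) :
    Module.Basis (Fin r × Fin (n + 1)) (X.Fn U) (Sec E U) :=
  .ofEquivFun (LinearEquiv.symm (LinearEquiv.ofBijective
    (Fintype.linearCombination (X.Fn U)
      (fun p : Fin r × Fin (n + 1) => ((app ε U) ^ (p.2 : ℕ)) (e p.1))) (by
    have h := (he U le_rfl).comp (Equiv.curry (Fin r) (Fin (n + 1)) (X.Fn U)).bijective
    convert h using 1
    funext c
    simp only [Fintype.linearCombination_apply, Fintype.sum_prod_type, res_self]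
    rfl)))

theorem IsFrame.basis_apply (he : IsFrame ε n e) (p : Fin r × Fin (n + 1)) :
    he.basis p = ((app ε U) ^ (p.2 : ℕ)) (e p.1) := by
  simp [IsFrame.basis, LinearEquiv.ofBijective_apply, Fintype.linearCombination_apply_single]

theorem IsFrame.basis_mono (he : IsFrame ε n e) {V : Opens X.Pt} (h : V ≤ U)
    (p : Fin r × Fin (n + 1)) : (he.mono h).basis p = res E h (he.basis p) := by
  rw [basis_apply, basis_apply, app_pow_res]

theorem IsFrame.repr_res (he : IsFrame ε n e) {V : Opens X.Pt} (h : V ≤ U) (s : Sec E U)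
    (p : Fin r × Fin (n + 1)) :
    (he.mono h).basis.repr (res E h s) p = X.resFn h (he.basis.repr s p) := by
  conv_lhs => rw [← he.basis.sum_repr s, map_sum]
  simp only [map_smulₛₗ, ← basis_mono, map_sum, Module.Basis.repr_self,
    Finsupp.coe_finsetSum, Finset.sum_apply, Finsupp.smul_apply]
  rw [Finset.sum_eq_single p]
  · simp
  · intro q _ hq
    simp [hq]
  · simp

variable (D : X.CartierDivisor)

/-- The coordinates of a section of `E ⊗ Ω¹(D)` in a frame. -/
noncomputable def IsFrame.coord (he : IsFrame ε n e) (p : Fin r × Fin (n + 1)) :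
    Tw D E U →ₗ[X.Fn U] PolarForm D U :=
  (TensorProduct.lid (X.Fn U) (PolarForm D U)).toLinearMap ∘ₗ
    (he.basis.coord p).rTensor (PolarForm D U)

theorem IsFrame.coord_tmul (he : IsFrame ε n e) (p : Fin r × Fin (n + 1)) (s : Sec E U)
    (w : PolarForm D U) : he.coord D p (s ⊗ₜ w) = he.basis.repr s p • w := rfl

theorem IsFrame.sum_coord (he : IsFrame ε n e) (t : Tw D E U) :
    ∑ p, he.basis p ⊗ₜ[X.Fn U] he.coord D p t = t := by
  induction t using TensorProduct.induction_on with
  | zero => simp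
  | tmul s w =>
    simp only [coord_tmul, ← TensorProduct.smul_tmul, ← TensorProduct.sum_tmul,
      he.basis.sum_repr]
  | add a b ha hb => simp only [map_add, TensorProduct.tmul_add, Finset.sum_add_distrib, ha, hb]

theorem IsFrame.coord_ext (he : IsFrame ε n e) {s t : Tw D E U}
    (h : ∀ p, he.coord D p s = he.coord D p t) : s = t := by
  rw [← he.sum_coord D s, ← he.sum_coord D t]
  simp only [h]

theorem IsFrame.coord_sum (he : IsFrame ε n e) (w : Fin r × Fin (n + 1) → PolarForm D U)
    (p : Fin r × Fin (n + 1)) :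
    he.coord D p (∑ q, he.basis q ⊗ₜ[X.Fn U] w q) = w p := by
  simp only [map_sum, coord_tmul, Module.Basis.repr_self]
  rw [Finset.sum_eq_single p]
  · simp
  · intro q _ hq
    simp [hq]
  · simp

theorem IsFrame.coord_res (he : IsFrame ε n e) {V : Opens X.Pt} (h : V ≤ U) (t : Tw D E U)
    (p : Fin r × Fin (n + 1)) :
    (he.mono h).coord D p (resTw D E h t) = resForm h (he.coord D p t) := by
  induction t using TensorProduct.induction_on with
  | zero => simp
  | tmul s w => rw [resTw_tmul, coord_tmul, coord_tmul, repr_res, map_smulₛₗ]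
  | add a b ha hb => simp only [map_add, ha, hb]

theorem resTw_resTw {U V W : Opens X.Pt} (h : V ≤ U) (h' : W ≤ V) (t : Tw D E U) :
    resTw D E h' (resTw D E h t) = resTw D E (h'.trans h) t := by
  induction t using TensorProduct.induction_on with
  | zero => simp
  | tmul s w => rw [resTw_tmul, resTw_tmul, resTw_tmul, res_res, resForm_resForm]
  | add a b ha hb => simp only [map_add, ha, hb]

theorem resTw_self {U : Opens X.Pt} (t : Tw D E U) : resTw D E le_rfl t = t := by
  induction t using TensorProduct.induction_on with
  | zero => simp
  | tmul s w => rw [resTw_tmul, res_self]; rfl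
  | add a b ha hb => simp only [map_add, ha, hb]

theorem resTw_map {F : X.Mods} {U V : Opens X.Pt} (h : V ≤ U)
    (φ : Sec E U →ₗ[X.Fn U] Sec F U) (ψ : Sec E V →ₗ[X.Fn V] Sec F V)
    (hc : ∀ s, ψ (res E h s) = res F h (φ s)) (t : Tw D E U) :
    resTw D F h (φ.rTensor (PolarForm D U) t) = ψ.rTensor (PolarForm D V) (resTw D E h t) := by
  induction t using TensorProduct.induction_on with
  | zero => simp
  | tmul s w => rw [LinearMap.rTensor_tmul, resTw_tmul, resTw_tmul, LinearMap.rTensor_tmul, hc]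
  | add a b ha hb => rw [map_add, map_add, ha, hb, map_add, map_add]

variable {D}

/-- A frame over U identifies `Tw` with a finite sum of copies of Ω¹(D), by coordinates that commute
with restriction, and so transfers the sheaf property of Ω¹(D). This is why triviality over U is
assumed. -/
theorem Tw.eq_of_locally_eq {m : ℕ} {E : X.Bundle m} {U : Opens X.Pt} (hU : E.Triv U)
    (s t : Tw D E.sheaf U) (h : ∀ x ∈ U, ∃ (V : Opens X.Pt) (hV : V ≤ U), x ∈ V ∧
      resTw D E.sheaf hV s = resTw D E.sheaf hV t) : s = t := by
  obtain ⟨r, e, he⟩ := hU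
  refine he.coord_ext D fun p => PolarForm.eq_of_locally_eq _ _ fun x hx => ?_
  obtain ⟨V, hV, hxV, hst⟩ := h x hx
  refine ⟨V, hV, hxV, ?_⟩
  rw [← he.coord_res, ← he.coord_res, hst]

/-- Uniqueness of the solutions of `P` makes each of their coordinates unique, so the coordinates
glue one at a time as forms with poles. -/
theorem Tw.exists_of_unique {m : ℕ} {E : X.Bundle m} {U : Opens X.Pt} (hU : E.Triv U)
    (P : ∀ V : Opens X.Pt, Tw D E.sheaf V → Prop)
    (mono : ∀ {V W : Opens X.Pt} (h : W ≤ V) (s : Tw D E.sheaf V),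
      P V s → P W (resTw D E.sheaf h s))
    (uniq : ∀ (V : Opens X.Pt), V ≤ U → ∀ s t : Tw D E.sheaf V, P V s → P V t → s = t)
    (ex : ∀ x ∈ U, ∃ V : Opens X.Pt, V ≤ U ∧ x ∈ V ∧ ∃ s : Tw D E.sheaf V, P V s) :
    ∃ s : Tw D E.sheaf U, ∀ (V : Opens X.Pt) (h : V ≤ U) (t : Tw D E.sheaf V),
      P V t → resTw D E.sheaf h s = t := by
  obtain ⟨r, e, he⟩ := hU
  have H : ∀ p, ∃ w : PolarForm D U, ∀ (V : Opens X.Pt) (h : V ≤ U) (v : PolarForm D V),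
      (∃ (_ : V ≤ U) (t : Tw D E.sheaf V), P V t ∧ (he.mono h).coord D p t = v) →
        resForm h w = v := by
    intro p
    have := PolarForm.exists_of_unique (U := U) (fun V (v : PolarForm D V) =>
      ∃ (h : V ≤ U) (t : Tw D E.sheaf V), P V t ∧ (he.mono h).coord D p t = v) ?_ ?_ ?_
    · obtain ⟨w, hw⟩ := this
      exact ⟨w, fun V h v ⟨_, t, ht, e⟩ => hw V h v ⟨h, t, ht, e⟩⟩
    · rintro V W h v ⟨hV, t, ht, rfl⟩
      refine ⟨h.trans hV, _, mono h t ht, ?_⟩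
      rw [← (he.mono hV).coord_res D h]
      -- What remains is that restricting the frame in two steps or in one gives the same family.
      congr 2
      all_goals simp only [res_res]
    · rintro V hV s t ⟨_, s', hs', rfl⟩ ⟨_, t', ht', rfl⟩
      rw [uniq V hV _ _ hs' ht']
    · intro x hx
      obtain ⟨V, hV, hxV, s, hs⟩ := ex x hx
      exact ⟨V, hV, hxV, _, hV, s, hs, rfl⟩
  choose w hw using H
  refine ⟨∑ q, he.basis q ⊗ₜ[X.Fn U] w q, fun V h t ht => (he.mono h).coord_ext D fun p => ?_⟩
  rw [he.coord_res, he.coord_sum]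
  exact hw p V h _ ⟨h, t, ht, rfl⟩

end Frames

end KSpace

/-! ### The Yoneda square on a fine covering -/

namespace DGPair

variable {T : TopCat.{u}} {K : DGPair T} {ι : Type u} {𝔘 : Cover T ι}

theorem yoneda_mk (𝔙 : PCover T) (x y : K.H₁ 𝔙.toCover) :
    K.yoneda (Quotient.mk _ ⟨𝔙, x⟩) (Quotient.mk _ ⟨𝔙, y⟩) =
      (Quotient.mk _ ⟨𝔙, K.yonedaCover 𝔙.toCover x y⟩ : K.HH₂) :=
  DirectLimit.map₂_def K.trans₁ K.trans₁ K.trans₂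
    (fun 𝔘 x y => K.yonedaCover 𝔘.toCover x y) _ 𝔙 x y

/-- The Yoneda square of the class of a cocycle vanishes if and only if its cup square is a
coboundary on some refinement, which may be taken as fine as one likes. -/
theorem yoneda_cls_self_eq_zero_iff (z : K.Z₁ 𝔘) (B : T → Opens T) (hB : ∀ x, x ∈ B x) :
    K.yoneda (cls z) (cls z) = 0 ↔ ∃ (𝔙 : PCover T) (τ : T → ι) (h : ∀ x, 𝔙.U x ≤ 𝔘.U (τ x)),
      (∀ x, 𝔙.U x ≤ B x) ∧ ∃ y, K.D₁ 𝔙.toCover y =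
        K.cup 𝔙.toCover (K.pull₁ (𝔙 := 𝔙.toCover) τ h z.1) (K.pull₁ (𝔙 := 𝔙.toCover) τ h z.1) := by
  constructor
  · intro H
    rw [cls, yoneda_mk] at H
    obtain ⟨𝔙, h𝔙, H2⟩ := (DirectLimit.exists_eq_zero _).1 H
    change K.mk₂ 𝔙.toCover (K.pullZ₂ (𝔙 := 𝔙.toCover) id h𝔙 _) = 0 at H2
    obtain ⟨y, hy⟩ := (K.mk₂_eq_zero _).1 H2
    -- Intersecting with `B x` gives the prescribed fineness; a coboundary pulls back to a
    -- coboundary.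
    let 𝔚 : PCover T := ⟨fun x => 𝔙.U x ⊓ B x, fun x => ⟨𝔙.mem x, hB x⟩⟩
    have h𝔚 : ∀ x, 𝔚.toCover.U x ≤ 𝔙.toCover.U x := fun _ => inf_le_left
    refine ⟨𝔚, 𝔘.index, fun x => (h𝔚 x).trans (h𝔙 x), fun x => inf_le_right,
      K.pull₁ (𝔙 := 𝔚.toCover) id h𝔚 y, ?_⟩
    rw [D₁_pull, hy]
    change K.pull₂ id h𝔚 (K.pull₂ (𝔙 := 𝔙.toCover) id h𝔙 (K.cup 𝔘.toPCover.toCover _ _)) = _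
    rw [← cup_pull, ← cup_pull]
    have e : K.pull₁ (𝔙 := 𝔚.toCover) id h𝔚 (K.pull₁ (𝔙 := 𝔙.toCover) id h𝔙
        (K.pull₁ (𝔙 := 𝔘.toPCover.toCover) 𝔘.index 𝔘.toPCover_le z.1)) =
        K.pull₁ (𝔙 := 𝔚.toCover) 𝔘.index (fun x => (h𝔚 x).trans (h𝔙 x)) z.1 :=
      Prod.ext (funext fun i => funext fun j => (K.res₀_res₀ _ _ _).trans (K.res₀_res₀ _ _ _))
        (funext fun i => (K.res₁_res₁ _ _ _).trans (K.res₁_res₁ _ _ _))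
    exact congrArg₂ (fun a b => K.cup 𝔚.toCover a b) e e
  · rintro ⟨𝔙, τ, h, -, hy⟩
    -- The map τ need not be the one chosen in the definition of `cls`; the class does not depend on
    -- it.
    rw [cls_eq z τ 𝔙 h]
    rw [yoneda_mk, DirectLimit.zero_def 𝔙]
    refine congrArg (fun c => (⟦⟨𝔙, c⟩⟧ : K.HH₂)) ?_
    exact (K.mk₂_eq_zero _).2 hy

end DGPair

namespace KSpace

variable {k : Type u} [Field k] {X : KSpace k} {D : X.CartierDivisor}

theorem IsGivenBy.pull {E : X.Bundle 0} {N : Connection D E} {E₁ : X.Bundle 1}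
    {N₁ : Connection D E₁} {ρ : Reduction N₁ N} {ι κ : Type u}
    {𝔘 : DGPair.Cover X.toLRS.toTopCat ι} {z : N.endPair.Z₁ 𝔘} (hz : IsGivenBy ρ 𝔘 z)
    {𝔙 : DGPair.Cover X.toLRS.toTopCat κ} (τ : κ → ι) (h : ∀ i, 𝔙.U i ≤ 𝔘.U (τ i)) :
    IsGivenBy ρ 𝔙 (N.endPair.pullZ₁ τ h z) := by
  obtain ⟨ψ, h1, h2, h3, h4⟩ := hz
  refine ⟨fun α W hW => ψ (τ α) W (hW.trans (h α)), fun α W V hW => h1 (τ α) W V (hW.trans (h α)),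
    fun α W hW => h2 (τ α) W (hW.trans (h α)), fun α β W hW t t₁ s => ?_,
    fun α W hW t t₁ s => ?_⟩
  · exact h3 (τ α) (τ β) W (hW.trans (inf_le_inf (h α) (h β))) t t₁ s
  · exact h4 (τ α) W (hW.trans (h α)) t t₁ s

/-! ### Division by powers of ε in a free module -/

section Shift

/-- Over `𝒪_X[ε]/(ε^{n+1})`, a free module has linear operators `κ`, which divides by `ε^n` on
`ε^n E` up to a multiple of `ε`, and `μ`, which divides by `ε` up to a multiple of `ε^n`. -/
theorem Bundle.Triv.exists_shift {n : ℕ} {E : X.Bundle n} {U : Opens X.Pt} (hU : E.Triv U) :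
    ∃ κ μ : ∀ V : Opens X.Pt, V ≤ U → Module.End (X.Fn V) (Sec E.sheaf V),
      (∀ V h, (app E.eps V) ^ n * κ V h + μ V h * app E.eps V = 1) ∧
      (∀ V h, κ V h * (app E.eps V) ^ n + app E.eps V * μ V h = 1) ∧
      (∀ V h, μ V h * κ V h = 0) ∧
      ∀ (V W : Opens X.Pt) (hV : V ≤ U) (h : W ≤ V) (s : Sec E.sheaf V),
        κ W (h.trans hV) (res E.sheaf h s) = res E.sheaf h (κ V hV s) := by
  obtain ⟨r, e, he⟩ := hU
  let κ : ∀ V : Opens X.Pt, V ≤ U → Module.End (X.Fn V) (Sec E.sheaf V) := fun V h =>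
    (he.mono h).basis.constr (X.Fn V) fun p => if (p.2 : ℕ) = n then res E.sheaf h (e p.1) else 0
  let μ : ∀ V : Opens X.Pt, V ≤ U → Module.End (X.Fn V) (Sec E.sheaf V) := fun V h =>
    (he.mono h).basis.constr (X.Fn V) fun p =>
      if (p.2 : ℕ) = 0 then 0 else ((app E.eps V) ^ ((p.2 : ℕ) - 1)) (res E.sheaf h (e p.1))
  have pow0 : ∀ V m, n < m → (app E.eps V) ^ m = 0 := fun V m hm => by
    have : (app E.eps V) ^ (n + 1) = 0 := LinearMap.ext fun s => E.eps_pow V s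
    rw [← Nat.sub_add_cancel (Nat.succ_le_of_lt hm), pow_add, this, mul_zero]
  have hκ : ∀ V h i j, j ≤ n → κ V h (((app E.eps V) ^ j) (res E.sheaf h (e i))) =
      if j = n then res E.sheaf h (e i) else 0 := by
    intro V h i j hj
    have := (he.mono h).basis.constr_basis (X.Fn V)
      (fun p => if (p.2 : ℕ) = n then res E.sheaf h (e p.1) else 0) (i, ⟨j, Nat.lt_succ_of_le hj⟩)
    rwa [(he.mono h).basis_apply] at this
  have hμ : ∀ V h i j, j ≤ n → μ V h (((app E.eps V) ^ j) (res E.sheaf h (e i))) =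
      if j = 0 then 0 else ((app E.eps V) ^ (j - 1)) (res E.sheaf h (e i)) := by
    intro V h i j hj
    have := (he.mono h).basis.constr_basis (X.Fn V)
      (fun p => if (p.2 : ℕ) = 0 then 0 else
        ((app E.eps V) ^ ((p.2 : ℕ) - 1)) (res E.sheaf h (e p.1))) (i, ⟨j, Nat.lt_succ_of_le hj⟩)
    rwa [(he.mono h).basis_apply] at this
  refine ⟨κ, μ, fun V h => (he.mono h).basis.ext ?_, fun V h => (he.mono h).basis.ext ?_,
    fun V h => (he.mono h).basis.ext ?_, fun V W hV h s => ?_⟩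
  · rintro ⟨i, j, hj⟩
    rw [(he.mono h).basis_apply, LinearMap.add_apply, Module.End.mul_apply, Module.End.mul_apply,
      Module.End.one_apply]
    dsimp only
    rw [← Module.End.mul_apply (app E.eps V), ← pow_succ', hκ V h i j (by omega)]
    -- On basis vectors ε^j e_i, the operator μ ε is the identity for j < n and zero for j = n; ε^n
    -- κ does the opposite.
    by_cases hjn : j = n
    · subst hjn
      rw [if_pos rfl, pow0 V (j + 1) (by omega)]
      simp
    · rw [if_neg hjn, hμ V h i (j + 1) (by omega)]
      simp
  · rintro ⟨i, j, hj⟩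
    rw [(he.mono h).basis_apply, LinearMap.add_apply, Module.End.mul_apply, Module.End.mul_apply,
      Module.End.one_apply]
    dsimp only
    rw [← Module.End.mul_apply (_ ^ n), ← pow_add, hμ V h i j (by omega)]
    -- Dually, κ ε^n is the identity for j = 0 and zero for j > 0, where ε μ is the identity.
    by_cases hj0 : j = 0
    · subst hj0
      rw [add_zero, hκ V h i n le_rfl]
      simp
    · rw [if_neg hj0, pow0 V (n + j) (by omega), ← Module.End.mul_apply (app E.eps V), ← pow_succ',
        Nat.sub_add_cancel (by omega)]
      simp
  · rintro ⟨i, j, hj⟩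
    rw [(he.mono h).basis_apply, Module.End.mul_apply]
    dsimp only
    rw [hκ V h i j (by omega)]
    split_ifs
    · exact (hμ V h i 0 (Nat.zero_le n)).trans (if_pos rfl)
    · exact map_zero _
  -- The values of κ on the basis are restrictions of one frame fixed over U, hence κ commutes with
  -- restriction.
  · have hb : ∀ V h p, κ V h (res E.sheaf h (he.basis p)) =
        res E.sheaf h (if (p.2 : ℕ) = n then e p.1 else 0) := fun V h p => by
      rw [← he.basis_mono h]
      refine ((he.mono h).basis.constr_basis (X.Fn V) _ p).trans ?_
      split_ifs
      · rfl
      · exact (map_zero _).symm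
    rw [← (he.mono hV).basis.sum_repr s]
    simp only [he.basis_mono, map_sum, map_smulₛₗ, res_res, hb, RingHom.id_apply]

end Shift

/-! ### The coefficient of ε² and the gauge transformation -/

section Coefficients

variable {E : X.Bundle 0} {N : Connection D E} {E₁ : X.Bundle 1} {N₁ : Connection D E₁}
  {E₂ : X.Bundle 2} {N₂ : Connection D E₂}

theorem app_eps_zero (E : X.Bundle 0) (U : Opens X.Pt) (s : Sec E.sheaf U) :
    app E.eps U s = 0 := by
  simpa using E.eps_pow U s

theorem app_eps_three (E₂ : X.Bundle 2) (U : Opens X.Pt) (s : Sec E₂.sheaf U) :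
    app E₂.eps U (app E₂.eps U (app E₂.eps U s)) = 0 := E₂.eps_pow U s

/-- If `χ` lifts the identity of `E` to `E₂`, then `ε² χ` is a split injection whose image is the
kernel of the reduction `E₂ → E₁`, also after tensoring with `Ω¹(D)`. -/
theorem exists_coefficient (ρ : Reduction N₁ N) (π : Reduction N₂ N₁) {W : Opens X.Pt}
    (h₁ : E₁.Triv W) (h₂ : E₂.Triv W) (χ : Sec E.sheaf W →ₗ[X.Fn W] Sec E₂.sheaf W)
    (hχ : ∀ s, app ρ.π W (app π.π W (χ s)) = s) :
    ∃ q : Sec E₂.sheaf W →ₗ[X.Fn W] Sec E.sheaf W,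
      (∀ s, q (app E₂.eps W (app E₂.eps W (χ s))) = s) ∧
      (∀ t, app π.π W t = 0 → app E₂.eps W (app E₂.eps W (χ (q t))) = t) ∧
      (∀ t, (app π.π W).rTensor (PolarForm D W) t = 0 →
        (app E₂.eps W).rTensor (PolarForm D W) ((app E₂.eps W).rTensor (PolarForm D W)
          (χ.rTensor (PolarForm D W) (q.rTensor (PolarForm D W) t))) = t) := by
  obtain ⟨κ', μ', -, h', -⟩ := h₂.exists_shift
  obtain ⟨κ, μ, h⟩ : ∃ κ μ : Module.End (X.Fn W) (Sec E₂.sheaf W),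
      κ * (app E₂.eps W) ^ 2 + app E₂.eps W * μ = 1 := ⟨_, _, h' W le_rfl⟩
  have hκ : ∀ s, κ (app E₂.eps W (app E₂.eps W s)) + app E₂.eps W (μ s) = s := fun s =>
    LinearMap.congr_fun h s
  have hε : ∀ t, app ρ.π W (app π.π W (app E₂.eps W t)) = 0 := fun t => by
    rw [π.π_eps, ρ.π_eps, app_eps_zero]
  -- The kernel of E₂ → E is ε E₂: the image of t in E₁ is some ε u₁, and for a lift u of u₁ the
  -- error t - ε u lies in ε² E₂.
  have hker : ∀ t, app ρ.π W (app π.π W t) = 0 → ∃ u, t = app E₂.eps W u := by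
    intro t ht
    obtain ⟨u₁, hu₁⟩ := (ρ.ker W h₁ _).1 ht
    obtain ⟨u, rfl⟩ := π.surj W h₂ u₁
    rw [zero_add, pow_one, ← π.π_eps, ← sub_eq_zero, ← map_sub] at hu₁
    obtain ⟨v, hv⟩ := (π.ker W h₂ _).1 hu₁
    refine ⟨u + app E₂.eps W v, ?_⟩
    rw [map_add, ← sub_eq_iff_eq_add', hv]
    rfl
  -- Division by ε² through κ is determined up to multiples of ε, which die in `E`.
  let q : Sec E₂.sheaf W →ₗ[X.Fn W] Sec E.sheaf W := app ρ.π W ∘ₗ app π.π W ∘ₗ κ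
  -- Reducing t to `E` and lifting it back by χ alters it by an element of ε E₂ only, and ε² kills
  -- the difference.
  have hsq : ∀ t, app E₂.eps W (app E₂.eps W (χ (app ρ.π W (app π.π W t)))) =
      app E₂.eps W (app E₂.eps W t) := by
    intro t
    obtain ⟨u, hu⟩ := hker (χ (app ρ.π W (app π.π W t)) - t) (by simp only [map_sub, hχ, sub_self])
    rw [← sub_eq_zero, ← map_sub, ← map_sub, hu, app_eps_three]
  have hθ : ∀ t, app E₂.eps W (app E₂.eps W (χ (q (app E₂.eps W (app E₂.eps W t))))) =
      app E₂.eps W (app E₂.eps W t) := by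
    intro t
    have h1 := hκ t
    change app E₂.eps W (app E₂.eps W (χ (app ρ.π W (app π.π W _)))) = _
    rw [hsq]
    conv_rhs => rw [← h1, map_add, map_add, app_eps_three, add_zero]
  refine ⟨q, fun s => ?_, fun t ht => ?_, fun t ht => ?_⟩
  · change app ρ.π W (app π.π W _) = s
    rw [eq_sub_of_add_eq (hκ (χ s)), map_sub, map_sub, hε, sub_zero, hχ]
  · obtain ⟨u, rfl⟩ := (π.ker W h₂ t).1 ht
    exact hθ u
  -- By right exactness of the tensor product, the kernel of π ⊗ 1 is the image of ε² ⊗ 1, so the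
  -- operator identity `hθ` only has to be tensored. Flatness of Ω¹(D) plays no role.
  · have hex : Function.Exact (app E₂.eps W ∘ₗ app E₂.eps W) (app π.π W) := fun t =>
      (π.ker W h₂ t).trans ⟨fun ⟨u, hu⟩ => ⟨u, hu.symm⟩, fun ⟨u, hu⟩ => ⟨u, hu.symm⟩⟩
    obtain ⟨u, rfl⟩ := (rTensor_exact (PolarForm D W) hex (π.surj W h₂) t).1 ht
    simp only [← LinearMap.comp_apply, ← LinearMap.rTensor_comp]
    refine LinearMap.congr_fun (congrArg (LinearMap.rTensor (PolarForm D W)) ?_) u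
    exact LinearMap.ext fun s => hθ s

/-- The gauge transformation formula modulo `ε³`: the effect of the change of trivialization
`χ' = χ (1 + ε a + ε² b)` on the connection `∇ + ε A + ε² B`. -/
theorem gauge_formula {R M M₂ P : Type*} [CommRing R] [AddCommGroup M] [AddCommGroup M₂]
    [AddCommGroup P] [Module R M] [Module R M₂] [Module R P]
    {ε : M₂ →ₗ[R] M₂} (hε : ∀ s, ε (ε (ε s)) = 0) {χ χ' : M →ₗ[R] M₂} {a b : M →ₗ[R] M}
    (hχ : ∀ s, χ' s = χ s + ε (χ (a s)) + ε (ε (χ (b s))))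
    {n : M →+ M ⊗[R] P} {n₂ : M₂ →+ M₂ ⊗[R] P} (hn₂ : ∀ s, n₂ (ε s) = ε.rTensor P (n₂ s))
    {A A' B B' : M → M ⊗[R] P}
    (hn : ∀ s, n₂ (χ s) = χ.rTensor P (n s) + ε.rTensor P (χ.rTensor P (A s)) +
      ε.rTensor P (ε.rTensor P (χ.rTensor P (B s))))
    (ha : ∀ s, n (a s) - a.rTensor P (n s) = A' s - A s) (s : M) :
    n₂ (χ' s) = χ'.rTensor P (n s) + ε.rTensor P (χ'.rTensor P (A' s)) +
      ε.rTensor P (ε.rTensor P (χ'.rTensor P (B' s))) +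
      ε.rTensor P (ε.rTensor P (χ.rTensor P
        (B s + A (a s) + (n (b s) - b.rTensor P (n s)) - a.rTensor P (A' s) - B' s))) := by
  have e3 : ∀ t, ε.rTensor P (ε.rTensor P (ε.rTensor P t)) = 0 := fun t => by
    rw [← LinearMap.comp_apply, ← LinearMap.comp_apply, ← LinearMap.rTensor_comp,
      ← LinearMap.rTensor_comp, show (ε ∘ₗ ε) ∘ₗ ε = 0 from LinearMap.ext fun s => hε s,
      LinearMap.rTensor_zero, LinearMap.zero_apply]
  have hχ' : χ' = χ + ε ∘ₗ χ ∘ₗ a + ε ∘ₗ ε ∘ₗ χ ∘ₗ b := LinearMap.ext hχ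
  have e : ∀ t, χ'.rTensor P t = χ.rTensor P t + ε.rTensor P (χ.rTensor P (a.rTensor P t)) +
      ε.rTensor P (ε.rTensor P (χ.rTensor P (b.rTensor P t))) := fun t => by
    rw [hχ']
    simp only [LinearMap.rTensor_add, LinearMap.rTensor_comp, LinearMap.add_apply,
      LinearMap.comp_apply]
  -- The first order relation `ha` replaces ∇(a s), after which the terms of order ε match. Since ε³
  -- = 0, the whole discrepancy is the bracket behind ε² in the last summand.
  rw [hχ, map_add, map_add, hn₂, hn₂, hn₂, hn, hn, hn, eq_add_of_sub_eq (ha s)]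
  simp only [e, map_add, map_sub, e3]
  abel

end Coefficients

end KSpace

namespace KSpace

variable {k : Type u} [Field k] {X : KSpace k} {D : X.CartierDivisor}

/-! ### Necessity: an extension makes the cup square a coboundary -/

section Obstruction

/-- On an open set on which `E` is free, homomorphisms from `E` lift along sectionwise surjective
morphisms. -/
theorem Bundle.Triv.exists_lift {n : ℕ} {E : X.Bundle n} {F G : X.Mods} (π : G ⟶ F)
    {U : Opens X.Pt} (hU : E.Triv U) (hπ : Function.Surjective (app π U))
    (ψ : ∀ W : Opens X.Pt, W ≤ U → (Sec E.sheaf W →ₗ[X.Fn W] Sec F W))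
    (hψ : ∀ (W V : Opens X.Pt) (hW : W ≤ U) (h : V ≤ W) (s : Sec E.sheaf W),
      ψ V (h.trans hW) (res E.sheaf h s) = res F h (ψ W hW s)) :
    ∃ χ : ∀ W : Opens X.Pt, W ≤ U → (Sec E.sheaf W →ₗ[X.Fn W] Sec G W),
      (∀ (W V : Opens X.Pt) (hW : W ≤ U) (h : V ≤ W) (s : Sec E.sheaf W),
        χ V (h.trans hW) (res E.sheaf h s) = res G h (χ W hW s)) ∧
      ∀ (W : Opens X.Pt) (hW : W ≤ U) (s : Sec E.sheaf W), app π W (χ W hW s) = ψ W hW s := by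
  obtain ⟨r, e, he⟩ := hU
  -- The basis is lifted once over U and the lifts are restricted: this makes χ compatible with
  -- restriction and uses surjectivity over U alone.
  choose f hf using fun p => hπ (ψ U le_rfl (he.basis p))
  let χ : ∀ W : Opens X.Pt, W ≤ U → (Sec E.sheaf W →ₗ[X.Fn W] Sec G W) := fun W hW =>
    (he.mono hW).basis.constr (X.Fn W) fun p => res G hW (f p)
  have hχ : ∀ W hW p, χ W hW (res E.sheaf hW (he.basis p)) = res G hW (f p) := fun W hW p => by
    rw [← he.basis_mono hW]
    exact (he.mono hW).basis.constr_basis (X.Fn W) _ p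
  refine ⟨χ, fun W V hW h s => ?_, fun W hW s => ?_⟩
  · rw [← (he.mono hW).basis.sum_repr s]
    simp only [he.basis_mono, map_sum, map_smulₛₗ, res_res, hχ, RingHom.id_apply]
  · rw [← (he.mono hW).basis.sum_repr s]
    simp only [he.basis_mono, map_sum, map_smul, hχ, app_res, hf, hψ U W le_rfl hW]

variable {E : X.Bundle 0} {N : Connection D E} {E₁ : X.Bundle 1} {N₁ : Connection D E₁}
  {E₂ : X.Bundle 2} {N₂ : Connection D E₂}

/-- The second order deviation of a lift `χ` of `ψ` from being horizontal for `∇ + ε A`. -/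
noncomputable def deviation (N : Connection D E) (N₂ : Connection D E₂) {W : Opens X.Pt}
    (h : E.Triv W) (h₂ : E₂.Triv W) (χ : Sec E.sheaf W →ₗ[X.Fn W] Sec E₂.sheaf W)
    (A : Sec E.sheaf W →ₗ[X.Fn W] Tw D E.sheaf W) :
    Sec E.sheaf W →ₗ[X.Fn W] Tw D E₂.sheaf W where
  toFun s := N₂.nabla W h₂ (χ s) - χ.rTensor (PolarForm D W) (N.nabla W h s) -
    (app E₂.eps W).rTensor (PolarForm D W) (χ.rTensor (PolarForm D W) (A s))
  map_add' s t := by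
    simp only [map_add]
    abel
  -- The Leibniz terms χ s ⊗ df of the two connections cancel, so the deviation is linear over
  -- functions.
  map_smul' f s := by
    simp only [map_smul, N.leibniz, N₂.leibniz, map_add, LinearMap.rTensor_tmul, RingHom.id_apply,
      smul_sub]
    abel

theorem deviation_apply {W : Opens X.Pt} (h : E.Triv W) (h₂ : E₂.Triv W)
    (χ : Sec E.sheaf W →ₗ[X.Fn W] Sec E₂.sheaf W)
    (A : Sec E.sheaf W →ₗ[X.Fn W] Tw D E.sheaf W) (s : Sec E.sheaf W) :
    deviation N N₂ h h₂ χ A s =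
      N₂.nabla W h₂ (χ s) - χ.rTensor (PolarForm D W) (N.nabla W h s) -
        (app E₂.eps W).rTensor (PolarForm D W) (χ.rTensor (PolarForm D W) (A s)) := rfl

/-- If the first order deformation given by a cocycle on `𝔙` extends to second order, and all the
bundles are trivial on the members of `𝔙`, then the cup square of the cocycle is a coboundary. -/
theorem exists_D₁_eq_cup (ρ : Reduction N₁ N) {κ : Type u}
    (𝔙 : DGPair.Cover X.toLRS.toTopCat κ) (z : N.endPair.Z₁ 𝔙) (hz : IsGivenBy ρ 𝔙 z)
    (hE : ∀ i, E.Triv (𝔙.U i)) (hE₁ : ∀ i, E₁.Triv (𝔙.U i)) (hE₂ : ∀ i, E₂.Triv (𝔙.U i))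
    (π : Reduction N₂ N₁) : ∃ y, N.endPair.D₁ 𝔙 y = N.endPair.cup 𝔙 z.1 z.1 := by
  obtain ⟨ψ, h1, h2, h3, h4⟩ := hz
  obtain ⟨hz0, hz1⟩ := (N.endPair.mem_Z₁ z.1).1 z.2
  -- local lifts of the trivializations, and the coefficients of `ε²`
  choose χ hχres hχ using fun i => (hE i).exists_lift π.π (π.surj _ (hE₂ i))
    (fun W hW => ψ i W hW ((hE i).mono hW) ((hE₁ i).mono hW)) (fun W V hW h s => h1 i W V hW h _ _ _ _ s)
  have hid : ∀ i W hW s, app ρ.π W (app π.π W (χ i W hW s)) = s := fun i W hW s => by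
    rw [hχ, h2]
  choose q hq1 hq2 hq3 using fun i W (hW : W ≤ 𝔙.U i) => exists_coefficient ρ π
    ((hE₁ i).mono hW) ((hE₂ i).mono hW) (χ i W hW) (hid i W hW)
  -- Coefficients of ε² are compared after applying ε² χ_i, which has the left inverse q_i; `hinjT`
  -- is the same after tensoring with forms.
  have hinj : ∀ i W hW s t, app E₂.eps W (app E₂.eps W (χ i W hW s)) =
      app E₂.eps W (app E₂.eps W (χ i W hW t)) → s = t := fun i W hW s t h => by
    rw [← hq1 i W hW s, h, hq1]
  have hinjT : ∀ i W hW (s t : Tw D E.sheaf W),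
      (app E₂.eps W).rTensor (PolarForm D W) ((app E₂.eps W).rTensor (PolarForm D W)
        ((χ i W hW).rTensor (PolarForm D W) s)) =
      (app E₂.eps W).rTensor (PolarForm D W) ((app E₂.eps W).rTensor (PolarForm D W)
        ((χ i W hW).rTensor (PolarForm D W) t)) → s = t := fun i W hW s t h => by
    have e : q i W hW ∘ₗ app E₂.eps W ∘ₗ app E₂.eps W ∘ₗ χ i W hW = LinearMap.id :=
      LinearMap.ext (hq1 i W hW)
    have e' : ∀ u : Tw D E.sheaf W, (q i W hW).rTensor (PolarForm D W)
        ((app E₂.eps W).rTensor (PolarForm D W) ((app E₂.eps W).rTensor (PolarForm D W)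
          ((χ i W hW).rTensor (PolarForm D W) u))) = u := fun u => by
      simp only [← LinearMap.comp_apply, ← LinearMap.rTensor_comp, e, LinearMap.rTensor_id,
        LinearMap.id_apply]
    rw [← e' s, h, e']
  let a : ∀ i j, EndSec E (𝔙.U₂ i j) := z.1.1
  let A : ∀ i, EndForm E D (𝔙.U i) := z.1.2
  -- the second order part of the transition functions
  have key : ∀ i j (W : TrivOpens E (𝔙.U₂ i j)), ∃ b : Module.End (X.Fn W.1) (Sec E.sheaf W.1),
      ∀ s, χ j W.1 (W.2.1.trans (𝔙.le₂₁ i j)) s = χ i W.1 (W.2.1.trans (𝔙.le₂₀ i j)) s +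
        app E₂.eps W.1 (χ i W.1 (W.2.1.trans (𝔙.le₂₀ i j)) ((a i j).1 W s)) +
        app E₂.eps W.1 (app E₂.eps W.1 (χ i W.1 (W.2.1.trans (𝔙.le₂₀ i j)) (b s))) := by
    intro i j W
    have hi : W.1 ≤ 𝔙.U i := W.2.1.trans (𝔙.le₂₀ i j)
    have hj : W.1 ≤ 𝔙.U j := W.2.1.trans (𝔙.le₂₁ i j)
    -- The difference χ_j - χ_i - ε χ_i a_ij vanishes in E₁ by the first order transition formula,
    -- hence it is ε² χ_i of its image under q_i.
    refine ⟨q i W.1 hi ∘ₗ (χ j W.1 hj - χ i W.1 hi - app E₂.eps W.1 ∘ₗ χ i W.1 hi ∘ₗ (a i j).1 W),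
      fun s => ?_⟩
    rw [LinearMap.comp_apply, hq2]
    · simp only [LinearMap.sub_apply, LinearMap.comp_apply]
      abel
    · simp only [LinearMap.sub_apply, LinearMap.comp_apply, map_sub, hχ, π.π_eps]
      rw [h3 i j W.1 W.2.1 _ ((hE₁ i).mono hi)]
      simp only [add_sub_cancel_left]
      exact sub_self _
  choose b₀ hb₀ using key
  -- Compatibility of b with restriction follows from its uniqueness.
  let b : ∀ i j, EndSec E (𝔙.U₂ i j) := fun i j => ⟨b₀ i j, fun W W' h s => by
    have hi : W.1 ≤ 𝔙.U i := W.2.1.trans (𝔙.le₂₀ i j)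
    have hj : W.1 ≤ 𝔙.U j := W.2.1.trans (𝔙.le₂₁ i j)
    refine hinj i W'.1 (h.trans hi) _ _ ?_
    have e1 := hb₀ i j W' (res E.sheaf h s)
    have e2 := congrArg (res E₂.sheaf h) (hb₀ i j W s)
    simp only [map_add] at e2
    rw [(a i j).2 W W' h] at e1
    simp only [← hχres i _ _ hi h, ← hχres j _ _ hj h, ← app_res] at e2
    rw [e2] at e1
    exact (add_left_cancel e1).symm⟩
  have hb : ∀ i j W (hW : W ≤ 𝔙.U₂ i j) (t : E.Triv W) s,
      χ j W (hW.trans (𝔙.le₂₁ i j)) s = χ i W (hW.trans (𝔙.le₂₀ i j)) s +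
        app E₂.eps W (χ i W (hW.trans (𝔙.le₂₀ i j)) ((a i j).1 ⟨W, hW, t⟩ s)) +
        app E₂.eps W (app E₂.eps W (χ i W (hW.trans (𝔙.le₂₀ i j)) ((b i j).1 ⟨W, hW, t⟩ s))) :=
    fun i j W hW t s => hb₀ i j ⟨W, hW, t⟩ s
  -- the second order part of the connection forms
  have key : ∀ i (W : TrivOpens E (𝔙.U i)), ∃ B : Sec E.sheaf W.1 →ₗ[X.Fn W.1] Tw D E.sheaf W.1,
      ∀ s, N₂.nabla W.1 ((hE₂ i).mono W.2.1) (χ i W.1 W.2.1 s) =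
        (χ i W.1 W.2.1).rTensor (PolarForm D W.1) (N.nabla W.1 W.2.2 s) +
        (app E₂.eps W.1).rTensor (PolarForm D W.1)
          ((χ i W.1 W.2.1).rTensor (PolarForm D W.1) ((A i).1 W s)) +
        (app E₂.eps W.1).rTensor (PolarForm D W.1) ((app E₂.eps W.1).rTensor (PolarForm D W.1)
          ((χ i W.1 W.2.1).rTensor (PolarForm D W.1) (B s))) := by
    intro i W
    -- The deviation of χ_i vanishes in E₁ ⊗ Ω¹(D), because ψ_i carries ∇ + ε A_i to ∇₁; so it has a
    -- coefficient of ε².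
    refine ⟨(q i W.1 W.2.1).rTensor (PolarForm D W.1) ∘ₗ deviation N N₂ W.2.2
      ((hE₂ i).mono W.2.1) (χ i W.1 W.2.1) ((A i).1 W), fun s => ?_⟩
    rw [LinearMap.comp_apply, hq3]
    · rw [deviation_apply]
      abel
    · rw [deviation_apply, map_sub, map_sub, ← π.π_nabla W.1 _ ((hE₁ i).mono W.2.1), hχ,
        h4 i W.1 W.2.1 W.2.2 _ s]
      have e1 : app π.π W.1 ∘ₗ χ i W.1 W.2.1 =
        ψ i W.1 W.2.1 W.2.2 ((hE₁ i).mono W.2.1) := LinearMap.ext (hχ i W.1 W.2.1)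
      have e2 : app π.π W.1 ∘ₗ app E₂.eps W.1 = app E₁.eps W.1 ∘ₗ app π.π W.1 :=
        LinearMap.ext (π.π_eps W.1)
      simp only [← LinearMap.comp_apply, ← LinearMap.rTensor_comp, ← LinearMap.comp_assoc, e2]
      simp only [LinearMap.comp_assoc, e1, LinearMap.comp_apply]
      simp only [add_sub_cancel_left]
      exact sub_self _
  choose B₀ hB₀ using key
  let B : ∀ i, EndForm E D (𝔙.U i) := fun i => ⟨B₀ i, fun W W' h s => by
    refine hinjT i W'.1 (h.trans W.2.1) _ _ ?_
    have e1 := hB₀ i W' (res E.sheaf h s)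
    have e2 := congrArg (resTw D E₂.sheaf h) (hB₀ i W s)
    have hε : ∀ t, resTw D E₂.sheaf h ((app E₂.eps W.1).rTensor (PolarForm D W.1) t) =
        (app E₂.eps W'.1).rTensor (PolarForm D W'.1) (resTw D E₂.sheaf h t) :=
      resTw_map D h _ _ (app_res E₂.eps h)
    have hc : ∀ t, resTw D E₂.sheaf h ((χ i W.1 W.2.1).rTensor (PolarForm D W.1) t) =
        (χ i W'.1 W'.2.1).rTensor (PolarForm D W'.1) (resTw D E.sheaf h t) :=
      resTw_map D h _ _ (hχres i _ _ W.2.1 h)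
    simp only [map_add, hε, hc] at e2
    rw [(A i).2 W W' h, N.nabla_res W.2.2 W'.2.2 h, hχres i _ _ W.2.1 h,
      N₂.nabla_res ((hE₂ i).mono W.2.1) ((hE₂ i).mono W'.2.1) h, e2] at e1
    exact (add_left_cancel e1).symm⟩
  have hB : ∀ i W (hW : W ≤ 𝔙.U i) (t : E.Triv W) s,
      N₂.nabla W ((hE₂ i).mono hW) (χ i W hW s) =
        (χ i W hW).rTensor (PolarForm D W) (N.nabla W t s) +
        (app E₂.eps W).rTensor (PolarForm D W)
          ((χ i W hW).rTensor (PolarForm D W) ((A i).1 ⟨W, hW, t⟩ s)) +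
        (app E₂.eps W).rTensor (PolarForm D W) ((app E₂.eps W).rTensor (PolarForm D W)
          ((χ i W hW).rTensor (PolarForm D W) ((B i).1 ⟨W, hW, t⟩ s))) :=
    fun i W hW t s => hB₀ i ⟨W, hW, t⟩ s
  -- The sign comes from the product of transition functions: b_il = b_ij + b_jl + a_ij a_jl, so the
  -- Čech coboundary of b is minus the cup square.
  refine ⟨-(b, B), Prod.ext (funext fun i => funext fun j => funext fun l => ?_)
    (funext fun i => funext fun j => ?_)⟩
  · refine Subtype.ext (funext fun W => LinearMap.ext fun s => ?_)
    obtain ⟨W, hW, t⟩ := W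
    have hij := hW.trans (𝔙.le₃₀₁ i j l)
    have hjl := hW.trans (𝔙.le₃₁₂ i j l)
    have hil := hW.trans (𝔙.le₃₀₂ i j l)
    have ea : (a i l).1 ⟨W, hil, t⟩ s = (a i j).1 ⟨W, hij, t⟩ s + (a j l).1 ⟨W, hjl, t⟩ s :=
      LinearMap.congr_fun (congrFun (congrArg Subtype.val (hz0 i j l)) ⟨W, hW, t⟩) s
    have ejl := hb j l W hjl t s
    have eil := hb i l W hil t s
    -- χ_l is expanded through χ_i in two ways, directly and by way of χ_j; the ε² terms give the
    -- relation for b.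
    rw [ejl, ea] at eil
    simp only [hb i j W hij t, map_add, app_eps_three, add_zero] at eil
    change -(b j l).1 ⟨W, hjl, t⟩ s - -(b i l).1 ⟨W, hil, t⟩ s + -(b i j).1 ⟨W, hij, t⟩ s =
      (a i j).1 ⟨W, hij, t⟩ ((a j l).1 ⟨W, hjl, t⟩ s)
    refine hinj i W (hij.trans (𝔙.le₂₀ i j)) _ _ ?_
    simp only [map_add, map_sub, map_neg]
    rw [← sub_eq_zero] at eil ⊢
    rw [← neg_eq_zero, ← eil]
    abel
  · refine EndForm.ext fun W s => ?_
    obtain ⟨W, hW, t⟩ := W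
    have hi := hW.trans (𝔙.le₂₀ i j)
    have hj := hW.trans (𝔙.le₂₁ i j)
    have ea : ∀ s, N.nabla W t ((a i j).1 ⟨W, hW, t⟩ s) -
        ((a i j).1 ⟨W, hW, t⟩).rTensor (PolarForm D W) (N.nabla W t s) =
        (A j).1 ⟨W, hj, t⟩ s - (A i).1 ⟨W, hi, t⟩ s := fun s =>
      LinearMap.congr_fun (congrFun (congrArg Subtype.val (hz1 i j)) ⟨W, hW, t⟩) s
    have e := gauge_formula (app_eps_three E₂ W) (hb i j W hW t)
      (N₂.nabla_eps ((hE₂ i).mono hi)) (hB i W hi t) ea (B' := (B j).1 ⟨W, hj, t⟩) s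
    rw [hB j W hj t s] at e
    -- ∇₂ χ_j is known both from B_j and from the gauge transformation of B_i. Equality forces ε²
    -- χ_i of the bracket in `gauge_formula` to vanish, and injectivity removes ε² χ_i.
    have e' := hinjT i W hi _ 0 ((left_eq_add.1 e).trans (by simp only [map_zero]))
    change -(B j).1 ⟨W, hj, t⟩ s - -(B i).1 ⟨W, hi, t⟩ s -
      (N.nabla W t (-(b i j).1 ⟨W, hW, t⟩ s) -
        (-(b i j).1 ⟨W, hW, t⟩).rTensor (PolarForm D W) (N.nabla W t s)) =
      ((a i j).1 ⟨W, hW, t⟩).rTensor (PolarForm D W) ((A j).1 ⟨W, hj, t⟩ s) -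
        (A i).1 ⟨W, hi, t⟩ ((a i j).1 ⟨W, hW, t⟩ s)
    rw [map_neg, LinearMap.rTensor_neg, LinearMap.neg_apply, ← sub_eq_zero, ← e']
    abel

end Obstruction

end KSpace

/-! ### The sheaf glued from copies of E[ε]/(ε³) -/

namespace KSpace

variable {k : Type u} [Field k] {X : KSpace k} {κ : Type u}

/-- Transition functions `1 + ε a_{ij} + ε² b_{ij}` for a sheaf of modules over `𝒪_X[ε]/(ε³)` glued
from copies of `E[ε]/(ε³)` over the open sets `U i`. -/
structure Gluing (E : X.Mods) (U : κ → Opens X.Pt) where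
  a : ∀ (i j : κ) (W : Opens X.Pt), W ≤ U i → W ≤ U j → Module.End (X.Fn W) (Sec E W)
  b : ∀ (i j : κ) (W : Opens X.Pt), W ≤ U i → W ≤ U j → Module.End (X.Fn W) (Sec E W)
  a_res : ∀ {i j : κ} {W V : Opens X.Pt} (hi : W ≤ U i) (hj : W ≤ U j) (h : V ≤ W) (s : Sec E W),
    a i j V (h.trans hi) (h.trans hj) (res E h s) = res E h (a i j W hi hj s)
  b_res : ∀ {i j : κ} {W V : Opens X.Pt} (hi : W ≤ U i) (hj : W ≤ U j) (h : V ≤ W) (s : Sec E W),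
    b i j V (h.trans hi) (h.trans hj) (res E h s) = res E h (b i j W hi hj s)
  a_cocycle : ∀ {i j l : κ} {W : Opens X.Pt} (hi : W ≤ U i) (hj : W ≤ U j) (hl : W ≤ U l)
    (s : Sec E W), a i l W hi hl s = a i j W hi hj s + a j l W hj hl s
  b_cocycle : ∀ {i j l : κ} {W : Opens X.Pt} (hi : W ≤ U i) (hj : W ≤ U j) (hl : W ≤ U l)
    (s : Sec E W), b i l W hi hl s =
      b i j W hi hj s + b j l W hj hl s + a i j W hi hj (a j l W hj hl s)

namespace Gluing

variable {E : X.Mods} {U : κ → Opens X.Pt} (G : Gluing E U)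

theorem a_self {i : κ} {W : Opens X.Pt} (hi hi' : W ≤ U i) (s : Sec E W) :
    G.a i i W hi hi' s = 0 := left_eq_add.1 (G.a_cocycle hi hi hi s)

theorem b_self {i : κ} {W : Opens X.Pt} (hi hi' : W ≤ U i) (s : Sec E W) :
    G.b i i W hi hi' s = 0 := by
  have h := G.b_cocycle hi hi hi s
  rw [G.a_self, add_zero] at h
  exact left_eq_add.1 h

/-- Pairs of an index `i` and an open subset of `U i ⊓ W`. -/
abbrev Idx (U : κ → Opens X.Pt) (W : Opens X.Pt) : Type u :=
  {p : κ × Opens X.Pt // p.2 ≤ U p.1 ∧ p.2 ≤ W}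

/-- Sections of the glued sheaf, given by their coefficients of `1, ε, ε²` in all the charts. -/
def SecSubgroup (W : Opens X.Pt) : AddSubgroup (∀ p : Idx U W, Fin 3 → Sec E p.1.2) where
  carrier := {s |
    (∀ (i : κ) (V V' : Opens X.Pt) (hi : V ≤ U i) (hV : V ≤ W) (h : V' ≤ V) (c : Fin 3),
      s ⟨(i, V'), h.trans hi, h.trans hV⟩ c = res E h (s ⟨(i, V), hi, hV⟩ c)) ∧
    -- The coefficients of 1, ε, ε² in s_i = (1 + ε a_ij + ε² b_ij) s_j.
    ∀ (i j : κ) (V : Opens X.Pt) (hi : V ≤ U i) (hj : V ≤ U j) (hV : V ≤ W),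
      s ⟨(i, V), hi, hV⟩ 0 = s ⟨(j, V), hj, hV⟩ 0 ∧
      s ⟨(i, V), hi, hV⟩ 1 = s ⟨(j, V), hj, hV⟩ 1 + G.a i j V hi hj (s ⟨(j, V), hj, hV⟩ 0) ∧
      s ⟨(i, V), hi, hV⟩ 2 = s ⟨(j, V), hj, hV⟩ 2 + G.a i j V hi hj (s ⟨(j, V), hj, hV⟩ 1) +
        G.b i j V hi hj (s ⟨(j, V), hj, hV⟩ 0)}
  zero_mem' := by
    refine ⟨fun i V V' hi hV h c => (map_zero (res E h)).symm, fun i j V hi hj hV => ?_⟩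
    simp only [Pi.zero_apply, map_zero, add_zero, and_self]
  add_mem' := by
    rintro s t ⟨hs, hs'⟩ ⟨ht, ht'⟩
    refine ⟨fun i V V' hi hV h c => ?_, fun i j V hi hj hV => ?_⟩
    · simp only [Pi.add_apply]
      rw [hs i V V' hi hV h, ht i V V' hi hV h, map_add]
    · obtain ⟨h0, h1, h2⟩ := hs' i j V hi hj hV
      obtain ⟨h0', h1', h2'⟩ := ht' i j V hi hj hV
      simp only [Pi.add_apply, map_add, h0, h0', h1, h1', h2, h2']
      refine ⟨trivial, ?_, ?_⟩ <;> abel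
  neg_mem' := by
    rintro s ⟨hs, hs'⟩
    refine ⟨fun i V V' hi hV h c => ?_, fun i j V hi hj hV => ?_⟩
    · simp only [Pi.neg_apply]
      rw [hs i V V' hi hV h, map_neg]
    · obtain ⟨h0, h1, h2⟩ := hs' i j V hi hj hV
      simp only [Pi.neg_apply, map_neg, h0, h1, h2]
      refine ⟨trivial, ?_, ?_⟩ <;> abel

/-- Sections of the glued sheaf. -/
def GSec (W : Opens X.Pt) : Type u := G.SecSubgroup W

noncomputable instance (W : Opens X.Pt) : AddCommGroup (G.GSec W) :=
  inferInstanceAs (AddCommGroup (G.SecSubgroup W))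

variable {G}

/-- The coefficients of a section in the chart `i`. -/
def GSec.co {W : Opens X.Pt} (s : G.GSec W) (i : κ) (V : Opens X.Pt) (hi : V ≤ U i) (hV : V ≤ W)
    (c : Fin 3) : Sec E V :=
  Subtype.val s ⟨(i, V), hi, hV⟩ c

theorem GSec.ext {W : Opens X.Pt} {s t : G.GSec W}
    (h : ∀ (i : κ) (V : Opens X.Pt) (hi : V ≤ U i) (hV : V ≤ W) (c : Fin 3),
      s.co i V hi hV c = t.co i V hi hV c) : s = t :=
  Subtype.ext <| funext fun ⟨(i, V), hi, hV⟩ => funext fun c => h i V hi hV c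

theorem GSec.co_res {W : Opens X.Pt} (s : G.GSec W) {i : κ} {V V' : Opens X.Pt} (hi : V ≤ U i)
    (hV : V ≤ W) (h : V' ≤ V) (c : Fin 3) :
    s.co i V' (h.trans hi) (h.trans hV) c = res E h (s.co i V hi hV c) :=
  s.2.1 i V V' hi hV h c

theorem GSec.co_zero {W : Opens X.Pt} (s : G.GSec W) {i j : κ} {V : Opens X.Pt} (hi : V ≤ U i)
    (hj : V ≤ U j) (hV : V ≤ W) : s.co i V hi hV 0 = s.co j V hj hV 0 :=
  (s.2.2 i j V hi hj hV).1

theorem GSec.co_one {W : Opens X.Pt} (s : G.GSec W) {i j : κ} {V : Opens X.Pt} (hi : V ≤ U i)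
    (hj : V ≤ U j) (hV : V ≤ W) :
    s.co i V hi hV 1 = s.co j V hj hV 1 + G.a i j V hi hj (s.co j V hj hV 0) :=
  (s.2.2 i j V hi hj hV).2.1

theorem GSec.co_two {W : Opens X.Pt} (s : G.GSec W) {i j : κ} {V : Opens X.Pt} (hi : V ≤ U i)
    (hj : V ≤ U j) (hV : V ≤ W) :
    s.co i V hi hV 2 = s.co j V hj hV 2 + G.a i j V hi hj (s.co j V hj hV 1) +
      G.b i j V hi hj (s.co j V hj hV 0) :=
  (s.2.2 i j V hi hj hV).2.2

variable (G)

/-- Sections from coefficients in all charts. -/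
def GSec.of {W : Opens X.Pt} (s : ∀ (i : κ) (V : Opens X.Pt), V ≤ U i → V ≤ W → Fin 3 → Sec E V)
    (h : ∀ (i : κ) (V V' : Opens X.Pt) (hi : V ≤ U i) (hV : V ≤ W) (h : V' ≤ V) (c : Fin 3),
      s i V' (h.trans hi) (h.trans hV) c = res E h (s i V hi hV c))
    (h' : ∀ (i j : κ) (V : Opens X.Pt) (hi : V ≤ U i) (hj : V ≤ U j) (hV : V ≤ W),
      s i V hi hV 0 = s j V hj hV 0 ∧
      s i V hi hV 1 = s j V hj hV 1 + G.a i j V hi hj (s j V hj hV 0) ∧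
      s i V hi hV 2 = s j V hj hV 2 + G.a i j V hi hj (s j V hj hV 1) +
        G.b i j V hi hj (s j V hj hV 0)) : G.GSec W :=
  ⟨fun p => s p.1.1 p.1.2 p.2.1 p.2.2, h, h'⟩

noncomputable instance (W : Opens X.Pt) : Module (X.Fn W) (G.GSec W) where
  smul f s := GSec.of G (fun i V hi hV c => X.resFn hV f • s.co i V hi hV c)
    (fun i V V' hi hV h c => by rw [s.co_res hi hV h, map_smulₛₗ, resFn_resFn])
    (fun i j V hi hj hV => by
      rw [s.co_zero hi hj, s.co_one hi hj, s.co_two hi hj]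
      simp only [smul_add, map_smul, and_self])
  one_smul s := GSec.ext fun i V hi hV c => by
    change X.resFn hV 1 • s.co i V hi hV c = _
    rw [map_one, one_smul]
  mul_smul f g s := GSec.ext fun i V hi hV c => by
    change X.resFn hV (f * g) • s.co i V hi hV c = X.resFn hV f • X.resFn hV g • s.co i V hi hV c
    rw [map_mul, mul_smul]
  smul_zero f := GSec.ext fun i V hi hV c => smul_zero (X.resFn hV f)
  smul_add f s t := GSec.ext fun i V hi hV c => smul_add (X.resFn hV f) _ _
  add_smul f g s := GSec.ext fun i V hi hV c => by
    change X.resFn hV (f + g) • s.co i V hi hV c =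
      X.resFn hV f • s.co i V hi hV c + X.resFn hV g • s.co i V hi hV c
    rw [map_add, add_smul]
  zero_smul s := GSec.ext fun i V hi hV c => by
    change X.resFn hV 0 • s.co i V hi hV c = 0
    rw [map_zero, zero_smul]

variable {G} in
theorem GSec.co_smul {W : Opens X.Pt} (f : X.Fn W) (s : G.GSec W) (i : κ) (V : Opens X.Pt)
    (hi : V ≤ U i) (hV : V ≤ W) (c : Fin 3) :
    (f • s).co i V hi hV c = X.resFn hV f • s.co i V hi hV c := rfl

/-- Restriction of sections. -/
noncomputable def resG {W W' : Opens X.Pt} (h : W' ≤ W) : G.GSec W →+ G.GSec W' :=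
  AddMonoidHom.mk' (fun s => GSec.of G (fun i V hi (hV : V ≤ W') => s.co i V hi (hV.trans h))
    (fun _ _ _ hi hV h' => s.co_res hi (hV.trans h) h')
    (fun _ _ _ hi hj _ => ⟨s.co_zero hi hj _, s.co_one hi hj _, s.co_two hi hj _⟩))
    fun _ _ => rfl

theorem resG_smul {W W' : Opens X.Pt} (h : W' ≤ W) (f : X.Fn W) (s : G.GSec W) :
    G.resG h (f • s) = X.resFn h f • G.resG h s := GSec.ext fun i V hi hV c => by
  change X.resFn (hV.trans h) f • s.co i V hi _ c =
    X.resFn hV (X.resFn h f) • s.co i V hi (hV.trans h) c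
  rw [resFn_resFn]

/-- The presheaf of abelian groups underlying the glued sheaf. -/
noncomputable def presheafAb : (Opens X.Pt)ᵒᵖ ⥤ Ab.{u} where
  obj W := AddCommGrpCat.of (G.GSec W.unop)
  map f := AddCommGrpCat.ofHom (G.resG f.unop.le)
  -- Coefficients are recorded on all small opens, so restriction only forgets some of them and
  -- functoriality is definitional.
  map_id _ := rfl
  map_comp _ _ := rfl

/-- Each coefficient in each chart glues because `E` is a sheaf; the gluing relations are local,
since a_ij and b_ij commute with restriction. -/
theorem presheafAb_isSheaf : TopCat.Presheaf.IsSheaf (X := X.toLRS.toTopCat) G.presheafAb := by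
  rw [TopCat.Presheaf.isSheaf_iff_isSheafUniqueGluing]
  intro ι O (sf : ∀ α, G.GSec (O α)) hsf
  have hcompat : ∀ α β i V hi (hα : V ≤ O α) (hβ : V ≤ O β) c,
      (sf α).co i V hi hα c = (sf β).co i V hi hβ c := fun α β i V hi hα hβ c =>
    congrArg (fun s : G.GSec (O α ⊓ O β) => s.co i V hi (le_inf hα hβ) c) (hsf α β)
  have key : ∀ (i : κ) (V : Opens X.Pt) (_ : V ≤ U i) (_ : V ≤ iSup O) (c : Fin 3),
      ∃ t : Sec E V, ∀ (α : ι) (V' : Opens X.Pt) (h : V' ≤ V) (hi : V' ≤ U i) (hα : V' ≤ O α),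
        res E h t = (sf α).co i V' hi hα c := by
    intro i V hi hV c
    -- Local solutions are the coefficients of any of the given sections; compatibility of the
    -- family makes them unique.
    obtain ⟨t, ht⟩ := Sec.exists_of_unique E (U := V) (fun V' t =>
        ∃ (α : ι) (hi : V' ≤ U i) (hα : V' ≤ O α), t = (sf α).co i V' hi hα c)
      (by
        rintro V' V'' h _ ⟨α, hi, hα, rfl⟩
        exact ⟨α, h.trans hi, h.trans hα, ((sf α).co_res hi hα h c).symm⟩)
      (by
        rintro V' h _ _ ⟨α, hi, hα, rfl⟩ ⟨β, hi, hβ, rfl⟩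
        exact hcompat α β i V' hi hα hβ c)
      (fun x hx => by
        obtain ⟨α, hα⟩ := Opens.mem_iSup.1 (hV hx)
        exact ⟨V ⊓ O α, inf_le_left, ⟨hx, hα⟩, _, α, inf_le_left.trans hi, inf_le_right, rfl⟩)
    exact ⟨t, fun α V' h hi hα => ht V' h _ ⟨α, hi, hα, rfl⟩⟩
  choose t ht using key
  have loc : ∀ {V : Opens X.Pt}, V ≤ iSup O → ∀ s s' : Sec E V,
      (∀ α, res E (inf_le_left : V ⊓ O α ≤ V) s = res E inf_le_left s') → s = s' := by
    intro V hV s s' h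
    refine Sec.eq_of_locally_eq E _ _ fun x hx => ?_
    obtain ⟨α, hα⟩ := Opens.mem_iSup.1 (hV hx)
    exact ⟨V ⊓ O α, inf_le_left, ⟨hx, hα⟩, h α⟩
  refine ⟨GSec.of G t (fun i V V' hi hV h c => loc (h.trans hV) _ _ fun α => ?_)
    (fun i j V hi hj hV => ⟨loc hV _ _ fun α => ?_, loc hV _ _ fun α => ?_,
      loc hV _ _ fun α => ?_⟩), fun α => ?_, fun s hs => ?_⟩
  · rw [ht _ _ _ _ _ α _ _ (inf_le_left.trans (h.trans hi)) inf_le_right, res_res,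
      ht _ _ _ _ _ α _ _ (inf_le_left.trans (h.trans hi)) inf_le_right]
  · rw [ht _ _ _ _ _ α _ _ (inf_le_left.trans hi) inf_le_right,
      ht _ _ _ _ _ α _ _ (inf_le_left.trans hj) inf_le_right]
    exact (sf α).co_zero _ _ _
  · rw [map_add, ← G.a_res, ht _ _ _ _ _ α _ _ (inf_le_left.trans hi) inf_le_right,
      ht _ _ _ _ _ α _ _ (inf_le_left.trans hj) inf_le_right,
      ht _ _ _ _ _ α _ _ (inf_le_left.trans hj) inf_le_right]
    exact (sf α).co_one _ _ _
  · rw [map_add, map_add, ← G.a_res, ← G.b_res,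
      ht _ _ _ _ _ α _ _ (inf_le_left.trans hi) inf_le_right,
      ht _ _ _ _ _ α _ _ (inf_le_left.trans hj) inf_le_right,
      ht _ _ _ _ _ α _ _ (inf_le_left.trans hj) inf_le_right,
      ht _ _ _ _ _ α _ _ (inf_le_left.trans hj) inf_le_right]
    exact (sf α).co_two _ _ _
  · refine GSec.ext fun i V hi hV c => ?_
    change t i V hi (hV.trans (le_iSup O α)) c = (sf α).co i V hi hV c
    rw [← ht i V hi (hV.trans (le_iSup O α)) c α V le_rfl hi hV, res_self]
  · refine GSec.ext fun i V hi hV c => loc hV _ _ fun α => ?_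
    change res E _ (GSec.co s i V hi hV c) = res E _ (t i V hi hV c)
    rw [ht _ _ _ _ _ α _ _ (inf_le_left.trans hi) inf_le_right]
    refine ((GSec.co_res (G := G) s hi hV inf_le_left c).symm).trans ?_
    exact congrArg (fun s : G.GSec (O α) => s.co i (V ⊓ O α) (inf_le_left.trans hi) inf_le_right c)
      (hs α)

noncomputable instance (W : (Opens X.Pt)ᵒᵖ) :
    Module (X.ringSheaf.obj.obj W) (G.presheafAb.obj W) :=
  inferInstanceAs (Module (X.Fn W.unop) (G.GSec W.unop))

/-- The glued sheaf. -/
noncomputable def mods : X.Mods where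
  val := PresheafOfModules.ofPresheaf (R := X.ringSheaf.obj) G.presheafAb
    (fun _ _ f r m => G.resG_smul f.unop.le r m)
  isSheaf := G.presheafAb_isSheaf

end Gluing

end KSpace

namespace KSpace

variable {k : Type u} [Field k] {X : KSpace k} {D : X.CartierDivisor} {κ : Type u}

/-! ### Gluing morphisms and connections -/

section LocalToGlobal

/-- A morphism of sheaves of modules from its effect on sections. -/
noncomputable def modsHomMk {F F' : X.Mods} (φ : ∀ W : Opens X.Pt, Sec F W →ₗ[X.Fn W] Sec F' W)
    (hφ : ∀ (W W' : Opens X.Pt) (h : W' ≤ W) (s : Sec F W),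
      φ W' (res F h s) = res F' h (φ W s)) : F ⟶ F' where
  val := PresheafOfModules.homMk
    { app := fun W => AddCommGrpCat.ofHom (φ W.unop).toAddMonoidHom
      naturality := fun W W' f => by
        ext s
        exact hφ W.unop W'.unop f.unop.le s }
    (fun W r m => (φ W.unop).map_smul r m)

theorem app_modsHomMk {F F' : X.Mods} (φ : ∀ W : Opens X.Pt, Sec F W →ₗ[X.Fn W] Sec F' W)
    (hφ : ∀ (W W' : Opens X.Pt) (h : W' ≤ W) (s : Sec F W),
      φ W' (res F h s) = res F' h (φ W s)) (W : Opens X.Pt) :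
    app (modsHomMk φ hφ) W = φ W := rfl

theorem DGPair.Cover.exists_inf_mem (𝔘 : DGPair.Cover X.toLRS.toTopCat κ) {U : Opens X.Pt}
    {x : X.Pt} (hx : x ∈ U) : ∃ i, x ∈ U ⊓ 𝔘.U i := by
  obtain ⟨i, hi⟩ := 𝔘.covers x
  exact ⟨i, hx, hi⟩

/-- Morphisms of sheaves of modules can be glued. -/
theorem exists_glued_hom (𝔘 : DGPair.Cover X.toLRS.toTopCat κ) {F F' : X.Mods}
    (φ : ∀ (i : κ) (W : Opens X.Pt), W ≤ 𝔘.U i → (Sec F W →ₗ[X.Fn W] Sec F' W))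
    (hres : ∀ (i : κ) (W W' : Opens X.Pt) (hi : W ≤ 𝔘.U i) (h : W' ≤ W) (s : Sec F W),
      φ i W' (h.trans hi) (res F h s) = res F' h (φ i W hi s))
    (hov : ∀ (i j : κ) (W : Opens X.Pt) (hi : W ≤ 𝔘.U i) (hj : W ≤ 𝔘.U j) (s : Sec F W),
      φ i W hi s = φ j W hj s) :
    ∃ f : F ⟶ F', ∀ (i : κ) (W : Opens X.Pt) (hi : W ≤ 𝔘.U i) (s : Sec F W),
      app f W s = φ i W hi s := by
  have key : ∀ (U : Opens X.Pt) (s : Sec F U), ∃ t : Sec F' U,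
      ∀ (i : κ) (W : Opens X.Pt) (hi : W ≤ 𝔘.U i) (h : W ≤ U),
        res F' h t = φ i W hi (res F h s) := by
    intro U s
    obtain ⟨t, ht⟩ := Sec.exists_of_unique F' (U := U)
      (fun V t => ∃ (i : κ) (hi : V ≤ 𝔘.U i) (h : V ≤ U), t = φ i V hi (res F h s))
      (by
        rintro V W h _ ⟨i, hi, hV, rfl⟩
        exact ⟨i, h.trans hi, h.trans hV, by rw [← hres, res_res]⟩)
      (by
        rintro V hV _ _ ⟨i, hi, _, rfl⟩ ⟨j, hj, _, rfl⟩
        exact hov i j V hi hj _)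
      (fun x hx => by
        obtain ⟨i, hi⟩ := DGPair.Cover.exists_inf_mem 𝔘 hx
        exact ⟨_, inf_le_left, hi, _, i, inf_le_right, inf_le_left, rfl⟩)
    exact ⟨t, fun i W hi h => ht W h _ ⟨i, hi, h, rfl⟩⟩
  choose t ht using key
  have loc : ∀ {U : Opens X.Pt} (s s' : Sec F' U), (∀ i, res F' (inf_le_left : U ⊓ 𝔘.U i ≤ U) s =
      res F' inf_le_left s') → s = s' := fun {U} s s' h =>
    Sec.eq_of_locally_eq F' s s' fun x hx => by
      obtain ⟨i, hi⟩ := DGPair.Cover.exists_inf_mem 𝔘 hx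
      exact ⟨_, inf_le_left, hi, h i⟩
  refine ⟨modsHomMk (fun U =>
    { toFun := t U
      map_add' := fun s s' => loc _ _ fun i => ?_
      map_smul' := fun f s => loc _ _ fun i => ?_ }) (fun U V h s => loc _ _ fun i => ?_),
    fun i W hi s => ?_⟩
  · rw [map_add, ht _ _ i _ inf_le_right, ht _ _ i _ inf_le_right, ht _ _ i _ inf_le_right,
      map_add, map_add]
  · rw [RingHom.id_apply, map_smulₛₗ, ht _ _ i _ inf_le_right, ht _ _ i _ inf_le_right,
      map_smulₛₗ, map_smul]
  · change res F' _ (t V (res F h s)) = res F' _ (res F' h (t U s))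
    rw [ht _ _ i _ inf_le_right, res_res, res_res, ht _ _ i _ inf_le_right]
  · rw [app_modsHomMk]
    change t W s = _
    rw [← res_self F' (t W s), ht W s i W hi le_rfl, res_self]

/-- Connections can be glued. -/
theorem exists_glued_connection (𝔘 : DGPair.Cover X.toLRS.toTopCat κ) {m : ℕ} (F : X.Bundle m)
    (n : ∀ (i : κ) (W : Opens X.Pt), W ≤ 𝔘.U i → (Sec F.sheaf W →+ Tw D F.sheaf W))
    (hres : ∀ (i : κ) (W W' : Opens X.Pt) (hi : W ≤ 𝔘.U i) (h : W' ≤ W) (s : Sec F.sheaf W),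
      n i W' (h.trans hi) (res F.sheaf h s) = resTw D F.sheaf h (n i W hi s))
    (hov : ∀ (i j : κ) (W : Opens X.Pt) (hi : W ≤ 𝔘.U i) (hj : W ≤ 𝔘.U j) (s : Sec F.sheaf W),
      n i W hi s = n j W hj s)
    (hleib : ∀ (i : κ) (W : Opens X.Pt) (hi : W ≤ 𝔘.U i) (f : X.Fn W) (s : Sec F.sheaf W),
      n i W hi (f • s) = f • n i W hi s + s ⊗ₜ dForm D f)
    (heps : ∀ (i : κ) (W : Opens X.Pt) (hi : W ≤ 𝔘.U i) (s : Sec F.sheaf W),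
      n i W hi (app F.eps W s) = (app F.eps W).rTensor (PolarForm D W) (n i W hi s)) :
    ∃ N : Connection D F, ∀ (i : κ) (W : Opens X.Pt) (hi : W ≤ 𝔘.U i) (t : F.Triv W)
      (s : Sec F.sheaf W), N.nabla W t s = n i W hi s := by
  have key : ∀ (U : Opens X.Pt) (_ : F.Triv U) (s : Sec F.sheaf U), ∃ t : Tw D F.sheaf U,
      ∀ (i : κ) (W : Opens X.Pt) (hi : W ≤ 𝔘.U i) (h : W ≤ U),
        resTw D F.sheaf h t = n i W hi (res F.sheaf h s) := by
    intro U hU s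
    -- Agreement on overlaps leaves one candidate on each small open set. Triviality of F over U is
    -- what allows the candidates to be glued in `Tw`.
    obtain ⟨t, ht⟩ := Tw.exists_of_unique hU
      (fun V t => ∃ (i : κ) (hi : V ≤ 𝔘.U i) (h : V ≤ U), t = n i V hi (res F.sheaf h s))
      (by
        rintro V W h _ ⟨i, hi, hV, rfl⟩
        exact ⟨i, h.trans hi, h.trans hV, by rw [← hres, res_res]⟩)
      (by
        rintro V hV _ _ ⟨i, hi, _, rfl⟩ ⟨j, hj, _, rfl⟩
        exact hov i j V hi hj _)
      (fun x hx => by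
        obtain ⟨i, hi⟩ := DGPair.Cover.exists_inf_mem 𝔘 hx
        exact ⟨_, inf_le_left, hi, _, i, inf_le_right, inf_le_left, rfl⟩)
    exact ⟨t, fun i W hi h => ht W h _ ⟨i, hi, h, rfl⟩⟩
  choose t ht using key
  have loc : ∀ {U : Opens X.Pt} (_ : F.Triv U) (s s' : Tw D F.sheaf U),
      (∀ i, resTw D F.sheaf (inf_le_left : U ⊓ 𝔘.U i ≤ U) s = resTw D F.sheaf inf_le_left s') →
        s = s' := fun {U} hU s s' h =>
    Tw.eq_of_locally_eq hU s s' fun x hx => by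
      obtain ⟨i, hi⟩ := DGPair.Cover.exists_inf_mem 𝔘 hx
      exact ⟨_, inf_le_left, hi, h i⟩
  refine ⟨{ nabla := fun U hU => AddMonoidHom.mk' (t U hU) fun s s' => loc hU _ _ fun i => ?_
            nabla_res := fun {U V} hU hV h s => loc hV _ _ fun i => ?_
            leibniz := fun {U} hU f s => loc hU _ _ fun i => ?_
            nabla_eps := fun {U} hU s => loc hU _ _ fun i => ?_ }, fun i W hi hW s => ?_⟩
  · rw [map_add, ht _ _ _ i _ inf_le_right, ht _ _ _ i _ inf_le_right, ht _ _ _ i _ inf_le_right,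
      map_add, map_add]
  · rw [AddMonoidHom.mk'_apply, AddMonoidHom.mk'_apply, ht _ _ _ i _ inf_le_right, res_res,
      resTw_resTw, ht _ _ _ i _ inf_le_right]
  · rw [AddMonoidHom.mk'_apply, map_add, resTw_smul, resTw_tmul,
      resForm_dForm, ht _ _ _ i _ inf_le_right, ht _ _ _ i _ inf_le_right, map_smulₛₗ, hleib]
  · rw [AddMonoidHom.mk'_apply,
      resTw_map D inf_le_left _ _ (app_res F.eps inf_le_left), ht _ _ _ i _ inf_le_right,
      ht _ _ _ i _ inf_le_right, ← app_res, heps]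
  · change t W hW s = _
    rw [← resTw_self D (t W hW s), ht W hW s i W hi le_rfl, res_self]

end LocalToGlobal

/-! ### Charts of the glued sheaf -/

namespace Gluing

variable {E : X.Mods} {U : κ → Opens X.Pt} (G : Gluing E U)

/-- Multiplication by `ε` on the glued sheaf. -/
noncomputable def eps : G.mods ⟶ G.mods :=
  modsHomMk (fun W =>
    { toFun := fun s => GSec.of G
        (fun i V hi hV => ![0, GSec.co (G := G) s i V hi hV 0, GSec.co (G := G) s i V hi hV 1])
        (fun i V V' hi hV h c => by
          fin_cases c
          · exact (map_zero (res E h)).symm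
          · exact GSec.co_res (G := G) s hi hV h 0
          · exact GSec.co_res (G := G) s hi hV h 1)
        -- Shifted coefficients satisfy the gluing relations of one order lower.
        (fun i j V hi hj hV => by
          refine ⟨rfl, ?_, ?_⟩
          · change GSec.co (G := G) s i V hi hV 0 = GSec.co (G := G) s j V hj hV 0 + G.a _ _ _ _ _ 0
            rw [map_zero, add_zero]
            exact GSec.co_zero (G := G) s hi hj hV
          · change GSec.co (G := G) s i V hi hV 1 = GSec.co (G := G) s j V hj hV 1 +
              G.a _ _ _ _ _ (GSec.co (G := G) s j V hj hV 0) + G.b _ _ _ _ _ 0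
            rw [map_zero, add_zero]
            exact GSec.co_one (G := G) s hi hj hV)
      map_add' := fun s t => GSec.ext (G := G) fun i V hi hV c => by
        fin_cases c
        · exact (add_zero (0 : Sec E V)).symm
        · rfl
        · rfl
      map_smul' := fun f s => GSec.ext (G := G) fun i V hi hV c => by
        fin_cases c
        · exact (smul_zero (X.resFn hV f)).symm
        · rfl
        · rfl })
    (fun W W' h s => rfl)

/-- The coefficients of a section in the chart `i`. -/
noncomputable def coef (i : κ) (W : Opens X.Pt) (hi : W ≤ U i) (c : Fin 3) :
    Sec G.mods W →ₗ[X.Fn W] Sec E W where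
  toFun s := GSec.co (G := G) s i W hi le_rfl c
  map_add' _ _ := rfl
  map_smul' f s := (GSec.co_smul (G := G) f s i W hi le_rfl c).trans (by rw [resFn_self]; rfl)

/-- The section `s` of `E`, regarded as a section of the glued sheaf by the chart `i`. -/
noncomputable def lift (i : κ) (W : Opens X.Pt) (hi : W ≤ U i) :
    Sec E W →ₗ[X.Fn W] Sec G.mods W where
  -- In the chart j the section s of the chart i becomes (1 + ε a_ji + ε² b_ji) s; the cocycle
  -- relations for the indices j, l, i are then exactly the gluing relations.
  toFun s := GSec.of G (fun j V hj hV => ![res E hV s, G.a j i V hj (hV.trans hi) (res E hV s),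
      G.b j i V hj (hV.trans hi) (res E hV s)])
    (fun j V V' hj hV h c => by
      fin_cases c
      · exact (res_res E hV h s).symm
      · refine Eq.trans ?_ (G.a_res hj (hV.trans hi) h (res E hV s))
        rw [res_res]
        rfl
      · refine Eq.trans ?_ (G.b_res hj (hV.trans hi) h (res E hV s))
        rw [res_res]
        rfl)
    (fun j l V hj hl hV => by
      refine ⟨rfl, ?_, ?_⟩
      · exact (G.a_cocycle hj hl (hV.trans hi) _).trans (add_comm _ _)
      · refine (G.b_cocycle hj hl (hV.trans hi) _).trans ?_
        rw [add_comm (G.b j l V hj hl _), add_right_comm]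
        rfl)
  map_add' s t := GSec.ext (G := G) fun j V hj hV c => by
    fin_cases c
    · exact map_add (res E hV) s t
    · exact (congrArg (G.a j i V hj (hV.trans hi)) (map_add (res E hV) s t)).trans
        (map_add (G.a j i V hj (hV.trans hi)) _ _)
    · exact (congrArg (G.b j i V hj (hV.trans hi)) (map_add (res E hV) s t)).trans
        (map_add (G.b j i V hj (hV.trans hi)) _ _)
  map_smul' f s := GSec.ext (G := G) fun j V hj hV c => by
    fin_cases c
    · exact map_smulₛₗ (res E hV) f s
    · exact (congrArg (G.a j i V hj (hV.trans hi)) (map_smulₛₗ (res E hV) f s)).trans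
        (map_smul (G.a j i V hj (hV.trans hi)) _ _)
    · exact (congrArg (G.b j i V hj (hV.trans hi)) (map_smulₛₗ (res E hV) f s)).trans
        (map_smul (G.b j i V hj (hV.trans hi)) _ _)

variable {G}

theorem coef_res {i : κ} {W V : Opens X.Pt} (hi : W ≤ U i) (h : V ≤ W) (c : Fin 3)
    (s : Sec G.mods W) : G.coef i V (h.trans hi) c (res G.mods h s) = res E h (G.coef i W hi c s) :=
  GSec.co_res (G := G) s hi le_rfl h c

theorem lift_res {i : κ} {W V : Opens X.Pt} (hi : W ≤ U i) (h : V ≤ W) (s : Sec E W) :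
    G.lift i V (h.trans hi) (res E h s) = res G.mods h (G.lift i W hi s) :=
  GSec.ext (G := G) fun j V' hj hV' c => by
    have e := res_res E h hV' s
    fin_cases c
    · exact e
    · exact congrArg _ e
    · exact congrArg _ e

theorem coef_eps_zero {i : κ} {W : Opens X.Pt} (hi : W ≤ U i) (s : Sec G.mods W) :
    G.coef i W hi 0 (app G.eps W s) = 0 := rfl

theorem coef_eps_one {i : κ} {W : Opens X.Pt} (hi : W ≤ U i) (s : Sec G.mods W) :
    G.coef i W hi 1 (app G.eps W s) = G.coef i W hi 0 s := rfl

theorem coef_eps_two {i : κ} {W : Opens X.Pt} (hi : W ≤ U i) (s : Sec G.mods W) :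
    G.coef i W hi 2 (app G.eps W s) = G.coef i W hi 1 s := rfl

theorem coef_lift_zero {i j : κ} {W : Opens X.Pt} (hi : W ≤ U i) (hj : W ≤ U j) (s : Sec E W) :
    G.coef i W hi 0 (G.lift j W hj s) = s := res_self E s

theorem coef_lift_one {i j : κ} {W : Opens X.Pt} (hi : W ≤ U i) (hj : W ≤ U j) (s : Sec E W) :
    G.coef i W hi 1 (G.lift j W hj s) = G.a i j W hi hj s := congrArg _ (res_self E s)

theorem coef_lift_two {i j : κ} {W : Opens X.Pt} (hi : W ≤ U i) (hj : W ≤ U j) (s : Sec E W) :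
    G.coef i W hi 2 (G.lift j W hj s) = G.b i j W hi hj s := congrArg _ (res_self E s)

/-- Inside U i the chart i suffices, as the gluing relations compute the coefficients in all other
charts from those in this one. -/
theorem ext_coef {i : κ} {W : Opens X.Pt} (hi : W ≤ U i) {s t : Sec G.mods W}
    (h : ∀ c, G.coef i W hi c s = G.coef i W hi c t) : s = t := by
  have h' : ∀ V (hV : V ≤ W) c, GSec.co (G := G) s i V (hV.trans hi) hV c =
      GSec.co (G := G) t i V (hV.trans hi) hV c := fun V hV c =>
    (GSec.co_res (G := G) s hi le_rfl hV c).trans ((congrArg (res E hV) (h c)).trans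
      (GSec.co_res (G := G) t hi le_rfl hV c).symm)
  refine GSec.ext (G := G) fun j V hj hV c => ?_
  have hVi := hV.trans hi
  fin_cases c
  · exact (GSec.co_zero (G := G) s hj hVi hV).trans
      ((h' V hV 0).trans (GSec.co_zero (G := G) t hj hVi hV).symm)
  · refine (GSec.co_one (G := G) s hj hVi hV).trans
      (Eq.trans ?_ (GSec.co_one (G := G) t hj hVi hV).symm)
    rw [h' V hV 0, h' V hV 1]
  · refine (GSec.co_two (G := G) s hj hVi hV).trans
      (Eq.trans ?_ (GSec.co_two (G := G) t hj hVi hV).symm)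
    rw [h' V hV 0, h' V hV 1, h' V hV 2]

theorem ext_coef' {i : κ} {W : Opens X.Pt} (hi : W ≤ U i) {s t : Sec G.mods W}
    (h0 : G.coef i W hi 0 s = G.coef i W hi 0 t) (h1 : G.coef i W hi 1 s = G.coef i W hi 1 t)
    (h2 : G.coef i W hi 2 s = G.coef i W hi 2 t) : s = t :=
  ext_coef hi fun c => by
    fin_cases c
    exacts [h0, h1, h2]

/-- Since a_ii and b_ii vanish, a section lifted by the chart i has only a constant coefficient
there; so the chart i identifies the glued sheaf with E[ε]/(ε³). -/
theorem decomp {i : κ} {W : Opens X.Pt} (hi : W ≤ U i) (s : Sec G.mods W) :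
    s = G.lift i W hi (G.coef i W hi 0 s) + app G.eps W (G.lift i W hi (G.coef i W hi 1 s)) +
      app G.eps W (app G.eps W (G.lift i W hi (G.coef i W hi 2 s))) := by
  refine ext_coef' hi ?_ ?_ ?_ <;>
  simp only [map_add, coef_eps_zero, coef_eps_one, coef_eps_two, coef_lift_zero, coef_lift_one,
    coef_lift_two, a_self, b_self, add_zero, zero_add]

/-- The glued sheaf has the prescribed transition functions, in the form that `gauge_formula` asks
for. -/
theorem lift_eq {i j : κ} {W : Opens X.Pt} (hi : W ≤ U i) (hj : W ≤ U j) (s : Sec E W) :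
    G.lift j W hj s = G.lift i W hi s + app G.eps W (G.lift i W hi (G.a i j W hi hj s)) +
      app G.eps W (app G.eps W (G.lift i W hi (G.b i j W hi hj s))) := by
  refine ext_coef' hi ?_ ?_ ?_ <;>
  simp only [map_add, coef_eps_zero, coef_eps_one, coef_eps_two, coef_lift_zero, coef_lift_one,
    coef_lift_two, a_self, b_self, add_zero, zero_add]

theorem eps_three (W : Opens X.Pt) (s : Sec G.mods W) :
    app G.eps W (app G.eps W (app G.eps W s)) = 0 :=
  GSec.ext (G := G) fun i V hi hV c => by fin_cases c <;> rfl

/-- In the chart i the coefficient of ε^j involves only the functions c p j, so bijectivity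
separates into three copies of that for `e`. -/
theorem isFrame_lift {ε : E ⟶ E} {r : ℕ} {i : κ} {W : Opens X.Pt} (hi : W ≤ U i)
    {e : Fin r → Sec E W} (he : IsFrame ε 0 e) :
    IsFrame G.eps 2 fun p => G.lift i W hi (e p) := by
  intro V hV
  have hVi := hV.trans hi
  -- For n = 0 the inner sum runs over `Fin 1` and contains only ε⁰, so `e` is a basis over 𝒪_X;
  -- coefficient families are passed to it as functions constant in that index.
  have hb := he V hV
  simp only [Fin.sum_univ_succ, Fin.sum_univ_zero, Fin.val_zero, pow_zero, Module.End.one_apply,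
    add_zero] at hb
  have hF : ∀ (c : Fin r → Fin 3 → X.Fn V) (j : Fin 3), G.coef i V hVi j
      (∑ p, ∑ j, c p j • ((app G.eps V) ^ (j : ℕ)) (res G.mods hV (G.lift i W hi (e p)))) =
      ∑ p, c p j • res E hV (e p) := by
    intro c j
    rw [map_sum]
    refine Finset.sum_congr rfl fun p _ => ?_
    rw [← lift_res]
    simp only [Fin.sum_univ_three, map_add, map_smul, Fin.val_zero, Fin.val_one, Fin.val_two,
      pow_zero, pow_one, pow_two, Module.End.one_apply, Module.End.mul_apply]
    fin_cases j <;>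
    simp [coef_eps_zero, coef_eps_one, coef_eps_two, coef_lift_zero, coef_lift_one,
      coef_lift_two, a_self, b_self]
  constructor
  · intro c c' h
    funext p j
    have h1 := congrArg (G.coef i V hVi j) h
    simp only [hF] at h1
    exact congrFun (congrFun (@hb.1 (fun p _ => c p j) (fun p _ => c' p j) h1) p) 0
  · intro s
    choose c hc using fun j => hb.2 (G.coef i V hVi j s)
    refine ⟨fun p j => c j p 0, ext_coef hVi fun j => ?_⟩
    exact (hF _ j).trans (hc j)

end Gluing

end KSpace

namespace KSpace

variable {k : Type u} [Field k] {X : KSpace k} {D : X.CartierDivisor} {κ : Type u}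
  {E : X.Bundle 0} {N : Connection D E} {𝔙 : DGPair.Cover X.toLRS.toTopCat κ}

/-! ### The glued bundle and its connection -/

namespace Gluing

/-- Transition functions given by sections of `𝓔nd(E)`. -/
def ofEnd (hE : ∀ i, E.Triv (𝔙.U i)) (a b : ∀ i j, EndSec E (𝔙.U₂ i j))
    (ha : ∀ i j l, resEnd E (𝔙.le₃₀₂ i j l) (a i l) =
      resEnd E (𝔙.le₃₀₁ i j l) (a i j) + resEnd E (𝔙.le₃₁₂ i j l) (a j l))
    (hb : ∀ i j l, resEnd E (𝔙.le₃₀₂ i j l) (b i l) =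
      resEnd E (𝔙.le₃₀₁ i j l) (b i j) + resEnd E (𝔙.le₃₁₂ i j l) (b j l) +
        resEnd E (𝔙.le₃₀₁ i j l) (a i j) * resEnd E (𝔙.le₃₁₂ i j l) (a j l)) :
    Gluing E.sheaf 𝔙.U where
  a i j W hi hj := (a i j).1 ⟨W, le_inf hi hj, (hE i).mono hi⟩
  b i j W hi hj := (b i j).1 ⟨W, le_inf hi hj, (hE i).mono hi⟩
  a_res {i j W V} hi hj h s := (a i j).2 ⟨W, le_inf hi hj, (hE i).mono hi⟩
    ⟨V, le_inf (h.trans hi) (h.trans hj), (hE i).mono (h.trans hi)⟩ h s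
  b_res {i j W V} hi hj h s := (b i j).2 ⟨W, le_inf hi hj, (hE i).mono hi⟩
    ⟨V, le_inf (h.trans hi) (h.trans hj), (hE i).mono (h.trans hi)⟩ h s
  a_cocycle {i j l W} hi hj hl s := LinearMap.congr_fun (congrFun (congrArg Subtype.val
    (ha i j l)) ⟨W, le_inf (le_inf hi hj) hl, (hE i).mono hi⟩) s
  b_cocycle {i j l W} hi hj hl s := LinearMap.congr_fun (congrFun (congrArg Subtype.val
    (hb i j l)) ⟨W, le_inf (le_inf hi hj) hl, (hE i).mono hi⟩) s

variable (G : Gluing E.sheaf 𝔙.U)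

/-- The glued vector bundle over `V₂`. -/
noncomputable def bundle (hE : ∀ i, E.Triv (𝔙.U i)) : X.Bundle 2 where
  sheaf := G.mods
  eps := G.eps
  eps_pow := eps_three
  locally_free x := by
    obtain ⟨i, hi⟩ := 𝔙.covers x
    obtain ⟨r, e, he⟩ := hE i
    exact ⟨_, hi, r, _, isFrame_lift le_rfl he⟩

variable {G} {hE : ∀ i, E.Triv (𝔙.U i)}

theorem coef_change_zero {i j : κ} {W : Opens X.Pt} (hi : W ≤ 𝔙.U i) (hj : W ≤ 𝔙.U j)
    (s : Sec G.mods W) : G.coef i W hi 0 s = G.coef j W hj 0 s :=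
  GSec.co_zero (G := G) s hi hj le_rfl

theorem coef_change_one {i j : κ} {W : Opens X.Pt} (hi : W ≤ 𝔙.U i) (hj : W ≤ 𝔙.U j)
    (s : Sec G.mods W) :
    G.coef i W hi 1 s = G.coef j W hj 1 s + G.a i j W hi hj (G.coef j W hj 0 s) :=
  GSec.co_one (G := G) s hi hj le_rfl

variable (G hE)

/-- The operator `∇ + ε A + ε² B` on sections of `E`, in the chart `i`. -/
noncomputable def nabla₀ (N : Connection D E) (A B : ∀ i, EndForm E D (𝔙.U i)) (i : κ)
    (W : Opens X.Pt) (hi : W ≤ 𝔙.U i) : Sec E.sheaf W →+ Tw D G.mods W :=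
  AddMonoidHom.mk' (fun s =>
    (G.lift i W hi).rTensor (PolarForm D W) (N.nabla W ((hE i).mono hi) s) +
    (app G.eps W).rTensor (PolarForm D W) ((G.lift i W hi).rTensor (PolarForm D W)
      ((A i).1 ⟨W, hi, (hE i).mono hi⟩ s)) +
    (app G.eps W).rTensor (PolarForm D W) ((app G.eps W).rTensor (PolarForm D W)
      ((G.lift i W hi).rTensor (PolarForm D W) ((B i).1 ⟨W, hi, (hE i).mono hi⟩ s))))
    fun s t => by
      simp only [map_add]
      abel

/-- The connection `∇ + ε A + ε² B` in the chart `i`. -/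
noncomputable def nablaChart (N : Connection D E) (A B : ∀ i, EndForm E D (𝔙.U i)) (i : κ)
    (W : Opens X.Pt) (hi : W ≤ 𝔙.U i) : Sec G.mods W →+ Tw D G.mods W :=
  AddMonoidHom.mk' (fun s => G.nabla₀ hE N A B i W hi (G.coef i W hi 0 s) +
    (app G.eps W).rTensor (PolarForm D W) (G.nabla₀ hE N A B i W hi (G.coef i W hi 1 s)) +
    (app G.eps W).rTensor (PolarForm D W) ((app G.eps W).rTensor (PolarForm D W)
      (G.nabla₀ hE N A B i W hi (G.coef i W hi 2 s))))
    fun s t => by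
      simp only [map_add]
      abel

variable {G hE} {A B : ∀ i, EndForm E D (𝔙.U i)}

theorem nabla₀_apply {i : κ} {W : Opens X.Pt} (hi : W ≤ 𝔙.U i) (s : Sec E.sheaf W) :
    G.nabla₀ hE N A B i W hi s =
      (G.lift i W hi).rTensor (PolarForm D W) (N.nabla W ((hE i).mono hi) s) +
      (app G.eps W).rTensor (PolarForm D W) ((G.lift i W hi).rTensor (PolarForm D W)
        ((A i).1 ⟨W, hi, (hE i).mono hi⟩ s)) +
      (app G.eps W).rTensor (PolarForm D W) ((app G.eps W).rTensor (PolarForm D W)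
        ((G.lift i W hi).rTensor (PolarForm D W) ((B i).1 ⟨W, hi, (hE i).mono hi⟩ s))) := rfl

theorem nablaChart_apply {i : κ} {W : Opens X.Pt} (hi : W ≤ 𝔙.U i) (s : Sec G.mods W) :
    G.nablaChart hE N A B i W hi s = G.nabla₀ hE N A B i W hi (G.coef i W hi 0 s) +
      (app G.eps W).rTensor (PolarForm D W) (G.nabla₀ hE N A B i W hi (G.coef i W hi 1 s)) +
      (app G.eps W).rTensor (PolarForm D W) ((app G.eps W).rTensor (PolarForm D W)
        (G.nabla₀ hE N A B i W hi (G.coef i W hi 2 s))) := rfl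

theorem resTw_eps {W V : Opens X.Pt} (h : V ≤ W) (t : Tw D G.mods W) :
    resTw D G.mods h ((app G.eps W).rTensor (PolarForm D W) t) =
      (app G.eps V).rTensor (PolarForm D V) (resTw D G.mods h t) :=
  resTw_map D h _ _ (app_res G.eps h) t

theorem nabla₀_res {i : κ} {W V : Opens X.Pt} (hi : W ≤ 𝔙.U i) (h : V ≤ W) (s : Sec E.sheaf W) :
    G.nabla₀ hE N A B i V (h.trans hi) (res E.sheaf h s) =
      resTw D G.mods h (G.nabla₀ hE N A B i W hi s) := by
  have hl : ∀ t, resTw D G.mods h ((G.lift i W hi).rTensor (PolarForm D W) t) =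
      (G.lift i V (h.trans hi)).rTensor (PolarForm D V) (resTw D E.sheaf h t) :=
    resTw_map D h _ _ (lift_res hi h)
  simp only [nabla₀_apply, map_add, resTw_eps, hl,
    N.nabla_res ((hE i).mono hi) ((hE i).mono (h.trans hi)) h]
  rw [(A i).2 ⟨W, hi, (hE i).mono hi⟩ ⟨V, h.trans hi, (hE i).mono (h.trans hi)⟩ h,
    (B i).2 ⟨W, hi, (hE i).mono hi⟩ ⟨V, h.trans hi, (hE i).mono (h.trans hi)⟩ h]

theorem nablaChart_res {i : κ} {W V : Opens X.Pt} (hi : W ≤ 𝔙.U i) (h : V ≤ W)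
    (s : Sec G.mods W) : G.nablaChart hE N A B i V (h.trans hi) (res G.mods h s) =
      resTw D G.mods h (G.nablaChart hE N A B i W hi s) := by
  simp only [nablaChart_apply, coef_res hi h, nabla₀_res hi h, map_add, resTw_eps]

theorem nabla₀_smul {i : κ} {W : Opens X.Pt} (hi : W ≤ 𝔙.U i) (f : X.Fn W) (s : Sec E.sheaf W) :
    G.nabla₀ hE N A B i W hi (f • s) = f • G.nabla₀ hE N A B i W hi s +
      G.lift i W hi s ⊗ₜ dForm D f := by
  simp only [nabla₀_apply, N.leibniz, map_add, map_smul, LinearMap.rTensor_tmul, smul_add]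
  abel

theorem nablaChart_smul {i : κ} {W : Opens X.Pt} (hi : W ≤ 𝔙.U i) (f : X.Fn W)
    (s : Sec G.mods W) : G.nablaChart hE N A B i W hi (f • s) =
      f • G.nablaChart hE N A B i W hi s + s ⊗ₜ dForm D f := by
  -- The Leibniz term is split along `decomp`, to match the Leibniz terms of the three coefficients.
  have h : s ⊗ₜ[X.Fn W] dForm D f = G.lift i W hi (G.coef i W hi 0 s) ⊗ₜ dForm D f +
      app G.eps W (G.lift i W hi (G.coef i W hi 1 s)) ⊗ₜ dForm D f +
      app G.eps W (app G.eps W (G.lift i W hi (G.coef i W hi 2 s))) ⊗ₜ dForm D f := by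
    rw [← TensorProduct.add_tmul, ← TensorProduct.add_tmul, ← decomp]
  rw [h]
  simp only [nablaChart_apply, map_smul, nabla₀_smul, map_add, LinearMap.rTensor_tmul, smul_add]
  abel

theorem eps_three_tw {W : Opens X.Pt} (t : Tw D G.mods W) :
    (app G.eps W).rTensor (PolarForm D W) ((app G.eps W).rTensor (PolarForm D W)
      ((app G.eps W).rTensor (PolarForm D W) t)) = 0 := by
  rw [← LinearMap.comp_apply, ← LinearMap.comp_apply, ← LinearMap.rTensor_comp,
    ← LinearMap.rTensor_comp, show (app G.eps W ∘ₗ app G.eps W) ∘ₗ app G.eps W = 0 from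
      LinearMap.ext fun s => eps_three W s, LinearMap.rTensor_zero, LinearMap.zero_apply]

/-- Multiplication by ε moves each coefficient up by one; the summand that would be left over
carries ε³. -/
theorem nablaChart_eps {i : κ} {W : Opens X.Pt} (hi : W ≤ 𝔙.U i) (s : Sec G.mods W) :
    G.nablaChart hE N A B i W hi (app G.eps W s) =
      (app G.eps W).rTensor (PolarForm D W) (G.nablaChart hE N A B i W hi s) := by
  simp only [nablaChart_apply, coef_eps_zero, coef_eps_one, coef_eps_two, map_zero, map_add,
    eps_three_tw, zero_add, add_zero]

theorem nablaChart_lift {i : κ} {W : Opens X.Pt} (hi : W ≤ 𝔙.U i) (s : Sec E.sheaf W) :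
    G.nablaChart hE N A B i W hi (G.lift i W hi s) = G.nabla₀ hE N A B i W hi s := by
  simp only [nablaChart_apply, coef_lift_zero, coef_lift_one, coef_lift_two, a_self, b_self,
    map_zero, add_zero]

/-- Both sides commute with ε, so by `decomp` it is enough to compare them on sections lifted by the
chart j. There `gauge_formula` applies, and `hb` says that its error term is zero. -/
theorem nablaChart_eq
    (ha : ∀ (i j : κ) (W : Opens X.Pt) (hi : W ≤ 𝔙.U i) (hj : W ≤ 𝔙.U j) (t : E.Triv W)
      (s : Sec E.sheaf W), N.nabla W t (G.a i j W hi hj s) -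
        (G.a i j W hi hj).rTensor (PolarForm D W) (N.nabla W t s) =
        (A j).1 ⟨W, hj, t⟩ s - (A i).1 ⟨W, hi, t⟩ s)
    (hb : ∀ (i j : κ) (W : Opens X.Pt) (hi : W ≤ 𝔙.U i) (hj : W ≤ 𝔙.U j) (t : E.Triv W)
      (s : Sec E.sheaf W), (B i).1 ⟨W, hi, t⟩ s + (A i).1 ⟨W, hi, t⟩ (G.a i j W hi hj s) +
        (N.nabla W t (G.b i j W hi hj s) -
          (G.b i j W hi hj).rTensor (PolarForm D W) (N.nabla W t s)) -
        (G.a i j W hi hj).rTensor (PolarForm D W) ((A j).1 ⟨W, hj, t⟩ s) -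
        (B j).1 ⟨W, hj, t⟩ s = 0)
    {i j : κ} {W : Opens X.Pt} (hi : W ≤ 𝔙.U i) (hj : W ≤ 𝔙.U j) (s : Sec G.mods W) :
    G.nablaChart hE N A B i W hi s = G.nablaChart hE N A B j W hj s := by
  have h : ∀ s, G.nablaChart hE N A B i W hi (G.lift j W hj s) =
      G.nabla₀ hE N A B j W hj s := by
    intro s
    have e := gauge_formula (eps_three W) (lift_eq hi hj) (nablaChart_eps hi)
      (fun s => (nablaChart_lift (N := N) (A := A) (B := B) (hE := hE) hi s).trans
        (nabla₀_apply hi s))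
      (ha i j W hi hj ((hE i).mono hi)) (B' := (B j).1 ⟨W, hj, (hE i).mono hi⟩) s
    rw [hb, map_zero, map_zero, map_zero, add_zero] at e
    exact e
  conv_lhs => rw [decomp hj s]
  rw [map_add, map_add, nablaChart_eps, nablaChart_eps, nablaChart_eps, h, h, h,
    ← nablaChart_apply]

end Gluing

/-! ### Sufficiency: the extension over V₂ -/

/-- A local lift along a morphism whose kernel is `ε^n F`, normalized by means of a frame, is
unique; hence the morphism is surjective on open sets on which `F` is free. -/
theorem Bundle.Triv.surjective_of_locally {n : ℕ} {F : X.Bundle n} {F' : X.Mods} (π : F.sheaf ⟶ F')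
    {U : Opens X.Pt} (hU : F.Triv U)
    (hker : ∀ V s, app π V s = 0 → app F.eps V s = 0)
    (hpow : ∀ V s, app π V (((app F.eps V) ^ n) s) = 0)
    (hloc : ∀ x ∈ U, ∃ V ≤ U, x ∈ V ∧ Function.Surjective (app π V)) :
    Function.Surjective (app π U) := by
  intro t
  obtain ⟨κ, μ, hκ1, hκ2, hμκ, hκres⟩ := hU.exists_shift
  have ex : ∀ x ∈ U, ∃ V : Opens X.Pt, V ≤ U ∧ x ∈ V ∧ ∃ (s : Sec F.sheaf V) (h : V ≤ U),
      app π V s = res F' h t ∧ κ V h s = 0 := fun x hx => by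
    obtain ⟨V, hV, hxV, hs⟩ := hloc x hx
    obtain ⟨s, hs⟩ := hs (res F' hV t)
    -- The correction ε^n κ s is invisible to π and normalizes the lift: κ (s - ε^n κ s) = ε μ κ s =
    -- 0.
    refine ⟨V, hV, hxV, s - ((app F.eps V) ^ n) (κ V hV s), hV, ?_, ?_⟩
    · rw [map_sub, hpow, sub_zero, hs]
    · have e := LinearMap.congr_fun (hκ2 V hV) (κ V hV s)
      have e' : μ V hV (κ V hV s) = 0 := LinearMap.congr_fun (hμκ V hV) s
      rw [LinearMap.add_apply, Module.End.mul_apply, Module.End.mul_apply, e', map_zero,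
        add_zero] at e
      rw [map_sub]
      exact sub_eq_zero.2 e.symm
  obtain ⟨s, hs⟩ := Sec.exists_of_unique F.sheaf (U := U)
    (fun V s => ∃ h : V ≤ U, app π V s = res F' h t ∧ κ V h s = 0)
    (by
      rintro V W h s ⟨hV, hs, hs'⟩
      exact ⟨h.trans hV, by rw [app_res, hs, res_res], by rw [hκres V W hV h, hs', map_zero]⟩)
    (by
      rintro V hV s s' ⟨_, hs, hs0⟩ ⟨_, hs', hs0'⟩
      have e0 : κ V hV (s - s') = 0 := by rw [map_sub, hs0, hs0', sub_zero]
      have e1 : app F.eps V (s - s') = 0 := hker V _ (by rw [map_sub, hs, hs', sub_self])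
      -- The difference of two normalized lifts is killed by κ and, lying in the kernel of π, by ε;
      -- hence it is zero, as ε^n κ + μ ε = 1.
      have e := LinearMap.congr_fun (hκ1 V hV) (s - s')
      rw [LinearMap.add_apply, Module.End.mul_apply, Module.End.mul_apply, e0, e1, map_zero,
        map_zero, add_zero] at e
      exact sub_eq_zero.1 e.symm) ex
  refine ⟨s, Sec.eq_of_locally_eq _ _ _ fun x hx => ?_⟩
  obtain ⟨V, hV, hxV, s', h', hs', hs0⟩ := ex x hx
  refine ⟨V, hV, hxV, ?_⟩
  rw [← app_res, hs V hV s' ⟨h', hs', hs0⟩, hs']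

/-- When ε s = 0, the identity ε^n κ + μ ε = 1 reads s = ε^n κ s. -/
theorem Bundle.Triv.exists_eq_pow {n : ℕ} {F : X.Bundle n} {U : Opens X.Pt} (hU : F.Triv U)
    {s : Sec F.sheaf U} (hs : app F.eps U s = 0) : ∃ t, s = ((app F.eps U) ^ n) t := by
  obtain ⟨κ, μ, hκ, -⟩ := hU.exists_shift
  refine ⟨κ U le_rfl s, ?_⟩
  have e := LinearMap.congr_fun (hκ U le_rfl) s
  rw [LinearMap.add_apply, Module.End.mul_apply, Module.End.mul_apply, hs, map_zero,
    add_zero] at e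
  exact e.symm

/-- The first order deformation extends over `V₂` if there are second order terms `b`, `B` for the
transition functions and the connection forms. -/
theorem exists_extension {E₁ : X.Bundle 1} {N₁ : Connection D E₁} (ρ : Reduction N₁ N)
    (z : N.endPair.Z₁ 𝔙) (hz : IsGivenBy ρ 𝔙 z) (hE : ∀ i, E.Triv (𝔙.U i))
    (hE₁ : ∀ i, E₁.Triv (𝔙.U i)) {y : N.endPair.L₁ 𝔙}
    (hy : N.endPair.D₁ 𝔙 y = N.endPair.cup 𝔙 z.1 z.1) :
    ∃ (E₂ : X.Bundle 2) (N₂ : Connection D E₂), Nonempty (Reduction N₂ N₁) := by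
  obtain ⟨ψ', h1, h2, h3, h4⟩ := hz
  obtain ⟨hz0, hz1⟩ := (N.endPair.mem_Z₁ z.1).1 z.2
  let a : ∀ i j, EndSec E (𝔙.U₂ i j) := z.1.1
  let A : ∀ i, EndForm E D (𝔙.U i) := z.1.2
  let b' : ∀ i j, EndSec E (𝔙.U₂ i j) := y.1
  let B' : ∀ i, EndForm E D (𝔙.U i) := y.2
  -- The cochain y bounds the cup square, while the gluing conditions require D(-(b, B)) to be the
  -- cup square; hence the sign.
  let b : ∀ i j, EndSec E (𝔙.U₂ i j) := fun i j => -b' i j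
  let B : ∀ i, EndForm E D (𝔙.U i) := fun i => -B' i
  let G : Gluing E.sheaf 𝔙.U := Gluing.ofEnd hE a b hz0 fun i j l => by
    have e : resEnd E (𝔙.le₃₁₂ i j l) (b' j l) -
        resEnd E (𝔙.le₃₀₂ i j l) (b' i l) +
        resEnd E (𝔙.le₃₀₁ i j l) (b' i j) =
        resEnd E (𝔙.le₃₀₁ i j l) (a i j) * resEnd E (𝔙.le₃₁₂ i j l) (a j l) :=
      congrFun (congrFun (congrFun (congrArg Prod.fst hy) i) j) l
    rw [← e]
    change -resEnd E (𝔙.le₃₀₂ i j l) (b' i l) = -resEnd E (𝔙.le₃₀₁ i j l) (b' i j) +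
      -resEnd E (𝔙.le₃₁₂ i j l) (b' j l) + _
    abel
  have ha : ∀ (i j : κ) (W : Opens X.Pt) (hi : W ≤ 𝔙.U i) (hj : W ≤ 𝔙.U j) (t : E.Triv W)
      (s : Sec E.sheaf W), N.nabla W t (G.a i j W hi hj s) -
        (G.a i j W hi hj).rTensor (PolarForm D W) (N.nabla W t s) =
        (A j).1 ⟨W, hj, t⟩ s - (A i).1 ⟨W, hi, t⟩ s := fun i j W hi hj t s =>
    LinearMap.congr_fun (congrFun (congrArg Subtype.val (hz1 i j)) ⟨W, le_inf hi hj, t⟩) s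
  have hb : ∀ (i j : κ) (W : Opens X.Pt) (hi : W ≤ 𝔙.U i) (hj : W ≤ 𝔙.U j) (t : E.Triv W)
      (s : Sec E.sheaf W), (B i).1 ⟨W, hi, t⟩ s + (A i).1 ⟨W, hi, t⟩ (G.a i j W hi hj s) +
        (N.nabla W t (G.b i j W hi hj s) -
          (G.b i j W hi hj).rTensor (PolarForm D W) (N.nabla W t s)) -
        (G.a i j W hi hj).rTensor (PolarForm D W) ((A j).1 ⟨W, hj, t⟩ s) -
        (B j).1 ⟨W, hj, t⟩ s = 0 := fun i j W hi hj t s => by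
    let c : Module.End (X.Fn W) (Sec E.sheaf W) :=
      (b' i j).1 ⟨W, le_inf hi hj, t⟩
    let C : ∀ i (_ : W ≤ 𝔙.U i), Sec E.sheaf W →ₗ[X.Fn W] Tw D E.sheaf W := fun i hi =>
      (B' i).1 ⟨W, hi, t⟩
    have e : C j hj s - C i hi s - (N.nabla W t (c s) -
        c.rTensor (PolarForm D W) (N.nabla W t s)) =
        (G.a i j W hi hj).rTensor (PolarForm D W) ((A j).1 ⟨W, hj, t⟩ s) -
          (A i).1 ⟨W, hi, t⟩ (G.a i j W hi hj s) :=
      LinearMap.congr_fun (congrFun (congrArg Subtype.val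
        (congrFun (congrFun (congrArg Prod.snd hy) i) j)) ⟨W, le_inf hi hj, t⟩) s
    change -C i hi s + (A i).1 ⟨W, hi, t⟩ (G.a i j W hi hj s) +
      (N.nabla W t (-c s) - (-c).rTensor (PolarForm D W) (N.nabla W t s)) -
        (G.a i j W hi hj).rTensor (PolarForm D W) ((A j).1 ⟨W, hj, t⟩ s) - -C j hj s = 0
    rw [map_neg, LinearMap.rTensor_neg, LinearMap.neg_apply]
    rw [← sub_eq_zero] at e
    rw [← e]
    abel
  let E₂ : X.Bundle 2 := G.bundle hE
  obtain ⟨N₂, hN₂⟩ := exists_glued_connection (D := D) 𝔙 E₂ (G.nablaChart hE N A B)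
    (fun i W V hi h s => Gluing.nablaChart_res hi h s)
    (fun i j W hi hj s => Gluing.nablaChart_eq ha hb hi hj s)
    (fun i W hi f s => Gluing.nablaChart_smul hi f s)
    (fun i W hi s => Gluing.nablaChart_eps hi s)
  -- the projection to the first order deformation
  let ψ : ∀ (i : κ) (W : Opens X.Pt), W ≤ 𝔙.U i → (Sec E.sheaf W →ₗ[X.Fn W] Sec E₁.sheaf W) :=
    fun i W hi => ψ' i W hi ((hE i).mono hi) ((hE₁ i).mono hi)
  have hψ : ∀ i j W hi hj s, ψ j W hj s =
      ψ i W hi s + app E₁.eps W (ψ i W hi (G.a i j W hi hj s)) := fun i j W hi hj s =>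
    h3 i j W (le_inf hi hj) ((hE i).mono hi) ((hE₁ i).mono hi) s
  have heps : ∀ W s, app E₁.eps W (app E₁.eps W s) = 0 := fun W s => E₁.eps_pow W s
  obtain ⟨π, hπ⟩ := exists_glued_hom 𝔙 (F := G.mods) (F' := E₁.sheaf)
    -- In the chart i this forgets the ε² term and applies the trivialization of E₁ to s₀ + ε s₁.
    (fun i W hi => ψ i W hi ∘ₗ G.coef i W hi 0 + app E₁.eps W ∘ₗ ψ i W hi ∘ₗ G.coef i W hi 1)
    (fun i W V hi h s => by
      simp only [LinearMap.add_apply, LinearMap.comp_apply, Gluing.coef_res hi h]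
      rw [map_add, ← app_res, ← h1 i W V hi h _ _ ((hE i).mono (h.trans hi))
        ((hE₁ i).mono (h.trans hi)), ← h1 i W V hi h _ _ ((hE i).mono (h.trans hi))
        ((hE₁ i).mono (h.trans hi))])
    -- The changes of s₁ and of ψ between the charts cancel modulo ε², which is zero on E₁.
    (fun i j W hi hj s => by
      simp only [LinearMap.add_apply, LinearMap.comp_apply]
      rw [hψ i j W hi hj, hψ i j W hi hj, Gluing.coef_change_zero hi hj,
        Gluing.coef_change_one hi hj]
      simp only [map_add, heps, add_zero]
      abel)
  simp only [LinearMap.add_apply, LinearMap.comp_apply] at hπ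
  have hπeps : ∀ (U : Opens X.Pt) (s : Sec G.mods U),
      app π U (app G.eps U s) = app E₁.eps U (app π U s) := by
    intro U s
    refine Sec.eq_of_locally_eq _ _ _ fun x hx => ?_
    obtain ⟨i, hi⟩ := DGPair.Cover.exists_inf_mem 𝔙 hx
    refine ⟨_, inf_le_left, hi, ?_⟩
    rw [← app_res, ← app_res, ← app_res, ← app_res, hπ i _ inf_le_right, hπ i _ inf_le_right,
      Gluing.coef_eps_zero, Gluing.coef_eps_one, map_zero, zero_add, map_add, heps, add_zero]
  -- Reducing further to `E` shows s₀ = 0, then s₁ = 0; only the ε² term remains, and ε kills it.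
  have hcoef : ∀ (i : κ) (W : Opens X.Pt) (hi : W ≤ 𝔙.U i) (s : Sec G.mods W), app π W s = 0 →
      app G.eps W s = 0 := by
    intro i W hi s hs
    rw [hπ i W hi] at hs
    have h0 : G.coef i W hi 0 s = 0 := by
      have := congrArg (app ρ.π W) hs
      rwa [map_add, ρ.π_eps, app_eps_zero, add_zero, h2, map_zero] at this
    rw [h0, map_zero, zero_add] at hs
    -- Here ε ψ(s₁) = 0, so κ ε + ε μ = 1 makes ψ(s₁) a multiple of ε, and its reduction s₁ to `E`
    -- vanishes.
    obtain ⟨κ', μ', -, hκ, -⟩ := ((hE₁ i).mono hi).exists_shift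
    have h10 : G.coef i W hi 1 s = 0 := by
      have e := congrArg (app ρ.π W) (LinearMap.congr_fun (hκ W le_rfl) (ψ i W hi (G.coef i W hi 1 s)))
      rw [LinearMap.add_apply, Module.End.mul_apply, Module.End.mul_apply, pow_one, hs, map_zero,
        zero_add, ρ.π_eps, app_eps_zero, Module.End.one_apply, h2] at e
      exact e.symm
    refine Gluing.ext_coef' hi ?_ ?_ ?_
    · rw [Gluing.coef_eps_zero, map_zero]
    · rw [Gluing.coef_eps_one, map_zero, h0]
    · rw [Gluing.coef_eps_two, map_zero, h10]
  have hker : ∀ U : Opens X.Pt, ∀ s : Sec G.mods U, app π U s = 0 → app G.eps U s = 0 := by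
    intro U s hs
    refine Sec.eq_of_locally_eq _ _ _ fun x hx => ?_
    obtain ⟨i, hi⟩ := DGPair.Cover.exists_inf_mem 𝔙 hx
    refine ⟨_, inf_le_left, hi, ?_⟩
    rw [← app_res, map_zero]
    exact hcoef i _ inf_le_right _ (by rw [app_res, hs, map_zero])
  have hπ2 : ∀ U s, app π U (((app G.eps U) ^ 2) s) = 0 := fun U s => by
    rw [pow_two, Module.End.mul_apply, hπeps, hπeps, heps]
  have hliftπ : ∀ (i : κ) (W : Opens X.Pt) (hi : W ≤ 𝔙.U i) (s : Sec E.sheaf W),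
      app π W (G.lift i W hi s) = ψ i W hi s := fun i W hi s => by
    rw [hπ i W hi, Gluing.coef_lift_zero, Gluing.coef_lift_one, Gluing.a_self, map_zero, map_zero,
      add_zero]
  have hsurj : ∀ (i : κ) (W : Opens X.Pt) (_ : W ≤ 𝔙.U i), Function.Surjective (app π W) := by
    intro i W hi t
    -- Applied to t and then to u, this gives t = ψ(ρ t) + ε ψ(ρ u) + ε² v, and the last term is
    -- zero in E₁.
    have hk : ∀ t, ∃ u, t - ψ i W hi (app ρ.π W t) = app E₁.eps W u := fun t => by
      obtain ⟨u, hu⟩ := (ρ.ker W ((hE₁ i).mono hi) (t - ψ i W hi (app ρ.π W t))).1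
        (by rw [map_sub, h2, sub_self])
      exact ⟨u, hu.trans (by rw [zero_add, pow_one])⟩
    obtain ⟨u, hu⟩ := hk t
    obtain ⟨v, hv⟩ := hk u
    refine ⟨G.lift i W hi (app ρ.π W t) + app G.eps W (G.lift i W hi (app ρ.π W u)), ?_⟩
    rw [map_add, hπeps, hliftπ, hliftπ, eq_add_of_sub_eq hu, eq_add_of_sub_eq hv]
    simp only [map_add, heps, zero_add, h2, ρ.π_eps, app_eps_zero, ψ]
    rw [add_comm]
  have hnabla : ∀ (i : κ) (W : Opens X.Pt) (hi : W ≤ 𝔙.U i) (t₁ : E₁.Triv W) (s : Sec G.mods W),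
      N₁.nabla W t₁ (app π W s) =
        (app π W).rTensor (PolarForm D W) (G.nablaChart hE N A B i W hi s) := by
    intro i W hi t₁ s
    have e1 : ∀ t : Tw D G.mods W, (app π W).rTensor (PolarForm D W)
        ((app G.eps W).rTensor (PolarForm D W) t) = (app E₁.eps W).rTensor (PolarForm D W)
          ((app π W).rTensor (PolarForm D W) t) := fun t => by
      rw [← LinearMap.comp_apply, ← LinearMap.comp_apply, ← LinearMap.rTensor_comp,
        ← LinearMap.rTensor_comp, show app π W ∘ₗ app G.eps W = app E₁.eps W ∘ₗ app π W
          from LinearMap.ext (hπeps W)]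
    have e2 : ∀ t : Tw D E.sheaf W, (app π W).rTensor (PolarForm D W)
        ((G.lift i W hi).rTensor (PolarForm D W) t) = (ψ i W hi).rTensor (PolarForm D W) t :=
      fun t => by
        rw [← LinearMap.comp_apply, ← LinearMap.rTensor_comp, show app π W ∘ₗ G.lift i W hi = ψ i W hi
          from LinearMap.ext (hliftπ i W hi)]
    have e3 : ∀ t : Tw D E₁.sheaf W, (app E₁.eps W).rTensor (PolarForm D W)
        ((app E₁.eps W).rTensor (PolarForm D W) t) = 0 := fun t => by
      rw [← LinearMap.comp_apply, ← LinearMap.rTensor_comp, show app E₁.eps W ∘ₗ app E₁.eps W = 0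
        from LinearMap.ext (heps W), LinearMap.rTensor_zero, LinearMap.zero_apply]
    have e4 : ∀ s, N₁.nabla W t₁ (ψ i W hi s) =
        (ψ i W hi).rTensor (PolarForm D W) (N.nabla W ((hE i).mono hi) s) +
        (app E₁.eps W).rTensor (PolarForm D W) ((ψ i W hi).rTensor (PolarForm D W)
          ((A i).1 ⟨W, hi, (hE i).mono hi⟩ s)) := fun s => by
      refine (h4 i W hi ((hE i).mono hi) ((hE₁ i).mono hi) s).trans ?_
      rw [LinearMap.rTensor_comp]
      rfl
    -- All terms with B, and those with the coefficient s₂, carry ε² and disappear in E₁, leaving ∇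
    -- + ε A_i on s₀ + ε s₁.
    rw [hπ i W hi, map_add, N₁.nabla_eps, e4, e4]
    simp only [Gluing.nablaChart_apply, Gluing.nabla₀_apply, map_add, e1, e2, e3]
    have e5 : (app E₁.eps W).rTensor (PolarForm D W) (0 : Tw D E₁.sheaf W) = 0 :=
      LinearMap.map_zero _
    simp only [e5, add_zero]
  refine ⟨E₂, N₂, ⟨⟨π, hπeps, fun U hU t => ?_, fun U hU s => ⟨fun hs => ?_, ?_⟩,
    fun U hU' hU s => ?_⟩⟩⟩
  -- U is any open set on which the glued bundle is free; it need not lie in a chart.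
  · refine Bundle.Triv.surjective_of_locally (F := G.bundle hE) (F' := E₁.sheaf) π hU hker hπ2
      (fun x hx => ?_) t
    obtain ⟨i, hi⟩ := DGPair.Cover.exists_inf_mem 𝔙 hx
    exact ⟨_, inf_le_left, hi, hsurj i _ inf_le_right⟩
  · exact Bundle.Triv.exists_eq_pow (F := G.bundle hE) hU (hker U s hs)
  · rintro ⟨t, rfl⟩
    exact hπ2 U t
  -- Horizontality is checked chart by chart; triviality of E₁ over U makes this sufficient.
  · refine Tw.eq_of_locally_eq hU _ _ fun x hx => ?_
    obtain ⟨i, hi⟩ := DGPair.Cover.exists_inf_mem 𝔙 hx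
    refine ⟨_, inf_le_left, hi, ?_⟩
    have hW : U ⊓ 𝔙.U i ≤ 𝔙.U i := inf_le_right
    have e := N₂.nabla_res hU' (hU'.mono inf_le_left) (inf_le_left : U ⊓ 𝔙.U i ≤ U) s
    rw [hN₂ i _ hW] at e
    have e₁ : res E₁.sheaf inf_le_left (app π U s) =
        app π (U ⊓ 𝔙.U i) (res G.mods inf_le_left s) :=
      (app_res (E := G.mods) π inf_le_left s).symm
    have e₂ : ∀ t : Tw D G.mods U, resTw D E₁.sheaf inf_le_left
        ((app π U).rTensor (PolarForm D U) t) =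
        (app π (U ⊓ 𝔙.U i)).rTensor (PolarForm D _) (resTw D G.mods inf_le_left t) :=
      resTw_map D inf_le_left _ _ (app_res (E := G.mods) π inf_le_left)
    refine (N₁.nabla_res hU (hU.mono inf_le_left) inf_le_left _).symm.trans ?_
    refine ((congrArg (N₁.nabla _ _) e₁).trans (hnabla i _ hW _ _)).trans ?_
    exact (congrArg ((app π (U ⊓ 𝔙.U i)).rTensor (PolarForm D _)) e).trans (e₂ _).symm

end KSpace

/-! ### The theorem -/

theorem KSpace.Bundle.exists_triv {k : Type u} [Field k] {X : KSpace k} {n : ℕ} (E : X.Bundle n)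
    (x : X.Pt) : ∃ U : Opens X.Pt, x ∈ U ∧ E.Triv U := by
  obtain ⟨U, hx, r, e, he⟩ := E.locally_free x
  exact ⟨U, hx, r, e, he⟩

theorem mainTheorem9 {k : Type u} [Field k] [IsAlgClosed k] (X : KSpace k)
    (hX : X.IsCompleteScheme ∨ X.IsComplexSpace) (D : X.CartierDivisor)
    (E : X.Bundle 0) (N : KSpace.Connection D E)
    {ι : Type u} (𝔘 : DGPair.Cover X.toLRS.toTopCat ι) (z : N.endPair.Z₁ 𝔘)
    (E₁ : X.Bundle 1) (N₁ : KSpace.Connection D E₁) (ρ : KSpace.Reduction N₁ N)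
    (hz : KSpace.IsGivenBy ρ 𝔘 z) :
    (∃ (E₂ : X.Bundle 2) (N₂ : KSpace.Connection D E₂), Nonempty (KSpace.Reduction N₂ N₁)) ↔
      N.endPair.yoneda (DGPair.cls z) (DGPair.cls z) = 0 := by
  choose B hB hBE using E.exists_triv
  choose B₁ hB₁ hBE₁ using E₁.exists_triv
  constructor
  · rintro ⟨E₂, N₂, ⟨π⟩⟩
    choose B₂ hB₂ hBE₂ using E₂.exists_triv
    -- The covering has to trivialize the extension E₂ as well, since the coefficients of ε² are
    -- extracted by frames of E₂.
    let C : X.Pt → Opens X.Pt := fun x => B x ⊓ (B₁ x ⊓ B₂ x)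
    have hC : ∀ x, x ∈ C x := fun x => ⟨hB x, hB₁ x, hB₂ x⟩
    let 𝔙 : DGPair.PCover X.toLRS.toTopCat :=
      ⟨fun x => 𝔘.toPCover.U x ⊓ C x, fun x => ⟨𝔘.toPCover.mem x, hC x⟩⟩
    have h : ∀ x, 𝔙.U x ≤ 𝔘.U (𝔘.index x) := fun x => inf_le_left
    have hV : ∀ x, 𝔙.U x ≤ C x := fun x => inf_le_right
    obtain ⟨y, hy⟩ := KSpace.exists_D₁_eq_cup ρ 𝔙.toCover
      (N.endPair.pullZ₁ (𝔙 := 𝔙.toCover) 𝔘.index h z) (hz.pull (𝔙 := 𝔙.toCover) 𝔘.index h)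
      (fun x => (hBE x).mono ((hV x).trans inf_le_left))
      (fun x => (hBE₁ x).mono ((hV x).trans (inf_le_right.trans inf_le_left)))
      (fun x => (hBE₂ x).mono ((hV x).trans (inf_le_right.trans inf_le_right))) π
    exact (DGPair.yoneda_cls_self_eq_zero_iff z C hC).2 ⟨𝔙, 𝔘.index, h, hV, y, hy⟩
  · intro H
    -- In this direction E₂ is built from E, so only E and E₁ must be trivial on the covering.
    obtain ⟨𝔙, τ, h, hV, y, hy⟩ := (DGPair.yoneda_cls_self_eq_zero_iff z
      (fun x : X.Pt => B x ⊓ B₁ x) fun x => ⟨hB x, hB₁ x⟩).1 H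
    exact KSpace.exists_extension ρ (N.endPair.pullZ₁ (𝔙 := 𝔙.toCover) τ h z)
      (hz.pull (𝔙 := 𝔙.toCover) τ h) (fun x => (hBE x).mono ((hV x).trans inf_le_left))
      (fun x => (hBE₁ x).mono ((hV x).trans inf_le_right)) hy
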